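/- **Conventions.** All C*-algebras are finite-dimensional, complex and unital, and sub-C*-algebras contain the unit of the ambient algebra. A *factor* is a non-zero C*-algebra whose centre is $\mathbb C\,\mathrm{id}$. For a sub-C*-algebra $\mathcal A$ of an algebra, $\mathcal A'$ is its commutant and $\mathcal Z(\mathcal A)=\mathcal A\cap\mathcal A'$ its centre; $\vee$ denotes the generated algebra; an *atomic projector* of a commutative algebra is a minimal non-zero orthogonal projector. *Graphs.* On the circle $\mathbb R/N\mathbb Z$ with its arc distance $d$, let $\Gamma_N=\{0,1,\dots,N-1\}$, $\Gamma_N^{+1/2}=\{\tfrac12,\tfrac32,\dots,N-\tfrac12\}$ and $\Gamma_N^{\mathrm{fine}}=\{n\pm\tfrac14 : n\in\Gamma_N\}=\{n\pm\tfrac14 : n\in\Gamma_N^{+1/2}\}$, each with its cyclic graph structure. For a set $S$ of points and $t\ge 0$, $S\pm t$ is the set of the vertices (of the graph under consideration) at distance at most $t$ from $S$. *Partitions.* Sub-C*-algebras $\mathcal A_1,\mathcal A_2\subseteq\mathcal B$ form a bipartition, $(\mathcal A_1,\mathcal A_2)\vdash\mathcal B$, if $\pi(\mathcal A_1'\cap\mathcal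 B)=\pi\mathcal A_2$ for every atomic projector $\pi$ of $\mathcal Z(\mathcal B)$, and $\mathcal Z(\mathcal B)\subseteq\mathcal Z(\mathcal A_1)\vee\mathcal Z(\mathcal A_2)$. A *partition* of $\Omega$ over a graph $\Gamma$ is a family $(\mathcal A_S)_{S\subseteq\Gamma}$ of sub-C*-algebras of $\Omega$ with $\mathcal A_\emptyset=\mathbb C\,\mathrm{id}$, $\mathcal A_\Gamma=\Omega$, and $(\mathcal A_S,\mathcal A_T)\vdash\mathcal A_{S\sqcup T}$ for all disjoint $S,T\subseteq\Gamma$. Write $\mathcal Z_S=\mathcal Z(\mathcal A_S)$. The partition is *strongly connected* if, for every interval $[m,n]\subsetneq\Gamma$ (with $m^-$ the predecessor of $m$ and $n^+$ the successor of $n$ in the cyclic graph), $\mathcal Z_{[m,n]}=(\mathcal Z_{m^-}\cap\mathcal Z_m)\vee(\mathcal Z_n\cap\mathcal Z_{n^+})$. It has *correlation length at most* $l$ if, for all $S\subseteq\Gamma$, all non-zero $a\in\mathcal A_S$ and all non-zero $b\in\mathcal A_{\Gamma\setminus(S\pm l)}$, one has $ab\neq0$. *QCAs.* A generalised 1D QCA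 of causality radius $r$, from a strongly connected partition $(\mathcal A_S)_{S\subseteq\Gamma}$ of a factor $\Omega$ to a strongly connected partition $(\mathcal B_S)_{S\subseteq\Gamma'}$ of a factor $\Omega'$, is a $*$-isomorphism $\mathcal U:\Omega\to\Omega'$ with $\mathcal U(\mathcal A_S)\subseteq\mathcal B_{S\pm r}$ for all $S\subseteq\Gamma$. If $\Gamma\in\{\Gamma_N,\Gamma_N^{+1/2}\}$ and $\Gamma'=\Gamma_N^{\mathrm{fine}}$, it is a *fine-graining* if $\mathcal U(\mathcal A_S)=\mathcal B_{S\pm1/4}$ for all $S\subseteq\Gamma$; if $\Gamma=\Gamma_N^{\mathrm{fine}}$ and $\Gamma'\in\{\Gamma_N,\Gamma_N^{+1/2}\}$, it is a *coarse-graining* if $\mathcal U(\mathcal A_{S\pm1/4})=\mathcal B_S$ for all $S\subseteq\Gamma'$. **Theorem.** Let $r\in\{\tfrac12,1,\tfrac32,\dots\}$ and $l,l',N\in\mathbb N$ with $N>4r+2(l+l')$. Let $\Gamma,\Gamma'\in\{\Gamma_N,\Gamma_N^{+1/2}\}$, with $\Gamma=\Gamma'$ if $r$ is an integer and $\Gamma\ne\Gamma'$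 otherwise. Let $\mathcal U$ be a generalised 1D QCA of causality radius $r$, from a strongly connected partition of a factor over $\Gamma$ with correlation length at most $l$ to a strongly connected partition of a factor over $\Gamma'$ with correlation length at most $l'$. Then there are $2r$ generalised 1D QCAs $\mathcal U_1,\dots,\mathcal U_{2r}$ of causality radius $\tfrac12$, each from a strongly connected partition of a factor over one of the graphs $\Gamma_N,\Gamma_N^{+1/2}$ to one over the other, such that $$\mathcal U=\mathcal U_{2r}\cdots\mathcal U_1 ,$$ the input partition of $\mathcal U_1$ and the output partition of $\mathcal U_{2r}$ being those of $\mathcal U$, and the output partition of $\mathcal U_i$ being the input partition of $\mathcal U_{i+1}$. Moreover each $\mathcal U_i=\mathcal U_i^{\mathrm{coarse}}\,\mathcal U_i^{\mathrm{fine}}$, where $\mathcal U_i^{\mathrm{fine}}$ is a fine-graining to, and $\mathcal U_i^{\mathrm{coarse}}$ a coarse-graining from, a strongly connected partition of a factor over $\Gamma_N^{\mathrm{fine}}$. The case $l=l'=0$ is that of QCAs between factorisations. -/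

import Mathlib

/-!
Positions on a circle of circumference `N` are measured in units of one quarter: the element `x` of
`ZMod (4 * N)` stands for the point `x / 4` of `ℝ / N ℤ`. In particular a length `t` is represented
by the natural number `4 * t`.
-/

/-- The points of a circle of circumference `N` whose coordinate is a multiple of `1/4`. -/
abbrev Pos (N : ℕ) : Type := ZMod (4 * N)

/-- Four times the distance of two points along the circle of circumference `N`. -/
def circleDist {N : ℕ} (x y : Pos N) : ℕ := (x - y).valMinAbs.natAbs

/-- The cyclic graphs used: `coarse 0` is `Γ_N = {0, 1, …, N - 1}`, `coarse 1` is
`Γ_N^{+1/2} = {1/2, 3/2, …, N - 1/2}`, and `fine` is `Γ_N^fine = {n ± 1/4 | n ∈ Γ_N}`. -/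
inductive CyclicGraph : Type
  | coarse (b : ZMod 2)
  | fine

namespace CyclicGraph

/-- The set of vertices. -/
def verts (N : ℕ) : CyclicGraph → Set (Pos N)
  | coarse b => {x | x.val % 4 = 2 * b.val}
  | fine => {x | x.val % 2 = 1}

/-- Four times the distance between a vertex and its two neighbours: the neighbours of a vertex `m`
are `m - step` and `m + step`. -/
def step : CyclicGraph → ℕ
  | coarse _ => 4
  | fine => 2

/-- `S ± ρ/4`, as a set of vertices of `G`. -/
def nbhd {N : ℕ} (G : CyclicGraph) (S : Set (Pos N)) (ρ : ℕ) : Set (Pos N) :=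
  {x | x ∈ G.verts N ∧ ∃ y ∈ S, circleDist x y ≤ ρ}

/-- The `k`-th successor of the vertex `m`. -/
def succ {N : ℕ} (G : CyclicGraph) (m : Pos N) (k : ℕ) : Pos N :=
  m + ((G.step * k : ℕ) : Pos N)

/-- The predecessor of the vertex `m`. -/
def pred {N : ℕ} (G : CyclicGraph) (m : Pos N) : Pos N :=
  m - (G.step : Pos N)

/-- The interval from the vertex `m` to its `k`-th successor. -/
def interval {N : ℕ} (G : CyclicGraph) (m : Pos N) (k : ℕ) : Set (Pos N) :=
  {x | ∃ j ≤ k, x = G.succ m j}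

end CyclicGraph

section Algebras

variable {Ω : Type*} [CStarAlgebra Ω]

/-- The commutant of a sub-C⋆-algebra. -/
def commutant (A : StarSubalgebra ℂ Ω) : StarSubalgebra ℂ Ω :=
  StarSubalgebra.centralizer ℂ (A : Set Ω)

/-- The centre of a sub-C⋆-algebra, as a sub-C⋆-algebra of the ambient algebra. -/
def centre (A : StarSubalgebra ℂ Ω) : StarSubalgebra ℂ Ω :=
  A ⊓ commutant A

/-- `p` is an atomic projector of `C`: a minimal non-zero orthogonal projector. -/
structure IsAtomProj (C : StarSubalgebra ℂ Ω) (p : Ω) : Prop where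
  mem : p ∈ C
  proj : IsStarProjection p
  ne_zero : p ≠ 0
  minimal : ∀ q ∈ C, IsStarProjection q → p * q = q → q = 0 ∨ q = p

/-- `(A₁, A₂) ⊢ B`: inside every block of `B`, the algebras `A₁` and `A₂` are each other's
commutants, and the centre of `B` is contained in the algebra generated by those of `A₁` and `A₂`
(the condition on commutants is symmetric in `A₁` and `A₂`, since every block of `B` is a factor). -/
structure IsBipartition (A₁ A₂ B : StarSubalgebra ℂ Ω) : Prop where
  left_le : A₁ ≤ B
  right_le : A₂ ≤ B
  comm_condition : ∀ p, IsAtomProj (centre B) p →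
    (fun x => p * x) '' ((commutant A₁ ⊓ B : StarSubalgebra ℂ Ω) : Set Ω) =
      (fun x => p * x) '' (A₂ : Set Ω)
  centre_condition : centre B ≤ centre A₁ ⊔ centre A₂

/-- The algebras `A S`, for `S` a subset of `V`, form a partition of `Ω` (the value of `A` on sets
not contained in `V` is irrelevant). -/
structure IsPartition {P : Type*} (V : Set P) (A : Set P → StarSubalgebra ℂ Ω) : Prop where
  empty : A ∅ = ⊥
  whole : A V = ⊤
  bipartition : ∀ S T : Set P, S ⊆ V → T ⊆ V → Disjoint S T → IsBipartition (A S) (A T) (A (S ∪ T))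

/-- Strong connectedness of a partition over a cyclic graph: every interval `[m, n]` other than the
whole graph satisfies `Z_[m, n] = (Z_{m-1} ∩ Z_m) ∨ (Z_n ∩ Z_{n+1})`. -/
def IsStronglyConnected {N : ℕ} (G : CyclicGraph) (A : Set (Pos N) → StarSubalgebra ℂ Ω) : Prop :=
  ∀ m ∈ G.verts N, ∀ k : ℕ, G.interval m k ≠ G.verts N →
    centre (A (G.interval m k)) =
      (centre (A {G.pred m}) ⊓ centre (A {m})) ⊔
        (centre (A {G.succ m k}) ⊓ centre (A {G.succ m (k + 1)}))

/-- Two (commuting) algebras are uncorrelated when the product of non-zero elements is non-zero. -/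
def Uncorrelated (A B : StarSubalgebra ℂ Ω) : Prop :=
  ∀ a ∈ A, ∀ b ∈ B, a * b = 0 → a = 0 ∨ b = 0

end Algebras

universe u

/-- A strongly connected partition, over the cyclic graph `G`, of a finite-dimensional factor. -/
structure FactorPartition (N : ℕ) (G : CyclicGraph) : Type (u + 1) where
  Ω : Type u
  [cstar : CStarAlgebra Ω]
  [finiteDim : FiniteDimensional ℂ Ω]
  [nontrivial : Nontrivial Ω]
  factor : Subalgebra.center ℂ Ω = ⊥
  alg : Set (Pos N) → StarSubalgebra ℂ Ω
  isPartition : IsPartition (G.verts N) alg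
  stronglyConnected : IsStronglyConnected G alg

attribute [instance] FactorPartition.cstar FactorPartition.finiteDim FactorPartition.nontrivial

namespace FactorPartition

variable {N : ℕ} {G G' : CyclicGraph}

/-- The correlation length is at most `lam / 4`: for every set `S` of vertices, `A_S` is uncorrelated
with the algebra of the complement of `S ± lam / 4`. -/
def CorrelationLengthLE (X : FactorPartition.{u} N G) (lam : ℕ) : Prop :=
  ∀ S ⊆ G.verts N, Uncorrelated (X.alg S) (X.alg (G.verts N \ G.nbhd S lam))

/-- The isomorphism `U` is a generalised QCA of causality radius `ρ / 4`:
`U (A_S) ⊆ B_{S ± ρ / 4}` for every set `S` of vertices. -/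
def HasCausalityRadius (X : FactorPartition.{u} N G) (Y : FactorPartition.{u} N G') (ρ : ℕ)
    (U : X.Ω ≃⋆ₐ[ℂ] Y.Ω) : Prop :=
  ∀ S ⊆ G.verts N, ∀ a ∈ X.alg S, U a ∈ Y.alg (G'.nbhd S ρ)

/-- Fine-graining: `U (A_S) = B_{S ± 1/4}` for every set `S` of vertices of the coarse graph. -/
def IsFineGraining {b : ZMod 2} (X : FactorPartition.{u} N (.coarse b))
    (Y : FactorPartition.{u} N .fine) (U : X.Ω ≃⋆ₐ[ℂ] Y.Ω) : Prop :=
  ∀ S ⊆ (CyclicGraph.coarse b).verts N,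
    U '' (X.alg S : Set X.Ω) = Y.alg (CyclicGraph.fine.nbhd S 1)

/-- Coarse-graining: `U (A_{S ± 1/4}) = B_S` for every set `S` of vertices of the coarse graph. -/
def IsCoarseGraining {b : ZMod 2} (X : FactorPartition.{u} N .fine)
    (Y : FactorPartition.{u} N (.coarse b)) (U : X.Ω ≃⋆ₐ[ℂ] Y.Ω) : Prop :=
  ∀ S ⊆ (CyclicGraph.coarse b).verts N,
    U '' (X.alg (CyclicGraph.fine.nbhd S 1) : Set X.Ω) = Y.alg S

/-- A generalised QCA of causality radius `1/2` that is a fine-graining followed by a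
coarse-graining. -/
structure IsElementary {b b' : ZMod 2} (X : FactorPartition.{u} N (.coarse b))
    (Y : FactorPartition.{u} N (.coarse b')) (U : X.Ω ≃⋆ₐ[ℂ] Y.Ω) : Prop where
  radius : HasCausalityRadius X Y 2 U
  decomposition : ∃ (W : FactorPartition.{u} N .fine) (Ufine : X.Ω ≃⋆ₐ[ℂ] W.Ω)
    (Ucoarse : W.Ω ≃⋆ₐ[ℂ] Y.Ω), IsFineGraining X W Ufine ∧ IsCoarseGraining W Y Ucoarse ∧
      U = Ufine.trans Ucoarse

/-- `IsProduct n X Y U`: the isomorphism `U` from `X` to `Y` is a product `U_n ⋯ U_1` of `n`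
elementary generalised QCAs, each of which goes from a partition over one of the graphs `Γ_N`,
`Γ_N^{+1/2}` to a partition over the other one. -/
inductive IsProduct : ℕ → {b b' : ZMod 2} → (X : FactorPartition.{u} N (.coarse b)) →
    (Y : FactorPartition.{u} N (.coarse b')) → (X.Ω ≃⋆ₐ[ℂ] Y.Ω) → Prop
  | nil {b : ZMod 2} (X : FactorPartition.{u} N (.coarse b)) :
      IsProduct 0 X X (StarAlgEquiv.refl (R := ℂ) (A := X.Ω))
  | cons {n : ℕ} {b b' : ZMod 2} (X : FactorPartition.{u} N (.coarse b))
      (Y : FactorPartition.{u} N (.coarse (b + 1))) (Z : FactorPartition.{u} N (.coarse b'))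
      (U₁ : X.Ω ≃⋆ₐ[ℂ] Y.Ω) (U : Y.Ω ≃⋆ₐ[ℂ] Z.Ω) :
      IsElementary X Y U₁ → IsProduct n Y Z U → IsProduct (n + 1) X Z (U₁.trans U)

end FactorPartition

/-! ### Commutants and generated algebras. -/

section Commutants

variable {Ω : Type*} [CStarAlgebra Ω]

/-! The proof peels off one factor of radius 1/2 at a time (`exists_first_factor`). Inside the input
algebra one builds a partition `C` over the graph shifted by half a step such that the identity from
the input partition to `C` is a fine-graining followed by a coarse-graining, `C` has correlation
length at most `l + 1`, and `U`, seen from `C`, has radius smaller by 1/2. Since `R = 2r` drops by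
one while `l` grows by one, the bound on `N` is preserved. Peeling requires `l ≤ l'`; otherwise it
is applied to the inverse of `U`. Radius 0 identifies two partitions and is absorbed into the last
factor.

To build `C`, every vertex `m` is cut in two. Number the output vertices so that causality is
one-sided: the pull-back of the output interval `[n, k)` lies in the input interval `[n - R, k)`.
The left-hand side of the cut of `m` is generated by input vertices before `m` and by `Q m`, the
pull-back of the output interval `[m - l', m + 1)`. What lies to the right of the cut must commute
with `Q m`.

In a factor the double commutant theorem holds (`commutant_commutant`), and a strongly connected
partition amounts to an `ArcSystem`: complementary arcs are commutants of each other, and the centre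
of an arc is generated by commutative algebras `E x` attached to its two ends. Starting from the
cuts between vertices, the cuts inside vertices are inserted one by one (`CutData.arcSystem`,
`Refinement.insert`). Once all `2N` cuts are present, `setAlg` gives a partition of the `2N` half
vertices; grouping these in pairs in the two possible ways gives back the input partition and gives
`C`.

The obstacle is that `(M ⊔ P) ⊓ commutant Q` need not be `(M ⊓ commutant Q) ⊔ P` when `Q` is not
contained in `M`. It is, if the support in the surrounding algebra of each atom of `P` lies in a
suitable commutative algebra `D` (`sup_inf_commutant_le_of_supportsIn`). This follows from
conditional independence of the algebras of distant cuts (`supportsIn_of_condIndep`), which the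
finite correlation length provides.

The gain in radius comes from `pullInt_le_arc`. Output intervals of length at most `l' + 1` fall by
construction into the expected arcs of the refined system, and longer ones are generated by these
(`ialg_le_of_short`), by a Markov-type argument. Taking commutants gives the causality of `C`. -/

theorem mem_commutant {A : StarSubalgebra ℂ Ω} {x : Ω} :
    x ∈ commutant A ↔ ∀ a ∈ A, a * x = x * a := by
  unfold commutant
  rw [StarSubalgebra.mem_centralizer_iff]
  exact ⟨fun h a ha => (h a ha).1, fun h a ha => ⟨h a ha, h _ (star_mem ha)⟩⟩

theorem le_commutant_iff {A B : StarSubalgebra ℂ Ω} :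
    A ≤ commutant B ↔ ∀ a ∈ A, ∀ b ∈ B, b * a = a * b :=
  ⟨fun h _ ha => mem_commutant.1 (h ha), fun h a ha => mem_commutant.2 (h a ha)⟩

theorem le_commutant_comm {A B : StarSubalgebra ℂ Ω} :
    A ≤ commutant B ↔ B ≤ commutant A := by
  rw [le_commutant_iff, le_commutant_iff]
  exact ⟨fun h a ha b hb => (h b hb a ha).symm, fun h a ha b hb => (h b hb a ha).symm⟩

theorem commutant_anti {A B : StarSubalgebra ℂ Ω} (h : A ≤ B) : commutant B ≤ commutant A :=
  le_commutant_comm.1 (h.trans (le_commutant_comm.1 le_rfl))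

theorem le_commutant_commutant (A : StarSubalgebra ℂ Ω) : A ≤ commutant (commutant A) :=
  le_commutant_comm.1 le_rfl

theorem commutant_sup (A B : StarSubalgebra ℂ Ω) :
    commutant (A ⊔ B) = commutant A ⊓ commutant B := by
  apply le_antisymm
  · exact le_inf (commutant_anti le_sup_left) (commutant_anti le_sup_right)
  · rw [le_commutant_comm]
    exact sup_le (le_commutant_comm.1 inf_le_left) (le_commutant_comm.1 inf_le_right)

theorem bot_le_commutant (A : StarSubalgebra ℂ Ω) : A ≤ commutant ⊥ :=
  le_commutant_comm.1 bot_le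

theorem centre_le (A : StarSubalgebra ℂ Ω) : centre A ≤ A := inf_le_left

theorem centre_le_commutant (A : StarSubalgebra ℂ Ω) : centre A ≤ commutant A := inf_le_right

theorem le_commutant_sup {A B C : StarSubalgebra ℂ Ω} (h₁ : C ≤ commutant A)
    (h₂ : C ≤ commutant B) : C ≤ commutant (A ⊔ B) := by
  rw [commutant_sup]; exact le_inf h₁ h₂

/-- Elements of the algebra generated by two commuting algebras are sums of products. -/
theorem mem_span_of_mem_sup {M P : StarSubalgebra ℂ Ω} (h : M ≤ commutant P) {x : Ω}
    (hx : x ∈ M ⊔ P) : x ∈ Submodule.span ℂ {y | ∃ m ∈ M, ∃ p ∈ P, y = m * p} := by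
  have hle : M ⊔ P ≤ StarAlgebra.adjoin ℂ ((M : Set Ω) ∪ P) := by
    refine sup_le (fun y hy => ?_) (fun y hy => ?_)
    · exact StarAlgebra.subset_adjoin ℂ _ (Or.inl hy)
    · exact StarAlgebra.subset_adjoin ℂ _ (Or.inr hy)
  have hc := le_commutant_iff.1 h
  replace hx := hle hx
  induction hx using StarAlgebra.adjoin_induction with
  | mem z hz =>
    rcases hz with hz | hz
    · exact Submodule.subset_span ⟨z, hz, 1, one_mem _, by simp⟩
    · exact Submodule.subset_span ⟨1, one_mem _, z, hz, by simp⟩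
  | algebraMap r =>
    exact Submodule.subset_span ⟨algebraMap ℂ Ω r, M.algebraMap_mem r, 1, one_mem _, by simp⟩
  | add y z _ _ hy hz => exact add_mem hy hz
  | mul y z hy' hz' hy hz =>
    clear hy' hz'
    induction hy using Submodule.span_induction with
    | mem y hy =>
      obtain ⟨m, hm, p, hp, rfl⟩ := hy
      induction hz using Submodule.span_induction with
      | mem z hz =>
        obtain ⟨m', hm', p', hp', rfl⟩ := hz
        refine Submodule.subset_span ⟨m * m', mul_mem hm hm', p * p', mul_mem hp hp', ?_⟩
        rw [mul_assoc, ← mul_assoc p, hc m' hm' p hp, mul_assoc, mul_assoc]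
      | zero => simp
      | add _ _ _ _ h₁ h₂ => rw [mul_add]; exact add_mem h₁ h₂
      | smul r _ _ h₁ => rw [mul_smul_comm]; exact Submodule.smul_mem _ r h₁
    | zero => simp
    | add _ _ _ _ h₁ h₂ => rw [add_mul]; exact add_mem h₁ h₂
    | smul r _ _ h₁ => rw [smul_mul_assoc]; exact Submodule.smul_mem _ r h₁
  | star y hy' hy =>
    clear hy'
    induction hy using Submodule.span_induction with
    | mem y hy =>
      obtain ⟨m, hm, p, hp, rfl⟩ := hy
      refine Submodule.subset_span ⟨star m, star_mem hm, star p, star_mem hp, ?_⟩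
      rw [star_mul, hc _ (star_mem hm) _ (star_mem hp)]
    | zero => simp
    | add _ _ _ _ h₁ h₂ => rw [star_add]; exact add_mem h₁ h₂
    | smul r _ _ h₁ => rw [star_smul]; exact Submodule.smul_mem _ _ h₁

end Commutants

/-! ### The trace form and averaging over a subalgebra. -/

section Casimir

variable {Ω : Type*} [CStarAlgebra Ω]

/-- The trace of the left regular representation of a sub-C⋆-algebra. -/
noncomputable def regTrace (T : StarSubalgebra ℂ Ω) : T →ₗ[ℂ] ℂ :=
  LinearMap.trace ℂ T ∘ₗ (Algebra.lmul ℂ T).toLinearMap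

theorem regTrace_apply (T : StarSubalgebra ℂ Ω) (t : T) :
    regTrace T t = LinearMap.trace ℂ T (LinearMap.mulLeft ℂ t) := rfl

theorem regTrace_comm (T : StarSubalgebra ℂ Ω) (s t : T) :
    regTrace T (s * t) = regTrace T (t * s) := by
  rw [regTrace_apply, regTrace_apply, LinearMap.mulLeft_mul, LinearMap.mulLeft_mul]
  exact LinearMap.trace_mul_comm ℂ _ _

theorem eq_zero_of_isSelfAdjoint_of_isNilpotent {a : Ω} (ha : IsSelfAdjoint a)
    (hn : IsNilpotent a) : a = 0 := by
  obtain ⟨n, hn⟩ := hn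
  have h2 : a ^ (2 ^ n) = 0 := by
    apply pow_eq_zero_of_le _ hn
    exact Nat.lt_two_pow_self.le
  have := ha.nnnorm_pow_two_pow n
  rw [h2, nnnorm_zero] at this
  exact nnnorm_eq_zero.1 (pow_eq_zero_iff (by positivity) |>.1 this.symm)

variable [FiniteDimensional ℂ Ω]

instance StarSubalgebra.finiteDimensional_coe (T : StarSubalgebra ℂ Ω) : FiniteDimensional ℂ T :=
  inferInstanceAs (FiniteDimensional ℂ (Subalgebra.toSubmodule T.toSubalgebra))

-- Eigenvalues of left multiplication by `star t * t` lie in the spectrum of a positive element. If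
-- their sum vanishes they all do, so `star t * t` is nilpotent as well as self-adjoint.
open scoped ComplexOrder in
theorem regTrace_star_mul_self (T : StarSubalgebra ℂ Ω) (t : T)
    (h : regTrace T (star t * t) = 0) : t = 0 := by
  set f : Module.End ℂ T := LinearMap.mulLeft ℂ (star t * t) with hf
  have hsa := IsSelfAdjoint.star_mul_self (t : Ω)
  have hroots : ∀ μ ∈ f.charpoly.roots, (0 : ℂ) ≤ μ := by
    intro μ hμ
    have hev : f.HasEigenvalue μ := by
      rw [Module.End.hasEigenvalue_iff_isRoot_charpoly]
      exact Polynomial.isRoot_of_mem_roots hμ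
    obtain ⟨y, hy⟩ := hev.exists_hasEigenvector
    have hy1 := hy.apply_eq_smul
    have hsp : μ ∈ spectrum ℂ (star (t : Ω) * t) := by
      intro hu
      apply hy.2
      have : (algebraMap ℂ Ω μ - star (t : Ω) * t) * (y : Ω) = 0 := by
        rw [sub_mul, sub_eq_zero, Algebra.algebraMap_eq_smul_one, smul_mul_assoc, one_mul]
        exact (congrArg (Subtype.val) hy1).symm
      exact Subtype.ext ((IsUnit.mul_right_eq_zero hu).1 this)
    have hre := hsa.mem_spectrum_eq_re hsp
    rw [hre] at hsp ⊢
    have := spectrum_star_mul_self_nonneg (b := (t : Ω)) μ.re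
      (by simpa [spectrum.algebraMap_mem_iff] using spectrum.of_algebraMap_mem ℂ hsp)
    exact_mod_cast this
  have htr : f.charpoly.roots.sum = 0 := by
    rw [← Module.End.trace_eq_sum_roots_charpoly_of_splits (IsAlgClosed.splits _)]
    exact h
  have hzero : ∀ μ ∈ f.charpoly.roots, μ = 0 :=
    Multiset.all_zero_of_le_zero_le_of_sum_eq_zero hroots htr
  have hnil : IsNilpotent f := by
    rw [LinearMap.isNilpotent_iff_charpoly]
    have h1 := (IsAlgClosed.splits f.charpoly).eq_prod_roots_of_monic f.charpoly_monic
    have h2 : f.charpoly.roots = Multiset.replicate (Module.finrank ℂ T) 0 := by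
      rw [Multiset.eq_replicate]
      refine ⟨?_, hzero⟩
      rw [← f.charpoly_natDegree]
      exact (IsAlgClosed.splits f.charpoly).natDegree_eq_card_roots.symm
    rw [h1, h2]
    simp
  have hn : IsNilpotent (star (t : Ω) * t) := by
    obtain ⟨n, hn⟩ := hnil
    refine ⟨n, ?_⟩
    have h1 : LinearMap.mulLeft ℂ ((star t * t) ^ n) = 0 := by
      rw [← LinearMap.pow_mulLeft]; exact hn
    have h2 := LinearMap.congr_fun h1 (1 : T)
    simpa using congrArg Subtype.val h2
  have := eq_zero_of_isSelfAdjoint_of_isNilpotent hsa hn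
  exact Subtype.ext (CStarRing.star_mul_self_eq_zero_iff _ |>.1 this)

/-- The trace form of a finite-dimensional C⋆-algebra is nondegenerate; this is the corresponding
separability idempotent `∑ a i ⊗ b i`, with its basic properties. -/
theorem exists_casimir (T : StarSubalgebra ℂ Ω) :
    ∃ (n : ℕ) (a b : Fin n → T), (∑ i, a i * b i = 1) ∧ (∑ i, b i * a i = 1) ∧
      (∀ (t : T) (x : Ω), t * ∑ i, (a i : Ω) * x * b i = (∑ i, (a i : Ω) * x * b i) * t) ∧
      (∀ t : T, t = ∑ i, regTrace T (t * a i) • b i) ∧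
      (∀ i j, regTrace T (b i * a j) = if j = i then 1 else 0) := by
  classical
  let B : LinearMap.BilinForm ℂ T := LinearMap.mk₂ ℂ (fun s t => regTrace T (s * t))
    (by intros; simp [add_mul]) (by intros; simp) (by intros; simp [mul_add]) (by intros; simp)
  have hB : ∀ s t, B s t = regTrace T (s * t) := fun s t => rfl
  have hsymm : B.IsSymm := ⟨fun s t => by rw [hB, hB, regTrace_comm]⟩
  have hnd : B.Nondegenerate := by
    refine ⟨fun s hs => ?_, fun t ht => ?_⟩
    · refine regTrace_star_mul_self T s ?_
      rw [regTrace_comm, ← hB]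
      exact hs _
    · refine regTrace_star_mul_self T t ?_
      rw [← hB]
      exact ht _
  let a := Module.finBasis ℂ T
  let b := B.dualBasis hnd a
  have hb : ∀ t i, b.repr t i = regTrace T (t * a i) := fun t i =>
    LinearMap.BilinForm.dualBasis_repr_apply _ _ _ _
  have hb' : ∀ t, t = ∑ i, regTrace T (t * a i) • b i := fun t => by
    conv_lhs => rw [← b.sum_repr t]
    simp_rw [hb]
  have hba : ∀ i j, regTrace T (b i * a j) = if j = i then 1 else 0 := fun i j =>
    LinearMap.BilinForm.apply_dualBasis_left hnd a i j
  have ha : ∀ t i, a.repr t i = regTrace T (b i * t) := fun t i => by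
    conv_rhs => rw [← a.sum_repr t, Finset.mul_sum, map_sum]
    simp [hba]
  have ha' : ∀ t, t = ∑ i, regTrace T (b i * t) • a i := fun t => by
    conv_lhs => rw [← a.sum_repr t]
    simp_rw [ha]
  have hext : ∀ c d : T, (∀ t, regTrace T (t * c) = regTrace T (t * d)) → c = d := by
    intro c d h
    rw [ha' c, ha' d]
    simp_rw [h]
  have htr : ∀ {ι : Type} [Fintype ι] [DecidableEq ι] (e : Module.Basis ι ℂ T) (t : T),
      regTrace T t = ∑ i, e.repr (t * e i) i := by
    intro ι _ _ e t
    rw [regTrace_apply, LinearMap.trace_eq_matrix_trace ℂ e, Matrix.trace]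
    refine Finset.sum_congr rfl fun i _ => ?_
    rw [Matrix.diag_apply, LinearMap.toMatrix_apply, LinearMap.mulLeft_apply]
  refine ⟨_, a, b, ?_, ?_, ?_, hb', hba⟩
  -- Paired with `t`, the sum gives the trace of left multiplication by `t` computed in the basis
  -- `a`. This is `regTrace T t`, whence the value 1 without normalisation.
  · refine hext _ _ fun t => ?_
    rw [mul_one, Finset.mul_sum, map_sum, htr a t]
    refine Finset.sum_congr rfl fun i _ => ?_
    rw [ha, ← mul_assoc, regTrace_comm]
  · refine hext _ _ fun t => ?_
    rw [mul_one, Finset.mul_sum, map_sum, htr b t]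
    refine Finset.sum_congr rfl fun i _ => ?_
    rw [hb, mul_assoc]
  · intro t x
    have h1 : ∀ i, (t : Ω) * a i = ∑ j, regTrace T (b j * (t * a i)) • (a j : Ω) := fun i => by
      simpa using congrArg Subtype.val (ha' (t * a i))
    have h2 : ∀ j, (b j : Ω) * t = ∑ i, regTrace T (b j * t * a i) • (b i : Ω) := fun j => by
      simpa using congrArg Subtype.val (hb' (b j * t))
    rw [Finset.mul_sum, Finset.sum_mul]
    have h3 : ∀ i, (t : Ω) * (a i * x * b i) =
        ∑ j, regTrace T (b j * t * a i) • ((a j : Ω) * x * b i) := fun i => by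
      rw [← mul_assoc, ← mul_assoc, h1, Finset.sum_mul, Finset.sum_mul]
      simp [mul_assoc]
    have h4 : ∀ j, (a j : Ω) * x * b j * t =
        ∑ i, regTrace T (b j * t * a i) • ((a j : Ω) * x * b i) := fun j => by
      rw [mul_assoc _ _ (t : Ω), h2, Finset.mul_sum]
      simp
    simp_rw [h3, h4]
    exact Finset.sum_comm

/-- Averaging over a sub-C⋆-algebra `T`: a projection onto the commutant of `T` of the form
`x ↦ ∑ a i * x * b i` with `a i` and `b i` in `T`. -/
theorem exists_average (T : StarSubalgebra ℂ Ω) :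
    ∃ (n : ℕ) (a b : Fin n → Ω), (∀ i, a i ∈ T) ∧ (∀ i, b i ∈ T) ∧ (∑ i, a i * b i = 1) ∧
      (∀ x, ∑ i, a i * x * b i ∈ commutant T) ∧
      (∀ g ∈ T, ∑ i, a i * (star g * g) * b i = 0 → g = 0) := by
  obtain ⟨n, a, b, h1, h2, h3, -, -⟩ := exists_casimir T
  refine ⟨n, fun i => a i, fun i => b i, fun i => (a i).2, fun i => (b i).2, ?_, ?_, ?_⟩
  · simpa using congrArg Subtype.val h1
  · exact fun x => mem_commutant.2 fun t ht => h3 ⟨t, ht⟩ x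
  · intro g hg h
    -- By cyclicity and `∑ b i * a i = 1`, averaging preserves the trace, so it is faithful on `T`.
    have h4 : ∑ i, a i * (star (⟨g, hg⟩ : T) * ⟨g, hg⟩) * b i = 0 := by
      apply Subtype.ext
      simpa using h
    have h5 : regTrace T (star (⟨g, hg⟩ : T) * ⟨g, hg⟩) = 0 := by
      have := congrArg (regTrace T) h4
      rw [map_zero, map_sum] at this
      rw [← this]
      calc regTrace T (star (⟨g, hg⟩ : T) * ⟨g, hg⟩)
          = regTrace T ((star (⟨g, hg⟩ : T) * ⟨g, hg⟩) * ∑ i, b i * a i) := by rw [h2, mul_one]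
        _ = _ := by
          rw [Finset.mul_sum, map_sum]
          refine Finset.sum_congr rfl fun i _ => ?_
          rw [mul_assoc (a i), regTrace_comm T (a i), mul_assoc _ (b i) (a i)]
    exact congrArg Subtype.val (regTrace_star_mul_self T _ h5)

end Casimir

/-! ### The double commutant theorem and the modular law. -/

section Lattice

variable {Ω : Type*} [CStarAlgebra Ω] [FiniteDimensional ℂ Ω]

/-- The double commutant theorem in a finite-dimensional factor. -/
theorem commutant_commutant [Nontrivial Ω] (hfac : Subalgebra.center ℂ Ω = ⊥)
    (S : StarSubalgebra ℂ Ω) : commutant (commutant S) = S := by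
  refine le_antisymm (fun x hx => ?_) (le_commutant_commutant S)
  by_contra hxS
  -- A functional separates `x` from `S`; the contradiction will be `f x = 0`.
  obtain ⟨f, hfS, hf⟩ := Submodule.exists_le_ker_of_notMem
    (show x ∉ Subalgebra.toSubmodule S.toSubalgebra from hxS)
  obtain ⟨n, A, B, -, hBA, hcent, hexp, -⟩ := exists_casimir (⊤ : StarSubalgebra ℂ Ω)
  obtain ⟨k, α, β, hαβ, -, hcomm, hexpS, hdual⟩ := exists_casimir S
  set τ : Ω → ℂ := fun w => regTrace ⊤ (⟨w, trivial⟩ : (⊤ : StarSubalgebra ℂ Ω)) with hτ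
  -- Averaging over the whole factor lands in the scalars, and the scalar is proportional to the
  -- trace.
  have hφ : ∀ w : Ω, ∃ μ : ℂ, ∑ i, (A i : Ω) * w * B i = μ • 1 ∧ μ * τ 1 = τ w := by
    intro w
    have hm : ∑ i, (A i : Ω) * w * B i ∈ Subalgebra.center ℂ Ω := by
      rw [Subalgebra.mem_center_iff]
      exact fun t => hcent ⟨t, trivial⟩ w
    rw [hfac] at hm
    obtain ⟨μ, hμ⟩ := Algebra.mem_bot.1 hm
    rw [Algebra.algebraMap_eq_smul_one] at hμ
    refine ⟨μ, hμ.symm, ?_⟩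
    have h1 : μ • (1 : (⊤ : StarSubalgebra ℂ Ω)) = ∑ i, A i * ⟨w, trivial⟩ * B i := by
      apply Subtype.ext
      simpa using hμ
    have h2 := congrArg (regTrace ⊤) h1
    rw [map_smul, map_sum, smul_eq_mul] at h2
    rw [show τ 1 = regTrace ⊤ (1 : (⊤ : StarSubalgebra ℂ Ω)) from rfl, h2]
    calc _ = regTrace ⊤ ((⟨w, trivial⟩ : (⊤ : StarSubalgebra ℂ Ω)) * ∑ i, B i * A i) := by
          rw [Finset.mul_sum, map_sum]
          refine Finset.sum_congr rfl fun i _ => ?_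
          rw [mul_assoc, regTrace_comm, mul_assoc]
      _ = τ w := by rw [hBA, mul_one]
  have hτ1 : τ 1 ≠ 0 := by
    intro h
    have h1 := regTrace_star_mul_self ⊤ (1 : (⊤ : StarSubalgebra ℂ Ω)) (by rw [star_one, one_mul]; exact h)
    exact one_ne_zero (congrArg Subtype.val h1)
  choose φ hφ1 hφ2 using hφ
  have hφ0 : ∀ w, φ w = 0 ↔ τ w = 0 := fun w => by
    rw [← hφ2]; simp [hτ1]
  obtain ⟨y, hy⟩ : ∃ y : Ω, ∀ w, f w = τ (y * w) := by
    refine ⟨∑ i, f (B i) • (A i : Ω), fun w => ?_⟩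
    have h1 := congrArg Subtype.val (hexp ⟨w, trivial⟩)
    have h2 : w = ∑ i, regTrace ⊤ ((⟨w, trivial⟩ : (⊤ : StarSubalgebra ℂ Ω)) * A i) • (B i : Ω) := by
      simpa using h1
    conv_lhs => rw [h2, map_sum]
    have h3 : (⟨(∑ i, f (B i) • (A i : Ω)) * w, trivial⟩ : (⊤ : StarSubalgebra ℂ Ω)) =
        ∑ i, f (B i) • (A i * ⟨w, trivial⟩) := by
      apply Subtype.ext
      simp [Finset.sum_mul]
    rw [hτ]
    simp only [h3, map_sum, map_smul, smul_eq_mul]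
    refine Finset.sum_congr rfl fun i _ => ?_
    rw [regTrace_comm, mul_comm]
  apply hfS
  have hS : ∀ s ∈ S, φ (y * s) = 0 := fun s hs => by
    rw [hφ0, ← hy]; exact hf hs
  -- The inner sum is an average over `S`, hence lies in `commutant S`.
  have hr : ∀ w : Ω, ∑ j, φ (y * (β j * w)) • (α j : Ω) =
      ∑ i, (∑ j, (α j : Ω) * (A i * y) * β j) * w * B i := by
    intro w
    have : ∀ j, φ (y * (β j * w)) • (α j : Ω) = ∑ i, (α j : Ω) * (A i * y) * β j * w * B i := by
      intro j
      have h1 := congrArg (fun u => (α j : Ω) * u) (hφ1 (y * (β j * w)))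
      simp only [mul_smul_comm, mul_one] at h1
      rw [← h1, Finset.mul_sum]
      simp only [mul_assoc]
    simp_rw [this]
    rw [Finset.sum_comm]
    refine Finset.sum_congr rfl fun i _ => ?_
    rw [Finset.sum_mul, Finset.sum_mul]
  have hx' := mem_commutant.1 hx
  -- As `x` commutes with `commutant S` it can be pulled out on the left. What remains is the case
  -- `w = 1`, which vanishes because `f` kills `S`.
  have h0 : ∑ j, φ (y * (β j * x)) • (α j : Ω) = 0 := by
    have h1 := hr 1
    have h2 := hr x
    have h3 : ∑ i, (∑ j, (α j : Ω) * (A i * y) * β j) * x * B i =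
        x * ∑ i, (∑ j, (α j : Ω) * (A i * y) * β j) * 1 * B i := by
      rw [Finset.mul_sum]
      refine Finset.sum_congr rfl fun i _ => ?_
      rw [hx' _ (mem_commutant.2 fun t ht => hcomm ⟨t, ht⟩ _), mul_one, mul_assoc]
    rw [h2, h3, ← h1]
    simp [hS]
  have h1 : ∀ i, φ (y * (β i * x)) = 0 := by
    intro i
    have h2 : ∑ j, φ (y * (β j * x)) • α j = 0 := Subtype.ext (by simpa using h0)
    have h3 := congrArg (fun u => regTrace S (β i * u)) h2
    simpa [Finset.mul_sum, hdual] using h3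
  rw [hy]
  have h2 : (1 : Ω) = ∑ i, regTrace S (α i) • (β i : Ω) := by
    simpa using congrArg Subtype.val (hexpS 1)
  have hlin : ∀ i, f (β i * x) = 0 := fun i => by rw [hy, ← hφ0]; exact h1 i
  rw [← hy, ← one_mul x, h2, Finset.sum_mul, map_sum]
  exact Finset.sum_eq_zero fun i _ => by rw [smul_mul_assoc, map_smul, hlin, smul_zero]

/-- Modular law: if `M` and `P` commute, averaging over `T ≤ M` only affects the factors in `M`. -/
theorem sup_inf_commutant_le {M P T : StarSubalgebra ℂ Ω} (h : M ≤ commutant P) (hT : T ≤ M) :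
    (M ⊔ P) ⊓ commutant T ≤ (M ⊓ commutant T) ⊔ P := by
  rintro x ⟨hx, hxT⟩
  obtain ⟨n, a, b, ha, hb, h1, h2, -⟩ := exists_average T
  have hfix : x = ∑ i, a i * x * b i := by
    have : ∀ i, a i * x * b i = x * (a i * b i) := fun i => by
      rw [mem_commutant.1 hxT _ (ha i), mul_assoc]
    simp_rw [this]
    rw [← Finset.mul_sum, h1, mul_one]
  rw [hfix]
  replace hx := mem_span_of_mem_sup h hx
  clear hfix hxT
  induction hx using Submodule.span_induction with
  | mem z hz =>
    obtain ⟨m, hm, p, hp, rfl⟩ := hz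
    have : ∑ i, a i * (m * p) * b i = (∑ i, a i * m * b i) * p := by
      rw [Finset.sum_mul]
      refine Finset.sum_congr rfl fun i _ => ?_
      simp only [mul_assoc]
      rw [le_commutant_iff.1 h _ (hT (hb i)) _ hp]
    rw [this]
    refine mul_mem (StarSubalgebra.mem_sup_left ⟨?_, h2 m⟩) (StarSubalgebra.mem_sup_right hp)
    exact sum_mem fun i _ => mul_mem (mul_mem (hT (ha i)) hm) (hT (hb i))
  | zero => simp
  | add y z _ _ hy hz =>
    simp only [mul_add, add_mul, Finset.sum_add_distrib]
    exact add_mem hy hz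
  | smul r y _ hy =>
    simp only [mul_smul_comm, smul_mul_assoc, ← Finset.smul_sum]
    exact (_ : StarSubalgebra ℂ Ω).toSubalgebra.smul_mem hy r

theorem sup_inf_commutant_left_le {M P : StarSubalgebra ℂ Ω} (h : M ≤ commutant P) :
    (M ⊔ P) ⊓ commutant M ≤ centre M ⊔ P :=
  sup_inf_commutant_le h le_rfl

/-- The modular law is used twice: commuting with `M` reduces `M` to its centre, then commuting with
`P` reduces `P`. -/
theorem centre_sup_le {M P : StarSubalgebra ℂ Ω} (h : M ≤ commutant P) :
    centre (M ⊔ P) ≤ centre M ⊔ centre P := by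
  have h1 : centre (M ⊔ P) ≤ centre M ⊔ P :=
    (inf_le_inf_left _ (commutant_anti le_sup_left)).trans (sup_inf_commutant_left_le h)
  have h2 : centre (M ⊔ P) ≤ commutant P := inf_le_right.trans (commutant_anti le_sup_right)
  have h3 : P ≤ commutant (centre M) :=
    le_commutant_comm.1 ((centre_le M).trans h)
  calc centre (M ⊔ P) ≤ (P ⊔ centre M) ⊓ commutant P := le_inf (h1.trans (sup_comm _ _).le) h2
    _ ≤ centre P ⊔ centre M := sup_inf_commutant_left_le h3
    _ = _ := sup_comm _ _

theorem commutant_inf [Nontrivial Ω] (hfac : Subalgebra.center ℂ Ω = ⊥)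
    (A B : StarSubalgebra ℂ Ω) : commutant (A ⊓ B) = commutant A ⊔ commutant B := by
  rw [← commutant_commutant hfac (commutant A ⊔ commutant B), commutant_sup,
    commutant_commutant hfac, commutant_commutant hfac]

theorem commutant_le_comm [Nontrivial Ω] (hfac : Subalgebra.center ℂ Ω = ⊥)
    {A B : StarSubalgebra ℂ Ω} (h : commutant A ≤ B) : commutant B ≤ A := by
  have := commutant_anti h
  rwa [commutant_commutant hfac] at this

end Lattice

/-! ### Atoms of commutative algebras. -/

section MinimalIdempotents

variable {Ω : Type*} [CStarAlgebra Ω]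

/-- `p` is a minimal idempotent of the commutative algebra `D`. -/
structure IsMinIdem (D : StarSubalgebra ℂ Ω) (p : Ω) : Prop where
  mem : p ∈ D
  idem : p * p = p
  ne_zero : p ≠ 0
  scalar : ∀ y ∈ D, ∃ μ : ℂ, p * y = μ • p

variable [FiniteDimensional ℂ Ω]

/-- A commutative finite-dimensional C⋆-algebra is spanned by its atomic projectors. -/
theorem exists_atoms {D : StarSubalgebra ℂ Ω} (hD : D ≤ commutant D) :
    ∃ s : Finset Ω, (∀ p ∈ s, IsMinIdem D p ∧ IsStarProjection p) ∧ ∑ p ∈ s, p = 1 := by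
  classical
  have hcomm := le_commutant_iff.1 hD
  let : CommRing D := { (inferInstance : Ring D) with
    mul_comm := fun x y => Subtype.ext (hcomm _ y.2 _ x.2) }
  have : IsReduced D := by
    refine ⟨fun x hx => ?_⟩
    have h1 : IsNilpotent (star x * x) := (Commute.all _ _).isNilpotent_mul_left hx
    have h2 : IsNilpotent (star (x : Ω) * x) := h1.map D.subtype
    exact Subtype.ext ((CStarRing.star_mul_self_eq_zero_iff _).1
      (eq_zero_of_isSelfAdjoint_of_isNilpotent (IsSelfAdjoint.star_mul_self (x : Ω)) h2))
  have : IsArtinianRing D := IsArtinianRing.of_finite ℂ D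
  let e := IsArtinianRing.equivPi D
  have : Finite (MaximalSpectrum D) := inferInstance
  have := Fintype.ofFinite (MaximalSpectrum D)
  let p : MaximalSpectrum D → D := fun I => e.symm (Pi.single I 1)
  have hidem : ∀ I, p I * p I = p I := fun I => by
    simp only [p]
    rw [← map_mul, ← Pi.single_mul, one_mul]
  have hsum : ∑ I, p I = 1 := by
    simp only [p]
    rw [← map_sum, Finset.univ_sum_single, ← map_one e.symm]
    rfl
  have hne : ∀ I, p I ≠ 0 := fun I h => by
    have h1 : (Pi.single I 1 : ∀ J : MaximalSpectrum D, D ⧸ J.asIdeal) = 0 := by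
      apply e.symm.injective
      rw [map_zero]; exact h
    have h2 := congrFun h1 I
    rw [Pi.single_eq_same] at h2
    have := Ideal.Quotient.nontrivial_iff.2 I.isMaximal.ne_top
    exact one_ne_zero h2
  have hscal : ∀ I (y : D), ∃ μ : ℂ, p I * y = μ • p I := by
    intro I y
    have := I.isMaximal
    -- Each residue field is finite over `ℂ`, hence equal to it; this makes the idempotents scalar
    -- on `D`.
    let : Field (D ⧸ I.asIdeal) := Ideal.Quotient.field I.asIdeal
    have : FiniteDimensional ℂ (D ⧸ I.asIdeal) :=
      Module.Finite.of_surjective (Ideal.Quotient.mkₐ ℂ I.asIdeal).toLinearMap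
        Ideal.Quotient.mk_surjective
    obtain ⟨μ, hμ⟩ := (IsAlgClosed.algebraMap_bijective_of_isIntegral (k := ℂ)
      (K := D ⧸ I.asIdeal)).2 (Ideal.Quotient.mk I.asIdeal y)
    refine ⟨μ, ?_⟩
    apply e.injective
    funext J
    have h1 : e (p I) = Pi.single I 1 := e.apply_symm_apply _
    have h2 : e (μ • p I) = e (algebraMap ℂ D μ) * e (p I) := by
      rw [← map_mul, Algebra.smul_def]
    rw [h2, map_mul, h1, Pi.mul_apply, Pi.mul_apply]
    by_cases hJ : J = I
    · subst hJ
      rw [Pi.single_eq_same, one_mul, mul_one]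
      exact hμ.symm
    · rw [Pi.single_eq_of_ne hJ, zero_mul, mul_zero]
  have hinj : Function.Injective (fun I => (p I : Ω)) := by
    intro I J h
    have h1 : p I = p J := Subtype.ext h
    have h2 : (Pi.single I 1 : ∀ J : MaximalSpectrum D, D ⧸ J.asIdeal) = Pi.single J 1 :=
      e.symm.injective h1
    by_contra hIJ
    have h3 := congrFun h2 I
    rw [Pi.single_eq_same, Pi.single_eq_of_ne hIJ] at h3
    have := Ideal.Quotient.nontrivial_iff.2 I.isMaximal.ne_top
    exact one_ne_zero h3
  refine ⟨Finset.univ.image fun I => (p I : Ω), ?_, ?_⟩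
  · intro q hq
    obtain ⟨I, -, rfl⟩ := Finset.mem_image.1 hq
    have hid : (p I : Ω) * p I = p I := congrArg Subtype.val (hidem I)
    refine ⟨⟨(p I).2, hid, fun h => hne I (Subtype.ext h), fun y hy => ?_⟩, ?_⟩
    · obtain ⟨μ, hμ⟩ := hscal I ⟨y, hy⟩
      exact ⟨μ, by simpa using congrArg Subtype.val hμ⟩
    · rw [isStarProjection_iff_isIdempotentElem_and_isStarNormal]
      exact ⟨hid, ⟨hcomm _ (p I).2 _ (star_mem (p I).2)⟩⟩
  · rw [Finset.sum_image fun _ _ _ _ h => hinj h]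
    simpa using congrArg Subtype.val hsum

/-- Some atom `q` of `exists_atoms` meets `p`, and minimality of `p` forces `p * q = p`, so `p`
inherits the scalar property of `q`. -/
theorem IsAtomProj.isMinIdem {D : StarSubalgebra ℂ Ω} (hD : D ≤ commutant D) {p : Ω}
    (hp : IsAtomProj D p) : IsMinIdem D p := by
  obtain ⟨s, hs, hsum⟩ := exists_atoms hD
  have hcomm := le_commutant_iff.1 hD
  obtain ⟨q, hq, hpq⟩ : ∃ q ∈ s, p * q ≠ 0 := by
    by_contra! h
    apply hp.ne_zero
    rw [← mul_one p, ← hsum, Finset.mul_sum]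
    exact Finset.sum_eq_zero h
  obtain ⟨hq1, hq2⟩ := hs q hq
  have hpp : p * p = p := hp.proj.isIdempotentElem
  have hproj : IsStarProjection (p * q) := by
    refine ⟨?_, ?_⟩
    · change p * q * (p * q) = p * q
      rw [mul_assoc, ← mul_assoc q, ← hcomm _ hq1.mem _ hp.mem, mul_assoc, hq1.idem, ← mul_assoc, hpp]
    · change star (p * q) = p * q
      rw [star_mul, hp.proj.isSelfAdjoint.star_eq, hq2.isSelfAdjoint.star_eq]
      exact hcomm _ hp.mem _ hq1.mem
  rcases hp.minimal (p * q) (mul_mem hp.mem hq1.mem) hproj (by rw [← mul_assoc, hpp]) with h | h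
  · exact absurd h hpq
  refine ⟨hp.mem, hpp, hp.ne_zero, fun y hy => ?_⟩
  obtain ⟨μ, hμ⟩ := hq1.scalar y hy
  refine ⟨μ, ?_⟩
  rw [← h, mul_assoc, hμ, mul_smul_comm]

end MinimalIdempotents

/-! ### Supports, and modular laws that need them. -/

section Splitting

variable {Ω : Type*} [CStarAlgebra Ω]

/-- Multiplication by `p` turns every factor from `P` into a scalar, so only factors from `M`
survive. -/
theorem IsMinIdem.exists_mul_eq {M P : StarSubalgebra ℂ Ω} (h : M ≤ commutant P) {p x : Ω}
    (hp : IsMinIdem P p) (hx : x ∈ M ⊔ P) : ∃ m ∈ M, p * x = p * m := by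
  replace hx := mem_span_of_mem_sup h hx
  induction hx using Submodule.span_induction with
  | mem z hz =>
    obtain ⟨m, hm, q, hq, rfl⟩ := hz
    obtain ⟨μ, hμ⟩ := hp.scalar q hq
    refine ⟨μ • m, M.toSubalgebra.smul_mem hm μ, ?_⟩
    rw [← le_commutant_iff.1 h _ hm _ hq, ← mul_assoc, hμ, smul_mul_assoc, mul_smul_comm]
  | zero => exact ⟨0, zero_mem _, rfl⟩
  | add y z _ _ hy hz =>
    obtain ⟨m, hm, h1⟩ := hy
    obtain ⟨m', hm', h2⟩ := hz
    exact ⟨m + m', add_mem hm hm', by rw [mul_add, mul_add, h1, h2]⟩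
  | smul r y _ hy =>
    obtain ⟨m, hm, h1⟩ := hy
    exact ⟨r • m, M.toSubalgebra.smul_mem hm r, by rw [mul_smul_comm, mul_smul_comm, h1]⟩

/-- The support in `M` of every minimal idempotent of `P` lies in the commutative algebra `D`. -/
def SupportsIn (M P D : StarSubalgebra ℂ Ω) : Prop :=
  ∀ p d, IsMinIdem P p → IsMinIdem D d → d * p ≠ 0 → ∀ g ∈ M, p * g = 0 → d * g = 0

theorem SupportsIn.mono {M M' P D : StarSubalgebra ℂ Ω} (h : SupportsIn M P D) (hM : M' ≤ M) :
    SupportsIn M' P D := fun p d hp hd hdp g hg => h p d hp hd hdp g (hM hg)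

variable [FiniteDimensional ℂ Ω]

/-- Given the supports, elements of `M` multiplied by a minimal idempotent `p` of `P` may be
multiplied by an element of `D` which acts as an identity on `p`. -/
theorem SupportsIn.exists_support {M P D : StarSubalgebra ℂ Ω} (h : SupportsIn M P D)
    (hD : D ≤ commutant D) (hDP : D ≤ commutant P) {p : Ω} (hp : IsMinIdem P p) :
    ∃ s ∈ D, p * s = p ∧ ∀ g ∈ M, p * g = 0 → s * g = 0 := by
  classical
  obtain ⟨S, hS, hsum⟩ := exists_atoms hD
  refine ⟨∑ d ∈ S with d * p ≠ 0, d, sum_mem fun d hd => (hS d (Finset.mem_filter.1 hd).1).1.mem,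
    ?_, ?_⟩
  · conv_rhs => rw [← mul_one p, ← hsum]
    rw [Finset.mul_sum, Finset.mul_sum]
    apply Finset.sum_subset (Finset.filter_subset _ _)
    intro d hd hd'
    rw [le_commutant_iff.1 hDP _ (hS d hd).1.mem _ hp.mem]
    by_contra hne
    exact hd' (Finset.mem_filter.2 ⟨hd, hne⟩)
  · intro g hg hpg
    rw [Finset.sum_mul]
    refine Finset.sum_eq_zero fun d hd => ?_
    obtain ⟨hd1, hd2⟩ := Finset.mem_filter.1 hd
    exact h p d hp (hS d hd1).1 hd2 g hg hpg

theorem mem_sup_of_forall_atoms {M P : StarSubalgebra ℂ Ω} (hP : P ≤ commutant P) {x : Ω}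
    (h : ∀ p, IsMinIdem P p → ∃ m ∈ M, p * x = p * m) : x ∈ M ⊔ P := by
  obtain ⟨S, hS, hsum⟩ := exists_atoms hP
  rw [← one_mul x, ← hsum, Finset.sum_mul]
  refine sum_mem fun p hp => ?_
  obtain ⟨m, hm, h1⟩ := h p (hS p hp).1
  rw [h1]
  exact mul_mem (StarSubalgebra.mem_sup_right (hS p hp).1.mem) (StarSubalgebra.mem_sup_left hm)

/-- A modular law for algebras `Q` not contained in `M`, under a condition on supports. -/
theorem sup_inf_commutant_le_of_supportsIn {M N P D Q : StarSubalgebra ℂ Ω} (hMN : M ≤ N)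
    (hQN : Q ≤ N) (hP : P ≤ commutant P) (hNP : N ≤ commutant P) (hDM : D ≤ M)
    (hDN : D ≤ commutant N) (hs : SupportsIn N P D) :
    (M ⊔ P) ⊓ commutant Q ≤ (M ⊓ commutant Q) ⊔ P := by
  rintro x ⟨hx, hxQ⟩
  refine mem_sup_of_forall_atoms hP fun p hp => ?_
  obtain ⟨m, hm, h1⟩ := hp.exists_mul_eq (hMN.trans hNP) hx
  obtain ⟨s, hs, hps, hsg⟩ := hs.exists_support
    ((hDM.trans hMN).trans (le_commutant_comm.1 hDN)) ((hDM.trans hMN).trans hNP) hp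
  refine ⟨s * m, ⟨mul_mem (hDM hs) hm, mem_commutant.2 fun q hq => ?_⟩, ?_⟩
  -- The commutator is killed by `p`, hence by the support `s`. So `s * m` commutes with `Q`, while
  -- `p * s = p` shows that nothing is lost on `p`.
  · have h2 : p * (m * q - q * m) = 0 := by
      rw [mul_sub, ← mul_assoc, ← h1, ← mul_assoc, le_commutant_iff.1 hNP _ (hQN hq) _ hp.mem,
        mul_assoc, mul_assoc, ← h1, mem_commutant.1 hxQ q hq |>.symm, ← mul_assoc, ← mul_assoc,
        le_commutant_iff.1 hNP _ (hQN hq) _ hp.mem, sub_self]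
    have h3 := hsg _ (sub_mem (mul_mem (hMN hm) (hQN hq)) (mul_mem (hQN hq) (hMN hm))) h2
    rw [mul_sub, sub_eq_zero] at h3
    rw [mul_assoc, h3, ← mul_assoc, ← mul_assoc, le_commutant_iff.1 hDN _ hs _ (hQN hq)]
  · rw [h1, ← mul_assoc, hps]

/-- Intersection of two algebras with a common commuting factor. -/
theorem sup_inf_sup_le_of_supportsIn {M K N P D : StarSubalgebra ℂ Ω} (hMN : M ≤ N)
    (hKN : K ≤ N) (hP : P ≤ commutant P) (hNP : N ≤ commutant P) (hDM : D ≤ M) (hDK : D ≤ K)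
    (hD : D ≤ commutant D) (hs : SupportsIn N P D) :
    (M ⊔ P) ⊓ (K ⊔ P) ≤ (M ⊓ K) ⊔ P := by
  rintro x ⟨hx, hx'⟩
  refine mem_sup_of_forall_atoms hP fun p hp => ?_
  obtain ⟨m, hm, h1⟩ := hp.exists_mul_eq (hMN.trans hNP) hx
  obtain ⟨k, hk, h2⟩ := hp.exists_mul_eq (hKN.trans hNP) hx'
  obtain ⟨s, hs, hps, hsg⟩ := hs.exists_support hD ((hDM.trans hMN).trans hNP) hp
  -- The two representatives agree on `p`, hence on the support `s`, and `s * m = s * k` lies in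
  -- both algebras.
  have h3 := hsg (m - k) (sub_mem (hMN hm) (hKN hk)) (by rw [mul_sub, ← h1, ← h2, sub_self])
  rw [mul_sub, sub_eq_zero] at h3
  refine ⟨s * m, ⟨mul_mem (hDM hs) hm, ?_⟩, ?_⟩
  · rw [h3]; exact mul_mem (hDK hs) hk
  · rw [h1, ← mul_assoc, hps]

/-- Removal of a commuting factor. -/
theorem inf_sup_le_of_supportsIn {M K P D : StarSubalgebra ℂ Ω} (hKM : K ≤ M)
    (hP : P ≤ commutant P) (hMP : M ≤ commutant P) (hDK : D ≤ K) (hD : D ≤ commutant D)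
    (hs : SupportsIn M P D) : M ⊓ (K ⊔ P) ≤ K := by
  rintro x ⟨hxM, hx⟩
  obtain ⟨S, hS, hsum⟩ := exists_atoms hD
  obtain ⟨S', hS', hsum'⟩ := exists_atoms hP
  rw [← one_mul x, ← hsum, Finset.sum_mul]
  refine sum_mem fun d hd => ?_
  have hd1 := (hS d hd).1
  -- An atom `p` that meets `d` suffices: `x` agrees with an element of `K` on `p`, hence on the
  -- whole of `d`.
  obtain ⟨p, hp, hdp⟩ : ∃ p ∈ S', d * p ≠ 0 := by
    by_contra! h
    apply hd1.ne_zero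
    rw [← mul_one d, ← hsum', Finset.mul_sum]
    exact Finset.sum_eq_zero h
  obtain ⟨k, hk, h1⟩ := (hS' p hp).1.exists_mul_eq (hKM.trans hMP) hx
  have h2 := hs p d (hS' p hp).1 hd1 hdp (x - k) (sub_mem hxM (hKM hk))
    (by rw [mul_sub, h1, sub_self])
  rw [mul_sub, sub_eq_zero] at h2
  rw [h2]
  exact mul_mem (hDK hd1.mem) hk

/-- Conditional independence of `P` and `Q` given `D` yields the condition on supports, for an
algebra `M` with centre `D ⊔ Q`. -/
theorem supportsIn_of_condIndep {M P D Q : StarSubalgebra ℂ Ω} (hMP : M ≤ commutant P)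
    (hcen : centre M ≤ D ⊔ Q) (hDM : D ≤ centre M) (hQM : Q ≤ centre M)
    (h : ∀ d, IsMinIdem D d → ∀ p ∈ P, ∀ q ∈ Q, d * p * q = 0 → d * p = 0 ∨ d * q = 0) :
    SupportsIn M P D := by
  intro p d hp hd hdp g hg hpg
  by_contra hne
  obtain ⟨n, a, b, ha, hb, -, h2, h3⟩ := exists_average M
  have hMP' := le_commutant_iff.1 hMP
  have hdM : d ∈ M := centre_le M (hDM hd.mem)
  have hdc : ∀ m ∈ M, m * d = d * m := mem_commutant.1 (centre_le_commutant M (hDM hd.mem))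
  -- If `d * g ≠ 0`, averaging produces a non-zero element of the centre of `M` of the form `d * q`
  -- with `q` in `Q`. It is still killed by `p`, against conditional independence.
  set ζ := ∑ i, a i * (star (d * g) * (d * g)) * b i with hζ
  have hζ0 : ζ ≠ 0 := fun h0 => hne (h3 _ (mul_mem hdM hg) h0)
  have hζM : ζ ∈ M := sum_mem fun i _ => mul_mem (mul_mem (ha i) (mul_mem
    (star_mem (mul_mem hdM hg)) (mul_mem hdM hg))) (hb i)
  have hζc : ζ ∈ D ⊔ Q := hcen ⟨hζM, h2 _⟩
  have hpζ : p * ζ = 0 := by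
    rw [hζ, Finset.mul_sum]
    refine Finset.sum_eq_zero fun i _ => ?_
    have h4 : p * (a i * (star (d * g) * (d * g)) * b i) =
        a i * (star (d * g) * (d * (p * g))) * b i := by
      have e1 := hMP' _ (ha i) _ hp.mem
      have e2 := hMP' _ (star_mem (mul_mem hdM hg)) _ hp.mem
      have e3 := hMP' _ hdM _ hp.mem
      calc _ = (p * a i) * (star (d * g) * (d * g)) * b i := by simp only [mul_assoc]
        _ = a i * ((p * star (d * g)) * (d * g)) * b i := by rw [e1]; simp only [mul_assoc]
        _ = a i * (star (d * g) * ((p * d) * g)) * b i := by rw [e2]; simp only [mul_assoc]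
        _ = _ := by rw [e3]; simp only [mul_assoc]
    rw [h4, hpg]
    simp
  have hdζ : ζ * d = ζ := by
    rw [hζ, Finset.sum_mul]
    refine Finset.sum_congr rfl fun i _ => ?_
    calc a i * (star (d * g) * (d * g)) * b i * d
        = a i * (star (d * g) * (d * (g * b i * d))) := by simp only [mul_assoc]
      _ = a i * (star (d * g) * (d * d * g)) * b i := by
        rw [hdc _ (mul_mem hg (hb i))]; simp only [mul_assoc]
      _ = _ := by rw [hd.idem]
  have hDQ : Q ≤ commutant D :=
    le_commutant_comm.1 ((hDM.trans (centre_le_commutant M)).trans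
      (commutant_anti (hQM.trans (centre_le M))))
  obtain ⟨q, hq, h4⟩ := hd.exists_mul_eq hDQ (by rwa [sup_comm] at hζc)
  have h5 : d * q = ζ := by rw [← h4, ← hdc _ hζM, hdζ]
  have h6 : d * p * q = 0 := by
    rw [hMP' _ hdM _ hp.mem |>.symm, mul_assoc, h5, hpζ]
  rcases h d hd p hp.mem q hq h6 with h7 | h7
  · exact hdp h7
  · exact hζ0 (by rw [← h5, h7])

end Splitting

/-! ### Cyclic order and arc systems. -/

section ArcSystems

/-- Three points of `ZMod M` in strict cyclic order. -/
def Cyc {M : ℕ} (x y z : ZMod M) : Prop :=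
  ∃ i j k : ℤ, i < j ∧ j < k ∧ k < i + M ∧ x = i ∧ y = j ∧ z = k

theorem Cyc.rotate {M : ℕ} {x y z : ZMod M} (h : Cyc x y z) : Cyc y z x := by
  obtain ⟨i, j, k, h1, h2, h3, rfl, rfl, rfl⟩ := h
  exact ⟨j, k, i + M, h2, h3, by omega, rfl, rfl, by simp⟩

theorem Cyc.mk {M : ℕ} {i j k : ℤ} (h : (i < j ∧ j < k ∧ k < i + M) ∨
    (j < k ∧ k < i ∧ i < j + M) ∨ (k < i ∧ i < j ∧ j < k + M)) :
    Cyc (i : ZMod M) j k := by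
  rcases h with ⟨h1, h2, h3⟩ | ⟨h1, h2, h3⟩ | ⟨h1, h2, h3⟩
  · exact ⟨i, j, k, h1, h2, h3, rfl, rfl, rfl⟩
  · exact Cyc.rotate (Cyc.rotate ⟨j, k, i, h1, h2, h3, rfl, rfl, rfl⟩)
  · exact Cyc.rotate ⟨k, i, j, h1, h2, h3, rfl, rfl, rfl⟩

theorem intCast_zmod_ne {M : ℕ} {i j : ℤ} (h : i ≠ j) (h1 : i < j + M) (h2 : j < i + M) :
    (i : ZMod M) ≠ j := by
  intro he
  rw [ZMod.intCast_eq_intCast_iff_dvd_sub] at he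
  obtain ⟨k, hk⟩ := he
  have : k = 0 := by
    rcases lt_trichotomy k 0 with h | h | h
    · nlinarith
    · exact h
    · nlinarith
  subst this
  omega

theorem Cyc.ne {M : ℕ} {x y z : ZMod M} (h : Cyc x y z) : x ≠ y := by
  obtain ⟨i, j, k, h1, h2, h3, rfl, rfl, rfl⟩ := h
  exact intCast_zmod_ne (by omega) (by omega) (by omega)

theorem exists_intCast_zmod {M : ℕ} [NeZero M] (c : ℤ) (x : ZMod M) :
    ∃ i : ℤ, c ≤ i ∧ i < c + M ∧ x = i := by
  refine ⟨c + ((x - c : ZMod M).val : ℤ), by omega, ?_, by simp⟩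
  have := ZMod.val_lt (x - c : ZMod M)
  omega

/-- The cyclic order read off in a window starting at the first point. -/
theorem Cyc.exists_window {M : ℕ} {c : ℤ} {y z : ZMod M} (h : Cyc (c : ZMod M) y z) :
    ∃ j k : ℤ, c < j ∧ j < k ∧ k < c + M ∧ y = j ∧ z = k := by
  obtain ⟨i, j, k, h1, h2, h3, h4, rfl, rfl⟩ := h
  rw [ZMod.intCast_eq_intCast_iff_dvd_sub] at h4
  obtain ⟨t, ht⟩ := h4
  refine ⟨j - M * t, k - M * t, by omega, by omega, by omega, by simp, by simp⟩

variable {Ω : Type*} [CStarAlgebra Ω] {M : ℕ}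

/-- A system of algebras `F x y` attached to the arcs of a circle with endpoints in a set `X` of
cuts, such that the centre of `F x y` is generated by algebras attached to its endpoints. -/
structure ArcSystem (X : Set (ZMod M)) (F : ZMod M → ZMod M → StarSubalgebra ℂ Ω)
    (E : ZMod M → StarSubalgebra ℂ Ω) : Prop where
  dual : ∀ x ∈ X, ∀ y ∈ X, x ≠ y → commutant (F x y) = F y x
  mono : ∀ x ∈ X, ∀ y ∈ X, ∀ z ∈ X, Cyc x y z → F x y ≤ F x z
  cen : ∀ x ∈ X, ∀ y ∈ X, x ≠ y → centre (F x y) = E x ⊔ E y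
  star : ∀ x ∈ X, ∀ y ∈ X, ∀ z ∈ X, Cyc x y z →
    commutant (F x y ⊔ F y z ⊔ F z x) ≤ E x ⊔ E y ⊔ E z

namespace ArcSystem

variable {X : Set (ZMod M)} {F : ZMod M → ZMod M → StarSubalgebra ℂ Ω}
  {E : ZMod M → StarSubalgebra ℂ Ω}

theorem commutant_eq (h : ArcSystem X F E) {x y : ℤ} (hx : (x : ZMod M) ∈ X := by assumption)
    (hy : (y : ZMod M) ∈ X := by assumption)
    (hxy : x ≠ y ∧ x < y + M ∧ y < x + M := by omega) : commutant (F x y) = F y x :=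
  h.dual _ hx _ hy (intCast_zmod_ne hxy.1 hxy.2.1 hxy.2.2)

theorem centre_eq (h : ArcSystem X F E) {x y : ℤ} (hx : (x : ZMod M) ∈ X := by assumption)
    (hy : (y : ZMod M) ∈ X := by assumption)
    (hxy : x ≠ y ∧ x < y + M ∧ y < x + M := by omega) : centre (F x y) = E x ⊔ E y :=
  h.cen _ hx _ hy (intCast_zmod_ne hxy.1 hxy.2.1 hxy.2.2)

/-- Dual to `mono`, since commutants exchange the two ends of an arc. -/
theorem mono_right (h : ArcSystem X F E) {x y z : ZMod M} (hx : x ∈ X) (hy : y ∈ X) (hz : z ∈ X)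
    (hc : Cyc x y z) : F y z ≤ F x z := by
  have h1 := h.mono _ hz _ hx _ hy hc.rotate.rotate
  have h2 := commutant_anti h1
  rw [h.dual _ hz _ hx hc.rotate.rotate.ne, h.dual _ hz _ hy hc.rotate.ne.symm] at h2
  exact h2

/-- Monotonicity in the arc. -/
theorem sub (h : ArcSystem X F E) {x y x' y' : ℤ} (hx : (x : ZMod M) ∈ X := by assumption)
    (hy : (y : ZMod M) ∈ X := by assumption) (hx' : (x' : ZMod M) ∈ X := by assumption)
    (hy' : (y' : ZMod M) ∈ X := by assumption)
    (hc : (x' ≤ x ∧ x < y ∧ y ≤ y' ∧ y' < x' + M) ∨ (x < y ∧ y ≤ y' ∧ y' < x' ∧ x' < x + M) ∨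
      (y ≤ y' ∧ y' < x' ∧ x' ≤ x ∧ x < y + M) ∨ (y' < x' ∧ x' ≤ x ∧ x < y ∧ y < y' + M) := by
        omega) :
    F x y ≤ F x' y' := by
  have h1 : F x y ≤ F x' y := by
    by_cases he : x = x'
    · rw [he]
    · exact h.mono_right hx' hx hy (Cyc.mk (by omega))
  have h2 : F x' y ≤ F x' y' := by
    by_cases he : y = y'
    · rw [he]
    · exact h.mono _ hx' _ hy _ hy' (Cyc.mk (by omega))
  exact h1.trans h2

/-- Algebras of disjoint arcs commute. -/
theorem disj (h : ArcSystem X F E) {x y x' y' : ℤ} (hx : (x : ZMod M) ∈ X := by assumption)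
    (hy : (y : ZMod M) ∈ X := by assumption) (hx' : (x' : ZMod M) ∈ X := by assumption)
    (hy' : (y' : ZMod M) ∈ X := by assumption)
    (hc : (y' ≤ x ∧ x < y ∧ y ≤ x' ∧ x' < y' + M) ∨ (x < y ∧ y ≤ x' ∧ x' < y' ∧ y' < x + M) ∨
      (y ≤ x' ∧ x' < y' ∧ y' ≤ x ∧ x < y + M) ∨ (x' < y' ∧ y' ≤ x ∧ x < y ∧ y < x' + M) := by
        omega) :
    F x y ≤ commutant (F x' y') := by
  rw [h.commutant_eq (x := x') (y := y')]
  exact h.sub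

theorem edge_left (h : ArcSystem X F E) {x y : ℤ} (hx : (x : ZMod M) ∈ X := by assumption)
    (hy : (y : ZMod M) ∈ X := by assumption)
    (hxy : x ≠ y ∧ x < y + M ∧ y < x + M := by omega) : E x ≤ F x y :=
  (le_sup_left.trans h.centre_eq.ge).trans (centre_le _)

theorem edge_right (h : ArcSystem X F E) {x y : ℤ} (hx : (x : ZMod M) ∈ X := by assumption)
    (hy : (y : ZMod M) ∈ X := by assumption)
    (hxy : x ≠ y ∧ x < y + M ∧ y < x + M := by omega) : E y ≤ F x y :=
  (le_sup_right.trans h.centre_eq.ge).trans (centre_le _)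

/-- The algebra of a cut is contained in that of every arc containing the cut. -/
theorem edge (h : ArcSystem X F E) {x y z : ℤ} (hx : (x : ZMod M) ∈ X := by assumption)
    (hy : (y : ZMod M) ∈ X := by assumption) (hz : (z : ZMod M) ∈ X := by assumption)
    (hc : (y ≤ x ∧ x ≤ z ∧ y < z ∧ z < y + M) ∨ (x ≤ z ∧ z < y ∧ y < x + M) ∨
      (z < y ∧ y ≤ x ∧ x < z + M) := by omega) :
    E x ≤ F y z := by
  by_cases he : x = y
  · subst he; exact h.edge_left
  · exact (h.edge_right (x := y) (y := x)).trans h.sub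

/-- The algebra of a cut commutes with that of every arc not containing the cut in its interior. -/
theorem edge_comm (h : ArcSystem X F E) {x y z : ℤ} (hx : (x : ZMod M) ∈ X := by assumption)
    (hy : (y : ZMod M) ∈ X := by assumption) (hz : (z : ZMod M) ∈ X := by assumption)
    (hc : (z ≤ x ∧ x ≤ y ∧ z < y ∧ y < z + M) ∨ (x ≤ y ∧ y < z ∧ z < x + M) ∨
      (y < z ∧ z ≤ x ∧ x < y + M) := by omega) :
    E x ≤ commutant (F y z) := by
  rw [h.commutant_eq (x := y) (y := z)]
  exact h.edge

theorem edge_comm' (h : ArcSystem X F E) {x y z : ℤ} (hx : (x : ZMod M) ∈ X := by assumption)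
    (hy : (y : ZMod M) ∈ X := by assumption) (hz : (z : ZMod M) ∈ X := by assumption)
    (hc : (z ≤ x ∧ x ≤ y ∧ z < y ∧ y < z + M) ∨ (x ≤ y ∧ y < z ∧ z < x + M) ∨
      (y < z ∧ z ≤ x ∧ x < y + M) := by omega) :
    F y z ≤ commutant (E x) :=
  le_commutant_comm.1 h.edge_comm

theorem edge_abelian (h : ArcSystem X F E) {x y : ZMod M} (hx : x ∈ X) (hy : y ∈ X) (hxy : x ≠ y) :
    E x ≤ commutant (E x) := by
  have h1 : E x ≤ centre (F x y) := le_sup_left.trans (h.cen _ hx _ hy hxy).ge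
  exact (h1.trans (centre_le_commutant _)).trans (commutant_anti (h1.trans (centre_le _)))

variable [FiniteDimensional ℂ Ω] [Nontrivial Ω]

/-- The circle with three arcs: the commutant of two of them. -/
theorem commutant_sup_le (h : ArcSystem X F E) (hfac : Subalgebra.center ℂ Ω = ⊥) {x y z : ZMod M}
    (hx : x ∈ X) (hy : y ∈ X) (hz : z ∈ X) (hc : Cyc x y z) :
    commutant (F x y ⊔ F y z) ≤ F z x ⊔ E y := by
  obtain ⟨i, j, k, h1, h2, h3, rfl, rfl, rfl⟩ := hc
  have hE : E i ⊔ E j ⊔ E k ≤ F i j ⊔ F j k :=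
    sup_le (sup_le (le_sup_of_le_left h.edge) (le_sup_of_le_left h.edge)) (le_sup_of_le_right h.edge)
  -- This is `star` after taking commutants: the three edge algebras lie in the two arcs, so what
  -- commutes with the arcs commutes with the edges.
  have h4 : commutant (F i j ⊔ F j k) ≤ F i j ⊔ F j k ⊔ F k i := by
    have := commutant_le_comm hfac (h.star _ hx _ hy _ hz (Cyc.mk (by omega)))
    exact (commutant_anti hE).trans this
  have h5 : F i j ⊔ F j k ≤ commutant (F k i) := sup_le h.disj h.disj
  calc commutant (F i j ⊔ F j k) ≤ (F i j ⊔ F j k ⊔ F k i) ⊓ commutant (F i j ⊔ F j k) :=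
        le_inf h4 le_rfl
    _ ≤ centre (F i j ⊔ F j k) ⊔ F k i := sup_inf_commutant_left_le h5
    _ ≤ (centre (F i j) ⊔ centre (F j k)) ⊔ F k i := sup_le_sup_right (centre_sup_le h.disj) _
    _ ≤ F k i ⊔ E j := by
      rw [h.centre_eq (x := i) (y := j), h.centre_eq (x := j) (y := k)]
      have e1 : E i ≤ F k i := h.edge
      have e2 : E k ≤ F k i := h.edge
      exact sup_le (sup_le (sup_le (le_sup_of_le_left e1) le_sup_right)
        (sup_le le_sup_right (le_sup_of_le_left e2))) le_sup_left

theorem bip (h : ArcSystem X F E) (hfac : Subalgebra.center ℂ Ω = ⊥) {x y z : ℤ}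
    (hx : (x : ZMod M) ∈ X := by assumption) (hy : (y : ZMod M) ∈ X := by assumption)
    (hz : (z : ZMod M) ∈ X := by assumption)
    (hc : (x < y ∧ y < z ∧ z < x + M) ∨ (y < z ∧ z < x ∧ x < y + M) ∨
      (z < x ∧ x < y ∧ y < z + M) := by omega) :
    commutant (F x y ⊔ F y z) ≤ F z x ⊔ E y :=
  h.commutant_sup_le hfac hx hy hz (Cyc.mk hc)

end ArcSystem

end ArcSystems

/-! ### Cutting one arc: the centres of the pieces. -/

section CondIndep

variable {Ω : Type*} [CStarAlgebra Ω]

/-- Conditional independence of `P` and `Q` given the commutative algebra `D`. -/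
def CondIndep (P D Q : StarSubalgebra ℂ Ω) : Prop :=
  ∀ d, IsMinIdem D d → ∀ p ∈ P, ∀ q ∈ Q, d * p * q = 0 → d * p = 0 ∨ d * q = 0

/-- Over the scalars, the condition on supports asks that a non-zero idempotent of `P` kill no
non-zero element of `M`. -/
theorem supportsIn_bot_of_uncorrelated {M P : StarSubalgebra ℂ Ω} (h : Uncorrelated P M) :
    SupportsIn M P ⊥ := by
  intro p d hp _ _ g hg hpg
  rcases h p hp.mem g hg hpg with h1 | h1
  · exact absurd h1 hp.ne_zero
  · rw [h1, mul_zero]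

theorem centre_commutant [FiniteDimensional ℂ Ω] [Nontrivial Ω]
    (hfac : Subalgebra.center ℂ Ω = ⊥) (A : StarSubalgebra ℂ Ω) :
    centre (commutant A) = centre A := by
  rw [centre, commutant_commutant hfac, inf_comm, centre]

end CondIndep

/-- The data for cutting an arc `[a, b)` of an arc system at a point `c`, by means of an algebra `Q`
which plays the role of what is on the left of the cut. -/
structure CutData {Ω : Type*} [CStarAlgebra Ω] {M : ℕ} (X : Set (ZMod M))
    (F : ZMod M → ZMod M → StarSubalgebra ℂ Ω) (E : ZMod M → StarSubalgebra ℂ Ω)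
    (Q : StarSubalgebra ℂ Ω) (c b v z q a : ℤ) : Prop where
  sys : ArcSystem X F E
  hcb : c < b
  hbv : b ≤ v
  hvz : v < z
  hzq : z ≤ q
  hqa : q < a
  hac : a < c + M
  mem_b : (b : ZMod M) ∈ X
  mem_v : (v : ZMod M) ∈ X
  mem_z : (z : ZMod M) ∈ X
  mem_q : (q : ZMod M) ∈ X
  mem_a : (a : ZMod M) ∈ X
  window : ∀ x ∈ X, ∃ i : ℤ, b ≤ i ∧ i ≤ a ∧ x = i
  le : Q ≤ F q b
  indep_left : ∀ x : ℤ, (x : ZMod M) ∈ X → b ≤ x → x < z → CondIndep (E z) (E x) (E q)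
  indep_right : ∀ x : ℤ, (x : ZMod M) ∈ X → z < x → x ≤ a → CondIndep (E z) (E x) (E v)
  indep : CondIndep (E v) (E z) (E b)
  uncorrelated : Uncorrelated (E z) (F a b)

set_option linter.unusedSectionVars false

namespace CutData

variable {Ω : Type*} [CStarAlgebra Ω] [FiniteDimensional ℂ Ω] {M : ℕ} {X : Set (ZMod M)}
  {F : ZMod M → ZMod M → StarSubalgebra ℂ Ω} {E : ZMod M → StarSubalgebra ℂ Ω}
  {Q : StarSubalgebra ℂ Ω} {c b v z q a : ℤ}

theorem Q_comm (h : CutData X F E Q c b v z q a) {x y : ℤ} (hx : (x : ZMod M) ∈ X)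
    (hy : (y : ZMod M) ∈ X) (hbx : b ≤ x) (hxy : x < y) (hyq : y ≤ q) :
    F x y ≤ commutant Q := by
  obtain ⟨sys, _, _, _, _, _, _, mem_b, mem_v, mem_z, mem_q, mem_a, -, le, -⟩ := h
  exact (sys.disj (x := x) (y := y) (x' := q) (y' := b)).trans (commutant_anti le)

theorem edge_Q_comm (h : CutData X F E Q c b v z q a) {x : ℤ} (hx : (x : ZMod M) ∈ X)
    (hbx : b ≤ x) (hxq : x ≤ q) : E x ≤ commutant Q := by
  obtain ⟨sys, _, _, _, _, _, _, mem_b, mem_v, mem_z, mem_q, mem_a, -, le, -⟩ := h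
  exact (sys.edge_comm (x := x) (y := q) (z := b)).trans (commutant_anti le)

theorem Q_le (h : CutData X F E Q c b v z q a) {x y : ℤ} (hx : (x : ZMod M) ∈ X)
    (hy : (y : ZMod M) ∈ X) (hby : b ≤ y) (hyx : y < x) (hxq : x ≤ q) : Q ≤ F x y := by
  obtain ⟨sys, _, _, _, _, _, _, mem_b, mem_v, mem_z, mem_q, mem_a, -, le, -⟩ := h
  exact le.trans sys.sub

/-- The algebra on the left of the cut. -/
def left (_ : CutData X F E Q c b v z q a) : StarSubalgebra ℂ Ω := F z a ⊔ Q

theorem commutant_left (h : CutData X F E Q c b v z q a) :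
    commutant h.left = F a z ⊓ commutant Q := by
  obtain ⟨sys, _, _, _, _, _, _, mem_b, mem_v, mem_z, mem_q, mem_a, -⟩ := h
  rw [left, commutant_sup, sys.commutant_eq (x := z) (y := a)]

theorem left_le (h : CutData X F E Q c b v z q a) : h.left ≤ F z b := by
  refine sup_le ?_ (h.Q_le h.mem_z h.mem_b le_rfl (by linarith [h.hbv, h.hvz]) h.hzq)
  obtain ⟨sys, _, _, _, _, _, _, mem_b, mem_v, mem_z, mem_q, mem_a, -⟩ := h
  exact sys.sub

theorem le_commutant_left (h : CutData X F E Q c b v z q a) {x y : ℤ} (hx : (x : ZMod M) ∈ X)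
    (hy : (y : ZMod M) ∈ X) (hbx : b ≤ x) (hxy : x < y) (hyz : y ≤ z) :
    F x y ≤ commutant h.left := by
  rw [h.commutant_left]
  refine le_inf ?_ (h.Q_comm hx hy hbx hxy (by linarith [h.hzq]))
  obtain ⟨sys, _, _, _, _, _, _, mem_b, mem_v, mem_z, mem_q, mem_a, -⟩ := h
  exact sys.sub

theorem edge_le_commutant_left (h : CutData X F E Q c b v z q a) {x : ℤ} (hx : (x : ZMod M) ∈ X)
    (hbx : b ≤ x) (hxz : x ≤ z) : E x ≤ commutant h.left := by
  rw [h.commutant_left]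
  refine le_inf ?_ (h.edge_Q_comm hx hbx (by linarith [h.hzq]))
  obtain ⟨sys, _, _, _, _, _, _, mem_b, mem_v, mem_z, mem_q, mem_a, -⟩ := h
  exact sys.edge

theorem le_left (h : CutData X F E Q c b v z q a) {x y : ℤ} (hx : (x : ZMod M) ∈ X)
    (hy : (y : ZMod M) ∈ X) (hzx : z ≤ x) (hxy : x < y) (hya : y ≤ a) : F x y ≤ h.left := by
  obtain ⟨sys, _, _, _, _, _, _, mem_b, mem_v, mem_z, mem_q, mem_a, -⟩ := h
  exact le_sup_of_le_left sys.sub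

theorem edge_le_left (h : CutData X F E Q c b v z q a) {x : ℤ} (hx : (x : ZMod M) ∈ X)
    (hzx : z ≤ x) (hxa : x ≤ a) : E x ≤ h.left := by
  obtain ⟨sys, _, _, _, _, _, _, mem_b, mem_v, mem_z, mem_q, mem_a, -⟩ := h
  exact le_sup_of_le_left sys.edge

/-- The arc `F q x` is large enough to contain both `F a x` and `Q`, as the modular law in
`commutant_sup_left_le` requires. -/
theorem supports_left (h : CutData X F E Q c b v z q a) {x : ℤ} (hx : (x : ZMod M) ∈ X)
    (hbx : b ≤ x) (hxz : x < z) : SupportsIn (F q x) (E z) (E x) := by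
  have h1 := h.indep_left x hx hbx hxz
  obtain ⟨sys, _, _, _, _, _, _, mem_b, mem_v, mem_z, mem_q, mem_a, -⟩ := h
  have h2 := sys.centre_eq (x := q) (y := x)
  exact supportsIn_of_condIndep sys.edge_comm' (by rw [h2, sup_comm]) (by rw [h2]; exact le_sup_right)
    (by rw [h2]; exact le_sup_left) h1

/-- Here the arc `F x v` contains both `F x b` and `h.fwd v`. -/
theorem supports_right (h : CutData X F E Q c b v z q a) {x : ℤ} (hx : (x : ZMod M) ∈ X)
    (hzx : z < x) (hxa : x ≤ a) : SupportsIn (F x v) (E z) (E x) := by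
  have h1 := h.indep_right x hx hzx hxa
  obtain ⟨sys, _, _, _, _, _, _, mem_b, mem_v, mem_z, mem_q, mem_a, -⟩ := h
  have h2 := sys.centre_eq (x := x) (y := v)
  exact supportsIn_of_condIndep sys.edge_comm' (by rw [h2]) (by rw [h2]; exact le_sup_left)
    (by rw [h2]; exact le_sup_right) h1

theorem edge_abelian (h : CutData X F E Q c b v z q a) {x : ℤ} (hx : (x : ZMod M) ∈ X) :
    E x ≤ commutant (E x) := by
  have hne : (z : ZMod M) ≠ (a : ZMod M) := by
    obtain ⟨sys, _, _, _, _, _, _, mem_b, mem_v, mem_z, mem_q, mem_a, -⟩ := h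
    exact intCast_zmod_ne (by omega) (by omega) (by omega)
  by_cases h1 : (x : ZMod M) = z
  · exact h.sys.edge_abelian hx h.mem_a (h1 ▸ hne)
  · exact h.sys.edge_abelian hx h.mem_z h1

/-- The algebra of the arc from the cut to a point before `z`. -/
def fwd (_ : CutData X F E Q c b v z q a) (x : ℤ) : StarSubalgebra ℂ Ω := F a x ⊓ commutant Q

/-- The algebra of the arc from a point after `z` to the cut. -/
def bwd (h : CutData X F E Q c b v z q a) (x : ℤ) : StarSubalgebra ℂ Ω := F x b ⊓ h.left

theorem fwd_le (h : CutData X F E Q c b v z q a) {x : ℤ} (hx : (x : ZMod M) ∈ X)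
    (hbx : b ≤ x) (hxz : x ≤ z) : h.fwd x ≤ commutant h.left := by
  rw [h.commutant_left]
  refine inf_le_inf_right _ ?_
  obtain ⟨sys, _, _, _, _, _, _, mem_b, mem_v, mem_z, mem_q, mem_a, -⟩ := h
  exact sys.sub

/-- `bip` puts what commutes with the arcs from `x` to `z` and from `z` to `a` into `F a x ⊔ E z`.
Commutation with `Q` is then imposed inside `F a x` alone, thanks to the supports. -/
theorem commutant_sup_left_le (h : CutData X F E Q c b v z q a) [Nontrivial Ω]
    (hfac : Subalgebra.center ℂ Ω = ⊥) {x : ℤ} (hx : (x : ZMod M) ∈ X) (hbx : b ≤ x)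
    (hxz : x < z) : commutant (F x z ⊔ h.left) ≤ h.fwd x ⊔ E z := by
  have hs := h.supports_left hx hbx hxz
  have hz := h.edge_abelian h.mem_z
  have hQ := h.Q_le h.mem_q hx hbx (by linarith [h.hzq]) le_rfl
  obtain ⟨sys, _, _, _, _, _, _, mem_b, mem_v, mem_z, mem_q, mem_a, -⟩ := h
  rw [left, ← sup_assoc, commutant_sup]
  refine (inf_le_inf_right _ (sys.bip hfac)).trans ?_
  exact sup_inf_commutant_le_of_supportsIn sys.sub hQ hz sys.edge_comm' sys.edge sys.edge_comm hs

/-- The commutant of the left side is generated locally. Dually, an element commuting with both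
generators is first placed in `h.left ⊔ E v`; then `E v` is removed because `E v` and `E b` are
independent given `E z`. -/
theorem commutant_left_le (h : CutData X F E Q c b v z q a) [Nontrivial Ω]
    (hfac : Subalgebra.center ℂ Ω = ⊥) : commutant h.left ≤ F b z ⊔ h.fwd v := by
  apply commutant_le_comm hfac
  rw [commutant_sup]
  intro y hy
  obtain ⟨hy1, hy2⟩ := hy
  have hb1 := h.commutant_sup_left_le hfac h.mem_v h.hbv h.hvz
  have hvl : F v z ≤ commutant h.left := h.le_commutant_left h.mem_v h.mem_z h.hbv h.hvz le_rfl
  have hLz : h.left ≤ F z b := h.left_le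
  have hzL : E z ≤ h.left :=
    h.edge_le_left h.mem_z le_rfl (by linarith [h.hzq, h.hqa])
  have hv := h.edge_abelian h.mem_v
  have hz := h.edge_abelian h.mem_z
  have hind := h.indep
  have hy3 : y ∈ F v z ⊔ h.left := by
    rw [← commutant_commutant hfac (F v z ⊔ h.left)]
    refine commutant_anti hb1 ?_
    rw [commutant_sup]
    refine ⟨hy2, ?_⟩
    obtain ⟨sys, _, _, _, _, _, _, mem_b, mem_v, mem_z, mem_q, mem_a, -⟩ := h
    exact commutant_anti sys.edge hy1
  have hy4 : y ∈ centre (F v z) ⊔ h.left := by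
    refine sup_inf_commutant_left_le hvl ⟨hy3, ?_⟩
    obtain ⟨sys, _, _, _, _, _, _, mem_b, mem_v, mem_z, mem_q, mem_a, -⟩ := h
    exact commutant_anti sys.sub hy1
  have hcz : centre (F v z) = E v ⊔ E z := by
    obtain ⟨sys, _, _, _, _, _, _, mem_b, mem_v, mem_z, mem_q, mem_a, -⟩ := h
    exact sys.centre_eq
  have hy5 : y ∈ h.left ⊔ E v := by
    rw [hcz] at hy4
    exact (sup_le (sup_le le_sup_right (le_sup_of_le_left hzL)) le_sup_left :
      E v ⊔ E z ⊔ h.left ≤ h.left ⊔ E v) hy4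
  have hy6 : y ∈ F z b := by
    obtain ⟨sys, _, _, _, _, _, _, mem_b, mem_v, mem_z, mem_q, mem_a, -⟩ := h
    rwa [sys.commutant_eq (x := b) (y := z)] at hy1
  obtain ⟨sys, _, _, _, _, _, _, mem_b, mem_v, mem_z, mem_q, mem_a, -⟩ := id h
  have h2 := sys.centre_eq (x := z) (y := b)
  refine inf_sup_le_of_supportsIn hLz hv sys.edge_comm' hzL hz ?_ ⟨hy6, hy5⟩
  exact supportsIn_of_condIndep sys.edge_comm' (by rw [h2]) (by rw [h2]; exact le_sup_left)
    (by rw [h2]; exact le_sup_right) hind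

/-- Mirror image of `commutant_sup_left_le`. The algebra `commutant h.left` is first replaced by the
generators from `commutant_left_le`, because `h.fwd v` lies in the arc `F x v` where the supports
are controlled. -/
theorem commutant_sup_commutant_left_le (h : CutData X F E Q c b v z q a) [Nontrivial Ω]
    (hfac : Subalgebra.center ℂ Ω = ⊥) {x : ℤ} (hx : (x : ZMod M) ∈ X) (hzx : z < x)
    (hxa : x ≤ a) : commutant (F z x ⊔ commutant h.left) ≤ h.bwd x ⊔ E z := by
  have hs := h.supports_right hx hzx hxa
  have hz := h.edge_abelian h.mem_z
  have hG := h.commutant_left_le hfac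
  have hbz : F b z ≤ commutant h.left := h.le_commutant_left h.mem_b h.mem_z le_rfl
    (by linarith [h.hbv, h.hvz]) le_rfl
  have hfv := h.fwd_le h.mem_v h.hbv h.hvz.le
  have h1 : commutant (F z x ⊔ commutant h.left) ≤
      commutant (F b z ⊔ F z x) ⊓ commutant (h.fwd v) := by
    rw [← commutant_sup]
    exact commutant_anti (sup_le (sup_le (le_sup_of_le_right hbz) le_sup_left)
      (le_sup_of_le_right hfv))
  have h2 : commutant (F b z ⊔ F z x) ⊓ commutant (h.fwd v) ≤
      (F x b ⊓ commutant (h.fwd v)) ⊔ E z := by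
    obtain ⟨sys, _, _, _, _, _, _, mem_b, mem_v, mem_z, mem_q, mem_a, -⟩ := h
    refine (inf_le_inf_right _ (sys.bip hfac)).trans ?_
    exact sup_inf_commutant_le_of_supportsIn (N := F x v) (D := E x) sys.sub
      (inf_le_left.trans sys.sub) hz sys.edge_comm' sys.edge sys.edge_comm hs
  refine (h1.trans h2).trans (sup_le_sup_right (le_inf inf_le_left ?_) _)
  rw [← commutant_commutant hfac h.left]
  refine le_trans ?_ (commutant_anti hG)
  rw [commutant_sup]
  refine inf_le_inf_right _ ?_
  obtain ⟨sys, _, _, _, _, _, _, mem_b, mem_v, mem_z, mem_q, mem_a, -⟩ := h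
  exact sys.disj

/-- The algebra of the cut. -/
def edgeCut (h : CutData X F E Q c b v z q a) : StarSubalgebra ℂ Ω := h.fwd b ⊓ h.bwd a

theorem edgeCut_le (h : CutData X F E Q c b v z q a) : h.edgeCut ≤ F a b :=
  inf_le_left.trans inf_le_left

theorem edgeCut_le_left (h : CutData X F E Q c b v z q a) : h.edgeCut ≤ h.left :=
  inf_le_right.trans inf_le_right

theorem edgeCut_le_commutant_left (h : CutData X F E Q c b v z q a) :
    h.edgeCut ≤ commutant h.left :=
  inf_le_left.trans (h.fwd_le h.mem_b le_rfl (by linarith [h.hbv, h.hvz]))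

/-- The two bounds on commutants catch a central element in `h.fwd b ⊔ E z` and in `h.bwd a ⊔ E z`.
The intersection distributes over `E z`, which is uncorrelated with the arc being cut. -/
theorem centre_left (h : CutData X F E Q c b v z q a) [Nontrivial Ω]
    (hfac : Subalgebra.center ℂ Ω = ⊥) : centre h.left = h.edgeCut ⊔ E z := by
  have hbz : b < z := by linarith [h.hbv, h.hvz]
  have hza : z < a := by linarith [h.hzq, h.hqa]
  apply le_antisymm
  · have h1 : centre h.left ≤ h.fwd b ⊔ E z := by
      refine le_trans ?_ (h.commutant_sup_left_le hfac h.mem_b le_rfl hbz)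
      rw [commutant_sup]
      refine le_inf ((centre_le _).trans ?_) (centre_le_commutant _)
      rw [le_commutant_comm]
      exact h.le_commutant_left h.mem_b h.mem_z le_rfl hbz le_rfl
    have h2 : centre h.left ≤ h.bwd a ⊔ E z := by
      refine le_trans ?_ (h.commutant_sup_commutant_left_le hfac h.mem_a hza le_rfl)
      rw [commutant_sup, commutant_commutant hfac]
      refine le_inf ((centre_le_commutant _).trans (commutant_anti ?_)) (centre_le _)
      exact h.le_left h.mem_z h.mem_a le_rfl hza le_rfl
    refine (le_inf h1 h2).trans ?_
    refine sup_inf_sup_le_of_supportsIn (N := F a b) (D := ⊥) inf_le_left inf_le_left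
      (h.edge_abelian h.mem_z) ?_ bot_le bot_le (bot_le_commutant _)
      (supportsIn_bot_of_uncorrelated h.uncorrelated)
    obtain ⟨sys, _, _, _, _, _, _, mem_b, mem_v, mem_z, mem_q, mem_a, -⟩ := h
    exact sys.edge_comm'
  · exact sup_le (le_inf h.edgeCut_le_left h.edgeCut_le_commutant_left)
      (le_inf (h.edge_le_left h.mem_z le_rfl hza.le)
        (h.edge_le_commutant_left h.mem_z hbz.le le_rfl))

theorem fwd_self (h : CutData X F E Q c b v z q a) : h.fwd z = commutant h.left :=
  h.commutant_left.symm

/-- A central element of `h.fwd x` turns out to be central in `F x z ⊔ h.left`, whose centre is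
known from `centre_left`. The extra `E z` is then removed by means of the supports. -/
theorem centre_fwd (h : CutData X F E Q c b v z q a) [Nontrivial Ω]
    (hfac : Subalgebra.center ℂ Ω = ⊥) {x : ℤ} (hx : (x : ZMod M) ∈ X) (hbx : b ≤ x)
    (hxz : x ≤ z) : centre (h.fwd x) = h.edgeCut ⊔ E x := by
  rcases eq_or_lt_of_le hxz with rfl | hxz
  · rw [h.fwd_self, centre_commutant hfac, h.centre_left hfac]
  have hcx : h.edgeCut ≤ F a x := by
    refine h.edgeCut_le.trans ?_
    obtain ⟨sys, _, _, _, _, _, _, mem_b, mem_v, mem_z, mem_q, mem_a, -⟩ := h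
    exact sys.sub
  have hxa : E x ≤ F a x := by
    obtain ⟨sys, _, _, _, _, _, _, mem_b, mem_v, mem_z, mem_q, mem_a, -⟩ := h
    exact sys.edge
  have hxz' : F x z ≤ commutant h.left := h.le_commutant_left hx h.mem_z hbx hxz le_rfl
  apply le_antisymm
  · have h1 : centre (h.fwd x) ≤ F x z ⊔ h.left := by
      rw [← commutant_commutant hfac (F x z ⊔ h.left)]
      refine le_trans ?_ (commutant_anti (h.commutant_sup_left_le hfac hx hbx hxz))
      refine le_commutant_sup (centre_le_commutant _) ((centre_le _).trans (inf_le_left.trans ?_))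
      obtain ⟨sys, _, _, _, _, _, _, mem_b, mem_v, mem_z, mem_q, mem_a, -⟩ := h
      exact sys.edge_comm'
    have h2 : centre (h.fwd x) ≤ commutant (F x z ⊔ h.left) := by
      refine (centre_le _).trans (le_commutant_sup ?_ (h.fwd_le hx hbx hxz.le))
      refine inf_le_left.trans ?_
      obtain ⟨sys, _, _, _, _, _, _, mem_b, mem_v, mem_z, mem_q, mem_a, -⟩ := h
      exact sys.disj
    have h3 : centre (h.fwd x) ≤ (h.edgeCut ⊔ E x) ⊔ E z := by
      refine (le_inf h1 h2 : _ ≤ centre (F x z ⊔ h.left)).trans ((centre_sup_le hxz').trans ?_)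
      rw [h.centre_left hfac, (by
        obtain ⟨sys, _, _, _, _, _, _, mem_b, mem_v, mem_z, mem_q, mem_a, -⟩ := h
        exact sys.centre_eq : centre (F x z) = E x ⊔ E z)]
      exact sup_le (sup_le (le_sup_of_le_left le_sup_right) le_sup_right)
        (sup_le (le_sup_of_le_left le_sup_left) le_sup_right)
    refine (le_inf ((centre_le _).trans inf_le_left) h3).trans ?_
    have hs := h.supports_left hx hbx hxz
    have hz := h.edge_abelian h.mem_z
    have hx' := h.edge_abelian hx
    obtain ⟨sys, _, _, _, _, _, _, mem_b, mem_v, mem_z, mem_q, mem_a, -⟩ := id h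
    exact inf_sup_le_of_supportsIn (D := E x) (sup_le hcx hxa) hz sys.edge_comm' le_sup_right
      hx' (hs.mono sys.sub)
  · refine sup_le (le_inf (le_inf hcx (inf_le_left.trans inf_le_right)) ?_)
      (le_inf (le_inf hxa (h.edge_Q_comm hx hbx (by linarith [h.hzq]))) ?_)
    · exact h.edgeCut_le_left.trans (le_commutant_comm.1 (h.fwd_le hx hbx hxz.le))
    · refine le_trans ?_ (commutant_anti inf_le_left)
      obtain ⟨sys, _, _, _, _, _, _, mem_b, mem_v, mem_z, mem_q, mem_a, -⟩ := h
      exact sys.edge_comm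

/-- Same argument as for `centre_fwd`, with `F z x ⊔ commutant h.left` as the auxiliary algebra. -/
theorem centre_bwd (h : CutData X F E Q c b v z q a) [Nontrivial Ω]
    (hfac : Subalgebra.center ℂ Ω = ⊥) {x : ℤ} (hx : (x : ZMod M) ∈ X) (hzx : z < x)
    (hxa : x ≤ a) : centre (h.bwd x) = h.edgeCut ⊔ E x := by
  have hcx : h.edgeCut ≤ F x b := by
    refine h.edgeCut_le.trans ?_
    obtain ⟨sys, _, _, _, _, _, _, mem_b, mem_v, mem_z, mem_q, mem_a, -⟩ := h
    exact sys.sub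
  have hxb : E x ≤ F x b := by
    obtain ⟨sys, _, _, _, _, _, _, mem_b, mem_v, mem_z, mem_q, mem_a, -⟩ := h
    exact sys.edge
  have hzx' : F z x ≤ h.left := h.le_left h.mem_z hx le_rfl hzx hxa
  apply le_antisymm
  · have h1 : centre (h.bwd x) ≤ F z x ⊔ commutant h.left := by
      rw [← commutant_commutant hfac (F z x ⊔ commutant h.left)]
      refine le_trans ?_ (commutant_anti (h.commutant_sup_commutant_left_le hfac hx hzx hxa))
      refine le_commutant_sup (centre_le_commutant _) ((centre_le _).trans (inf_le_left.trans ?_))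
      obtain ⟨sys, _, _, _, _, _, _, mem_b, mem_v, mem_z, mem_q, mem_a, -⟩ := h
      exact sys.edge_comm'
    have h2 : centre (h.bwd x) ≤ commutant (F z x ⊔ commutant h.left) := by
      refine (centre_le _).trans (le_commutant_sup (inf_le_left.trans ?_)
        (inf_le_right.trans (le_commutant_commutant _)))
      obtain ⟨sys, _, _, _, _, _, _, mem_b, mem_v, mem_z, mem_q, mem_a, -⟩ := h
      exact sys.disj
    have h3 : centre (h.bwd x) ≤ (h.edgeCut ⊔ E x) ⊔ E z := by
      refine (le_inf h1 h2 : _ ≤ centre (F z x ⊔ commutant h.left)).trans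
        ((centre_sup_le (hzx'.trans (le_commutant_commutant _))).trans ?_)
      rw [centre_commutant hfac, h.centre_left hfac, (by
        obtain ⟨sys, _, _, _, _, _, _, mem_b, mem_v, mem_z, mem_q, mem_a, -⟩ := h
        exact sys.centre_eq : centre (F z x) = E z ⊔ E x)]
      exact sup_le (sup_le le_sup_right (le_sup_of_le_left le_sup_right))
        (sup_le (le_sup_of_le_left le_sup_left) le_sup_right)
    refine (le_inf ((centre_le _).trans inf_le_left) h3).trans ?_
    have hs := h.supports_right hx hzx hxa
    have hz := h.edge_abelian h.mem_z
    have hx' := h.edge_abelian hx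
    obtain ⟨sys, _, _, _, _, _, _, mem_b, mem_v, mem_z, mem_q, mem_a, -⟩ := id h
    exact inf_sup_le_of_supportsIn (D := E x) (sup_le hcx hxb) hz sys.edge_comm' le_sup_right
      hx' (hs.mono sys.sub)
  · refine sup_le (le_inf (le_inf hcx h.edgeCut_le_left) ?_)
      (le_inf (le_inf hxb (h.edge_le_left hx hzx.le hxa)) ?_)
    · exact h.edgeCut_le_commutant_left.trans (commutant_anti inf_le_right)
    · refine le_trans ?_ (commutant_anti inf_le_left)
      obtain ⟨sys, _, _, _, _, _, _, mem_b, mem_v, mem_z, mem_q, mem_a, -⟩ := h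
      exact sys.edge_comm

/-- The commutant, inside the algebra of the arc that is cut, of the two pieces. -/
theorem inf_commutant_pieces_le (h : CutData X F E Q c b v z q a) [Nontrivial Ω]
    (hfac : Subalgebra.center ℂ Ω = ⊥) :
    F a b ⊓ commutant (h.bwd a ⊔ h.fwd b) ≤ E a ⊔ E b ⊔ h.edgeCut := by
  have hbz : b < z := by linarith [h.hbv, h.hvz]
  have hza : z < a := by linarith [h.hzq, h.hqa]
  have hbz' := h.le_commutant_left h.mem_b h.mem_z le_rfl hbz le_rfl
  have hza' : F z a ≤ h.left := h.le_left h.mem_z h.mem_a le_rfl hza le_rfl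
  have hEa : E a ≤ h.left := h.edge_le_left h.mem_a hza.le le_rfl
  have hEb : E b ≤ commutant h.left := h.edge_le_commutant_left h.mem_b le_rfl hbz.le
  have hEz : E z ≤ h.left := h.edge_le_left h.mem_z le_rfl hza.le
  have hEz' : E z ≤ commutant h.left := h.edge_le_commutant_left h.mem_z hbz.le le_rfl
  have hcbz : centre (F b z) = E b ⊔ E z := by
    obtain ⟨sys, _, _, _, _, _, _, mem_b, mem_v, mem_z, mem_q, mem_a, -⟩ := h
    exact sys.centre_eq
  have hcza : centre (F z a) = E z ⊔ E a := by
    obtain ⟨sys, _, _, _, _, _, _, mem_b, mem_v, mem_z, mem_q, mem_a, -⟩ := h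
    exact sys.centre_eq
  have hEzab : F a b ≤ commutant (E z) := by
    obtain ⟨sys, _, _, _, _, _, _, mem_b, mem_v, mem_z, mem_q, mem_a, -⟩ := h
    exact sys.edge_comm'
  have hab1 : F a b ≤ commutant (F b z) := by
    obtain ⟨sys, _, _, _, _, _, _, mem_b, mem_v, mem_z, mem_q, mem_a, -⟩ := h
    exact sys.disj
  have hab2 : F a b ≤ commutant (F z a) := by
    obtain ⟨sys, _, _, _, _, _, _, mem_b, mem_v, mem_z, mem_q, mem_a, -⟩ := h
    exact sys.disj
  rintro u ⟨hu, hu'⟩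
  rw [commutant_sup] at hu'
  obtain ⟨hu1, hu2⟩ := hu'
  -- Commuting with `h.fwd b` places `u` in the left side up to `E b`; next, commuting with `h.bwd
  -- a` places it in the commutant of that side up to `E a`.
  have hL : u ∈ h.left ⊔ E b := by
    have h1 : u ∈ F b z ⊔ h.left := by
      rw [← commutant_commutant hfac (F b z ⊔ h.left)]
      refine commutant_anti (h.commutant_sup_left_le hfac h.mem_b le_rfl hbz) ?_
      rw [commutant_sup]
      exact ⟨hu2, hEzab hu⟩
    have h2 := sup_inf_commutant_left_le hbz' ⟨h1, hab1 hu⟩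
    rw [hcbz] at h2
    exact (sup_le (sup_le le_sup_right (le_sup_of_le_left hEz)) le_sup_left :
      E b ⊔ E z ⊔ h.left ≤ h.left ⊔ E b) h2
  have hH : u ∈ commutant h.left ⊔ E a := by
    have h1 : u ∈ F z a ⊔ commutant h.left := by
      rw [← commutant_commutant hfac (F z a ⊔ commutant h.left)]
      refine commutant_anti (h.commutant_sup_commutant_left_le hfac h.mem_a hza le_rfl) ?_
      rw [commutant_sup]
      exact ⟨hu1, hEzab hu⟩
    have h2 := sup_inf_commutant_left_le (hza'.trans (le_commutant_commutant _)) ⟨h1, hab2 hu⟩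
    rw [hcza] at h2
    exact (sup_le (sup_le (le_sup_of_le_left hEz') le_sup_right) le_sup_left :
      E z ⊔ E a ⊔ commutant h.left ≤ commutant h.left ⊔ E a) h2
  -- `T` sits inside `commutant h.left`, commutes with `h.left` and `E b`, and has its commutant in
  -- `h.left ⊔ E b`. It therefore lets the modular law split `E a` off without losing the
  -- information in `hL`.
  set T := F b z ⊔ (commutant h.left ⊓ commutant (F b z)) with hT
  have hTle : T ≤ commutant h.left := sup_le hbz' inf_le_left
  have huT : u ∈ commutant T := by
    refine (sup_le (le_commutant_comm.1 hTle) ?_ : h.left ⊔ E b ≤ commutant T) hL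
    have hEb' : E b ≤ centre (F b z) := by rw [hcbz]; exact le_sup_left
    exact le_commutant_sup (hEb'.trans (centre_le_commutant _)) (le_commutant_comm.1
      (inf_le_right.trans (commutant_anti (hEb'.trans (centre_le _)))))
  have hT' : commutant T ≤ h.left ⊔ E b := by
    rw [hT, commutant_sup, commutant_inf hfac, commutant_commutant hfac, commutant_commutant hfac,
      inf_comm, sup_comm h.left]
    refine (sup_inf_commutant_left_le hbz').trans ?_
    rw [hcbz]
    exact sup_le (sup_le le_sup_right (le_sup_of_le_left hEz)) le_sup_left
  have h3 : u ∈ (commutant h.left ⊓ commutant T) ⊔ E a :=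
    sup_inf_commutant_le (commutant_anti hEa) hTle ⟨hH, huT⟩
  have h4 : commutant h.left ⊓ commutant T ≤ h.edgeCut ⊔ E z ⊔ E b := by
    refine (le_inf (inf_le_right.trans hT') inf_le_left).trans ?_
    refine (sup_inf_commutant_left_le (le_commutant_comm.1 hEb)).trans ?_
    rw [h.centre_left hfac]
  have h5 : u ∈ (E a ⊔ E b ⊔ h.edgeCut) ⊔ E z := by
    refine (sup_le (h4.trans (sup_le (sup_le ?_ ?_) ?_)) ?_ :
      (commutant h.left ⊓ commutant T) ⊔ E a ≤ _) h3
    · exact le_sup_of_le_left le_sup_right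
    · exact le_sup_right
    · exact le_sup_of_le_left (le_sup_of_le_left le_sup_right)
    · exact le_sup_of_le_left (le_sup_of_le_left le_sup_left)
  have hz := h.edge_abelian h.mem_z
  have hun := h.uncorrelated
  have hc := h.edgeCut_le
  obtain ⟨sys, _, _, _, _, _, _, mem_b, mem_v, mem_z, mem_q, mem_a, -⟩ := id h
  -- The distant `E z` was only auxiliary: it is uncorrelated with `F a b`, where `u` lives.
  exact inf_sup_le_of_supportsIn (D := ⊥) (sup_le (sup_le sys.edge sys.edge) hc) hz sys.edge_comm'
    bot_le (bot_le_commutant _) (supportsIn_bot_of_uncorrelated hun) ⟨hu, h5⟩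

end CutData

/-! ### The arc system with the new cut inserted. -/

set_option linter.unusedSectionVars false

namespace CutData

variable {Ω : Type*} [CStarAlgebra Ω] [FiniteDimensional ℂ Ω] {M : ℕ} {X : Set (ZMod M)}
  {F : ZMod M → ZMod M → StarSubalgebra ℂ Ω} {E : ZMod M → StarSubalgebra ℂ Ω}
  {Q : StarSubalgebra ℂ Ω} {c b v z q a : ℤ}

open scoped Classical in
/-- The algebra of the arc from the cut to a point. -/
noncomputable def arcFrom (h : CutData X F E Q c b v z q a) (x : ZMod M) : StarSubalgebra ℂ Ω :=
  if ∃ i : ℤ, b ≤ i ∧ i ≤ z ∧ x = i then F a x ⊓ commutant Q else commutant (F x b ⊓ h.left)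

theorem arcFrom_eq_fwd (h : CutData X F E Q c b v z q a) {x : ℤ} (hbx : b ≤ x) (hxz : x ≤ z) :
    h.arcFrom x = h.fwd x :=
  if_pos ⟨x, hbx, hxz, rfl⟩

theorem arcFrom_eq_bwd (h : CutData X F E Q c b v z q a) {x : ℤ} (hzx : z < x) (hxa : x ≤ a) :
    h.arcFrom x = commutant (h.bwd x) := by
  refine if_neg ?_
  rintro ⟨i, h1, h2, h3⟩
  have := h.hcb
  have := h.hac
  exact intCast_zmod_ne (by omega) (by omega) (by omega) h3

theorem arcFrom_mono (h : CutData X F E Q c b v z q a) {x y : ℤ} (hx : (x : ZMod M) ∈ X) (hy : (y : ZMod M) ∈ X)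
    (hbx : b ≤ x) (hxy : x ≤ y) (hya : y ≤ a) : h.arcFrom x ≤ h.arcFrom y := by
  rcases eq_or_lt_of_le hxy with rfl | hxy
  · exact le_rfl
  rcases le_or_gt y z with hyz | hyz
  · rw [h.arcFrom_eq_fwd hbx (by omega), h.arcFrom_eq_fwd (by omega) hyz]
    refine inf_le_inf_right _ ?_
    obtain ⟨sys, _, _, _, _, _, _, mem_b, mem_v, mem_z, mem_q, mem_a, -⟩ := h
    exact sys.sub
  rcases le_or_gt x z with hxz | hxz
  · rw [h.arcFrom_eq_fwd hbx hxz, h.arcFrom_eq_bwd hyz hya]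
    exact (h.fwd_le hx hbx hxz).trans (commutant_anti inf_le_right)
  · rw [h.arcFrom_eq_bwd hyz hya, h.arcFrom_eq_bwd hxz (by omega)]
    refine commutant_anti (inf_le_inf_right _ ?_)
    obtain ⟨sys, _, _, _, _, _, _, mem_b, mem_v, mem_z, mem_q, mem_a, -⟩ := h
    exact sys.sub

theorem arcFrom_le (h : CutData X F E Q c b v z q a) [Nontrivial Ω]
    (hfac : Subalgebra.center ℂ Ω = ⊥) {x y : ℤ} (hx : (x : ZMod M) ∈ X) (hy : (y : ZMod M) ∈ X)
    (hbx : b ≤ x) (hxy : x < y) (hya : y ≤ a) : h.arcFrom x ≤ F y x := by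
  rcases le_or_gt x z with hxz | hxz
  · rw [h.arcFrom_eq_fwd hbx hxz]
    refine inf_le_left.trans ?_
    obtain ⟨sys, _, _, _, _, _, _, mem_b, mem_v, mem_z, mem_q, mem_a, -⟩ := h
    exact sys.sub
  · rw [h.arcFrom_eq_bwd hxz (by omega)]
    apply commutant_le_comm hfac
    have h1 := h.le_left hx hy hxz.le hxy hya
    have h2 : commutant (F y x) = F x y := by
      obtain ⟨sys, _, _, _, _, _, _, mem_b, mem_v, mem_z, mem_q, mem_a, -⟩ := h
      exact sys.commutant_eq
    rw [h2]
    refine le_inf ?_ h1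
    obtain ⟨sys, _, _, _, _, _, _, mem_b, mem_v, mem_z, mem_q, mem_a, -⟩ := h
    exact sys.sub

/-- This and `arcFrom_le` are the two comparisons of new arcs with old ones that give monotonicity
when the new cut is one of three points. -/
theorem le_arcFrom (h : CutData X F E Q c b v z q a) {x y : ℤ} (hx : (x : ZMod M) ∈ X) (hy : (y : ZMod M) ∈ X)
    (hby : b ≤ y) (hyx : y < x) (hxa : x ≤ a) : F y x ≤ h.arcFrom x := by
  rcases le_or_gt x z with hxz | hxz
  · rw [h.arcFrom_eq_fwd (by omega) hxz]
    refine le_inf ?_ (h.Q_comm hy hx hby hyx (by linarith [h.hzq]))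
    obtain ⟨sys, _, _, _, _, _, _, mem_b, mem_v, mem_z, mem_q, mem_a, -⟩ := h
    exact sys.sub
  · rw [h.arcFrom_eq_bwd hxz hxa]
    refine le_trans ?_ (commutant_anti inf_le_left)
    obtain ⟨sys, _, _, _, _, _, _, mem_b, mem_v, mem_z, mem_q, mem_a, -⟩ := h
    exact sys.disj

theorem centre_arcFrom (h : CutData X F E Q c b v z q a) [Nontrivial Ω]
    (hfac : Subalgebra.center ℂ Ω = ⊥) {x : ℤ} (hx : (x : ZMod M) ∈ X) (hbx : b ≤ x)
    (hxa : x ≤ a) : centre (h.arcFrom x) = h.edgeCut ⊔ E x := by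
  rcases le_or_gt x z with hxz | hxz
  · rw [h.arcFrom_eq_fwd hbx hxz, h.centre_fwd hfac hx hbx hxz]
  · rw [h.arcFrom_eq_bwd hxz hxa, centre_commutant hfac, h.centre_bwd hfac hx hxz hxa]

/-- The four arcs `[a, b)`, `[b, x)`, `[x, y)`, `[y, a)`: the commutant of the last three. -/
theorem mem_sup_of_commutes (h : CutData X F E Q c b v z q a) [Nontrivial Ω]
    (hfac : Subalgebra.center ℂ Ω = ⊥) {x y : ℤ} (hx : (x : ZMod M) ∈ X) (hy : (y : ZMod M) ∈ X)
    (hbx : b ≤ x) (hxy : x < y) (hya : y ≤ a) {u : Ω} (h1 : b < x → u ∈ commutant (F b x))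
    (h2 : u ∈ commutant (F x y)) (h3 : y < a → u ∈ commutant (F y a)) :
    u ∈ F a b ⊔ (E x ⊔ E y) := by
  obtain ⟨sys, _, _, _, _, _, _, mem_b, mem_v, mem_z, mem_q, mem_a, -⟩ := h
  rcases eq_or_lt_of_le hbx with rfl | hbx
  · rcases eq_or_lt_of_le hya with rfl | hya
    · rw [sys.commutant_eq (x := b) (y := y)] at h2
      exact StarSubalgebra.mem_sup_left h2
    · have h4 : u ∈ commutant (F b y ⊔ F y a) := by rw [commutant_sup]; exact ⟨h2, h3 hya⟩
      exact ((sys.bip hfac).trans (sup_le_sup_left le_sup_right _) :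
        commutant (F b y ⊔ F y a) ≤ _) h4
  · rcases eq_or_lt_of_le hya with rfl | hya
    · have h4 : u ∈ commutant (F b x ⊔ F x y) := by rw [commutant_sup]; exact ⟨h1 hbx, h2⟩
      exact ((sys.bip hfac).trans (sup_le_sup_left le_sup_left _) :
        commutant (F b x ⊔ F x y) ≤ _) h4
    · have h4 : u ∈ commutant (F b x ⊔ F x y) := by rw [commutant_sup]; exact ⟨h1 hbx, h2⟩
      have h5 : u ∈ (F y b ⊓ commutant (F y a)) ⊔ E x :=
        sup_inf_commutant_le sys.edge_comm' sys.sub ⟨(sys.bip hfac : commutant (F b x ⊔ F x y) ≤ _) h4, h3 hya⟩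
      have h6 : F y b ⊓ commutant (F y a) ≤ F a b ⊔ E y := by
        rw [← sys.commutant_eq (x := b) (y := y), ← commutant_sup]
        exact sys.bip hfac
      refine (sup_le (h6.trans ?_) ?_ : (F y b ⊓ commutant (F y a)) ⊔ E x ≤ _) h5
      · exact sup_le_sup_left le_sup_right _
      · exact le_sup_of_le_right le_sup_left

/-- Commuting with the old arcs puts `u` in `F a b` up to `E x` and `E y`, and commuting with both
pieces leaves only edge algebras by `inf_commutant_pieces_le`. The unwanted `E b` is absorbed in
`h.arcFrom x` and goes when that is reduced to its centre; `E a` goes in the same way with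
`commutant (h.arcFrom y)`. -/
theorem star_arcFrom (h : CutData X F E Q c b v z q a) [Nontrivial Ω]
    (hfac : Subalgebra.center ℂ Ω = ⊥) {x y : ℤ} (hx : (x : ZMod M) ∈ X) (hy : (y : ZMod M) ∈ X)
    (hbx : b ≤ x) (hxy : x < y) (hya : y ≤ a) :
    commutant (h.arcFrom x ⊔ F x y ⊔ commutant (h.arcFrom y)) ≤ h.edgeCut ⊔ E x ⊔ E y := by
  have hbz : b < z := by linarith [h.hbv, h.hvz]
  have hza : z < a := by linarith [h.hzq, h.hqa]
  intro u hu
  rw [commutant_sup, commutant_sup, commutant_commutant hfac] at hu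
  obtain ⟨⟨hu1, hu2⟩, hu3⟩ := hu
  have h1 : u ∈ F a b ⊔ (E x ⊔ E y) := by
    refine h.mem_sup_of_commutes hfac hx hy hbx hxy hya (fun hlt => ?_) hu2 (fun hlt => ?_)
    · exact commutant_anti (h.le_arcFrom hx h.mem_b le_rfl hlt (by omega)) hu1
    · have h2 := h.arcFrom_le hfac hy h.mem_a (by omega) hlt le_rfl
      have h3 : commutant (F y a) = F a y := by
        obtain ⟨sys, _, _, _, _, _, _, mem_b, mem_v, mem_z, mem_q, mem_a, -⟩ := h
        exact sys.commutant_eq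
      rw [h3]
      exact h2 hu3
  have hba : h.bwd a = commutant (h.arcFrom a) := by
    rw [h.arcFrom_eq_bwd hza le_rfl, commutant_commutant hfac]
  have hfb : h.fwd b = h.arcFrom b := (h.arcFrom_eq_fwd le_rfl hbz.le).symm
  have hxa := h.arcFrom_mono hx h.mem_a hbx (by omega) le_rfl
  have hya' := h.arcFrom_mono hy h.mem_a (by omega) hya le_rfl
  have hxy' := h.arcFrom_mono hx hy hbx hxy.le hya
  have hbx' := h.arcFrom_mono h.mem_b hx le_rfl hbx (by omega)
  have hby' := hbx'.trans hxy'
  have hcx := h.centre_arcFrom hfac hx hbx (by omega)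
  have hcy := h.centre_arcFrom hfac hy (by omega) hya
  have hcb := h.centre_arcFrom hfac h.mem_b le_rfl (by omega)
  have hca := h.centre_arcFrom hfac h.mem_a (by omega) le_rfl
  have hEx : E x ≤ centre (h.arcFrom x) := by rw [hcx]; exact le_sup_right
  have hEy : E y ≤ centre (h.arcFrom y) := by rw [hcy]; exact le_sup_right
  have hEb : E b ≤ centre (h.arcFrom b) := by rw [hcb]; exact le_sup_right
  have hEa : E a ≤ centre (h.arcFrom a) := by rw [hca]; exact le_sup_right
  have hcx' : h.edgeCut ≤ centre (h.arcFrom x) := by rw [hcx]; exact le_sup_left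
  have hcy' : h.edgeCut ≤ centre (h.arcFrom y) := by rw [hcy]; exact le_sup_left
  have h2 : u ∈ (F a b ⊓ commutant (h.bwd a ⊔ h.fwd b)) ⊔ (E x ⊔ E y) := by
    have hT : h.bwd a ⊔ h.fwd b ≤ F a b := sup_le inf_le_left inf_le_left
    refine sup_inf_commutant_le ?_ hT ⟨h1, ?_⟩
    · obtain ⟨sys, _, _, _, _, _, _, mem_b, mem_v, mem_z, mem_q, mem_a, -⟩ := h
      exact le_commutant_sup sys.edge_comm' sys.edge_comm'
    · rw [commutant_sup, hba, hfb, commutant_commutant hfac]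
      exact ⟨hya' hu3, commutant_anti hbx' hu1⟩
  have h3 : u ∈ h.arcFrom x ⊔ (E a ⊔ (h.edgeCut ⊔ E x ⊔ E y)) := by
    refine (sup_le ((h.inf_commutant_pieces_le hfac).trans (sup_le (sup_le ?_ ?_) ?_))
      (sup_le ?_ ?_) : (F a b ⊓ commutant (h.bwd a ⊔ h.fwd b)) ⊔ (E x ⊔ E y) ≤ _) h2
    · exact le_sup_of_le_right le_sup_left
    · exact le_sup_of_le_left ((hEb.trans (centre_le _)).trans hbx')
    · exact le_sup_of_le_left (hcx'.trans (centre_le _))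
    · exact le_sup_of_le_left (hEx.trans (centre_le _))
    · exact le_sup_of_le_right (le_sup_of_le_right le_sup_right)
  have h4 : u ∈ E a ⊔ (h.edgeCut ⊔ E x ⊔ E y) := by
    have h5 := sup_inf_commutant_left_le (le_commutant_comm.1 ?_) ⟨h3, hu1⟩
    · rw [hcx] at h5
      refine (sup_le (sup_le ?_ ?_) le_rfl : h.edgeCut ⊔ E x ⊔ (E a ⊔ (h.edgeCut ⊔ E x ⊔ E y)) ≤
        E a ⊔ (h.edgeCut ⊔ E x ⊔ E y)) h5
      · exact le_sup_of_le_right (le_sup_of_le_left le_sup_left)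
      · exact le_sup_of_le_right (le_sup_of_le_left le_sup_right)
    · refine sup_le ((hEa.trans (centre_le_commutant _)).trans (commutant_anti hxa))
        (sup_le (sup_le (hcx'.trans (centre_le_commutant _)) (hEx.trans (centre_le_commutant _)))
        ((hEy.trans (centre_le_commutant _)).trans (commutant_anti hxy')))
  have hEay : E a ≤ commutant (h.arcFrom y) :=
    (hEa.trans (centre_le_commutant _)).trans (commutant_anti hya')
  have hP : h.edgeCut ⊔ E x ⊔ E y ≤ h.arcFrom y :=
    sup_le (sup_le (hcy'.trans (centre_le _)) ((hEx.trans (centre_le _)).trans hxy'))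
      (hEy.trans (centre_le _))
  have h5 := sup_inf_commutant_left_le (commutant_anti hP)
    ⟨sup_le_sup_right hEay _ h4, le_commutant_commutant _ hu3⟩
  rw [centre_commutant hfac, hcy] at h5
  refine (sup_le (sup_le ?_ ?_) le_rfl : h.edgeCut ⊔ E y ⊔ (h.edgeCut ⊔ E x ⊔ E y) ≤ _) h5
  · exact le_sup_of_le_left le_sup_left
  · exact le_sup_right

open scoped Classical in
/-- The arc system extended by the cut. -/
noncomputable def arc (h : CutData X F E Q c b v z q a) (x y : ZMod M) : StarSubalgebra ℂ Ω :=
  if x = c then h.arcFrom y else if y = c then commutant (h.arcFrom x) else F x y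

open scoped Classical in
/-- The algebras of the cuts of the extended system. -/
noncomputable def edge (h : CutData X F E Q c b v z q a) (x : ZMod M) : StarSubalgebra ℂ Ω :=
  if x = c then h.edgeCut else E x

theorem notMem (h : CutData X F E Q c b v z q a) : (c : ZMod M) ∉ X := by
  intro hc
  obtain ⟨i, h1, h2, h3⟩ := h.window _ hc
  have := h.hcb
  have := h.hac
  exact intCast_zmod_ne (by omega) (by omega) (by omega) h3

theorem ne_of_mem (h : CutData X F E Q c b v z q a) {x : ZMod M} (hx : x ∈ X) : x ≠ c :=
  fun he => h.notMem (he ▸ hx)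

theorem arc_of_mem (h : CutData X F E Q c b v z q a) {x y : ZMod M} (hx : x ∈ X) (hy : y ∈ X) :
    h.arc x y = F x y := by
  rw [arc, if_neg (h.ne_of_mem hx), if_neg (h.ne_of_mem hy)]

theorem edge_of_mem (h : CutData X F E Q c b v z q a) {x : ZMod M} (hx : x ∈ X) :
    h.edge x = E x := if_neg (h.ne_of_mem hx)

theorem edge_self (h : CutData X F E Q c b v z q a) : h.edge c = h.edgeCut := if_pos rfl

theorem arc_left (h : CutData X F E Q c b v z q a) (y : ZMod M) : h.arc c y = h.arcFrom y :=
  if_pos rfl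

theorem arc_right (h : CutData X F E Q c b v z q a) {x : ZMod M} (hx : x ∈ X) :
    h.arc x c = commutant (h.arcFrom x) := by
  rw [arc, if_neg (h.ne_of_mem hx), if_pos rfl]

theorem exists_window (h : CutData X F E Q c b v z q a) {x y : ZMod M} (hx : x ∈ X) (hy : y ∈ X)
    (hc : Cyc (c : ZMod M) x y) :
    ∃ i j : ℤ, b ≤ i ∧ i < j ∧ j ≤ a ∧ x = i ∧ y = j := by
  obtain ⟨i, j, h1, h2, h3, rfl, rfl⟩ := hc.exists_window
  obtain ⟨i', h4, h5, h6⟩ := h.window _ hx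
  obtain ⟨j', h7, h8, h9⟩ := h.window _ hy
  have hcb := h.hcb
  have hac := h.hac
  have hi : i = i' := by
    by_contra hne
    exact intCast_zmod_ne hne (by omega) (by omega) h6
  have hj : j = j' := by
    by_contra hne
    exact intCast_zmod_ne hne (by omega) (by omega) h9
  exact ⟨i, j, by omega, by omega, by omega, rfl, rfl⟩

theorem arcSystem (h : CutData X F E Q c b v z q a) [Nontrivial Ω]
    (hfac : Subalgebra.center ℂ Ω = ⊥) : ArcSystem (insert (c : ZMod M) X) h.arc h.edge := by
  have hstar : ∀ x ∈ X, ∀ y ∈ X, Cyc (c : ZMod M) x y →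
      commutant (h.arc c x ⊔ h.arc x y ⊔ h.arc y c) ≤ h.edge c ⊔ h.edge x ⊔ h.edge y := by
    intro x hx y hy hc
    rw [h.arc_left, h.arc_right hy, h.arc_of_mem hx hy, h.edge_self, h.edge_of_mem hx,
      h.edge_of_mem hy]
    obtain ⟨i, j, h1, h2, h3, rfl, rfl⟩ := h.exists_window hx hy hc
    exact h.star_arcFrom hfac hx hy h1 h2 h3
  refine ⟨?_, ?_, ?_, ?_⟩
  · rintro x (rfl | hx) y (rfl | hy) hxy
    · exact absurd rfl hxy
    · rw [h.arc_left, h.arc_right hy]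
    · rw [h.arc_left, h.arc_right hx, commutant_commutant hfac]
    · rw [h.arc_of_mem hx hy, h.arc_of_mem hy hx, h.sys.dual _ hx _ hy hxy]
  · rintro x (rfl | hx) y (rfl | hy) t (rfl | ht) hc
    · exact absurd rfl hc.ne
    · exact absurd rfl hc.ne
    · exact absurd rfl hc.rotate.rotate.ne
    · obtain ⟨i, j, h1, h2, h3, rfl, rfl⟩ := h.exists_window hy ht hc
      rw [h.arc_left, h.arc_left]
      exact h.arcFrom_mono hy ht h1 h2.le h3
    · exact absurd rfl hc.rotate.ne
    · obtain ⟨i, j, h1, h2, h3, rfl, rfl⟩ := h.exists_window ht hx hc.rotate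
      rw [h.arc_right hx, h.arc_of_mem hx ht]
      have h4 := h.le_arcFrom hx ht h1 h2 h3
      have h5 := commutant_anti h4
      rwa [h.sys.dual _ ht _ hx hc.rotate.rotate.ne] at h5
    · obtain ⟨i, j, h1, h2, h3, rfl, rfl⟩ := h.exists_window hx hy hc.rotate.rotate
      rw [h.arc_right hx, h.arc_of_mem hx hy]
      have h5 := commutant_anti (h.arcFrom_le hfac hx hy h1 h2 h3)
      rwa [h.sys.dual _ hy _ hx hc.ne.symm] at h5
    · rw [h.arc_of_mem hx hy, h.arc_of_mem hx ht]
      exact h.sys.mono _ hx _ hy _ ht hc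
  · have h1 : ∀ y ∈ X, centre (h.arcFrom y) = h.edgeCut ⊔ E y := by
      intro y hy
      obtain ⟨i, h1, h2, rfl⟩ := h.window _ hy
      exact h.centre_arcFrom hfac hy h1 h2
    rintro x (rfl | hx) y (rfl | hy) hxy
    · exact absurd rfl hxy
    · rw [h.arc_left, h.edge_self, h.edge_of_mem hy, h1 _ hy]
    · rw [h.arc_right hx, h.edge_self, h.edge_of_mem hx, centre_commutant hfac, h1 _ hx, sup_comm]
    · rw [h.arc_of_mem hx hy, h.edge_of_mem hx, h.edge_of_mem hy, h.sys.cen _ hx _ hy hxy]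
  · rintro x (rfl | hx) y (rfl | hy) t (rfl | ht) hc
    · exact absurd rfl hc.ne
    · exact absurd rfl hc.ne
    · exact absurd rfl hc.rotate.rotate.ne
    · exact hstar _ hy _ ht hc
    · exact absurd rfl hc.rotate.ne
    · have h1 := hstar _ ht _ hx hc.rotate
      rw [show h.arc x c ⊔ h.arc c t ⊔ h.arc t x = h.arc c t ⊔ h.arc t x ⊔ h.arc x c by ac_rfl,
        show h.edge x ⊔ h.edge c ⊔ h.edge t = h.edge c ⊔ h.edge t ⊔ h.edge x by ac_rfl]
      exact h1
    · have h1 := hstar _ hx _ hy hc.rotate.rotate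
      rw [show h.arc x y ⊔ h.arc y c ⊔ h.arc c x = h.arc c x ⊔ h.arc x y ⊔ h.arc y c by ac_rfl,
        show h.edge x ⊔ h.edge y ⊔ h.edge c = h.edge c ⊔ h.edge x ⊔ h.edge y by ac_rfl]
      exact h1
    · rw [h.arc_of_mem hx hy, h.arc_of_mem hy ht, h.arc_of_mem ht hx, h.edge_of_mem hx,
        h.edge_of_mem hy, h.edge_of_mem ht]
      exact h.sys.star _ hx _ hy _ ht hc

/-- Together with `bwd_le_arc`, this is how `Q` enters the hull bounds of `Refinement`. -/
theorem fwd_le_arc (h : CutData X F E Q c b v z q a) {x : ℤ} (hbx : b ≤ x) (hxz : x ≤ z) :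
    F a x ⊓ commutant Q ≤ h.arc c x := by
  rw [h.arc_left, h.arcFrom_eq_fwd hbx hxz]
  exact le_rfl

theorem bwd_le_arc (h : CutData X F E Q c b v z q a) [Nontrivial Ω]
    (hfac : Subalgebra.center ℂ Ω = ⊥) {x : ℤ} (hx : (x : ZMod M) ∈ X) (hzx : z ≤ x)
    (hxa : x ≤ a) : F x b ⊓ (F z a ⊔ Q) ≤ h.arc x c := by
  rw [h.arc_right hx]
  rcases eq_or_lt_of_le hzx with rfl | hzx
  · rw [h.arcFrom_eq_fwd (by linarith [h.hbv, h.hvz]) le_rfl, h.fwd_self, commutant_commutant hfac]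
    exact inf_le_right
  · rw [h.arcFrom_eq_bwd hzx hxa, commutant_commutant hfac]
    exact le_rfl

end CutData

set_option linter.unusedSectionVars false

/-! ### From arcs to arbitrary sets of sites. -/

section SetAlgebras

variable {Ω : Type*} [CStarAlgebra Ω] {M : ℕ}

open scoped Classical in
/-- The algebra of a set of sites, where the site `j` lies between the cuts `j` and `j + 1`: it is
generated by the algebras of the arcs contained in the set. -/
noncomputable def setAlg (F : ZMod M → ZMod M → StarSubalgebra ℂ Ω) (S : Set (ZMod M)) :
    StarSubalgebra ℂ Ω :=
  -- The whole circle needs its own value, because an arc always leaves out at least one site.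
  if S = Set.univ then ⊤ else
    ⨆ p : {p : ℤ × ℤ // p.1 < p.2 ∧ p.2 < p.1 + M ∧ ∀ i : ℤ, p.1 ≤ i → i < p.2 → (i : ZMod M) ∈ S},
      F p.1.1 p.1.2

theorem setAlg_univ (F : ZMod M → ZMod M → StarSubalgebra ℂ Ω) : setAlg F Set.univ = ⊤ :=
  if_pos rfl

theorem le_setAlg (F : ZMod M → ZMod M → StarSubalgebra ℂ Ω) {S : Set (ZMod M)} {x y : ℤ}
    (h1 : x < y) (h2 : y < x + M) (h3 : ∀ i : ℤ, x ≤ i → i < y → (i : ZMod M) ∈ S) :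
    F x y ≤ setAlg F S := by
  unfold setAlg
  split_ifs with h
  · exact le_top
  · exact le_iSup (fun p : {p : ℤ × ℤ // p.1 < p.2 ∧ p.2 < p.1 + M ∧
      ∀ i : ℤ, p.1 ≤ i → i < p.2 → (i : ZMod M) ∈ S} => F p.1.1 p.1.2) ⟨(x, y), h1, h2, h3⟩

theorem setAlg_le {F : ZMod M → ZMod M → StarSubalgebra ℂ Ω} {S : Set (ZMod M)}
    (hS : S ≠ Set.univ) {T : StarSubalgebra ℂ Ω} (h : ∀ x y : ℤ, x < y → y < x + M →
      (∀ i : ℤ, x ≤ i → i < y → (i : ZMod M) ∈ S) → F x y ≤ T) : setAlg F S ≤ T := by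
  unfold setAlg
  rw [if_neg hS]
  exact iSup_le fun p => h _ _ p.2.1 p.2.2.1 p.2.2.2

theorem setAlg_mono (F : ZMod M → ZMod M → StarSubalgebra ℂ Ω) {S T : Set (ZMod M)} (h : S ⊆ T) :
    setAlg F S ≤ setAlg F T := by
  by_cases hS : S = Set.univ
  · rw [hS, Set.univ_subset_iff] at h
    rw [hS, h]
  · exact setAlg_le hS fun x y h1 h2 h3 => le_setAlg F h1 h2 fun i hi hi' => h (h3 i hi hi')

theorem setAlg_empty [NeZero M] (F : ZMod M → ZMod M → StarSubalgebra ℂ Ω) : setAlg F ∅ = ⊥ := by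
  refine le_antisymm (setAlg_le Set.empty_ne_univ fun x y h1 _ h3 => ?_) bot_le
  exact absurd (h3 x le_rfl h1) (Set.notMem_empty _)

/-- The cuts at the boundary of a set of sites. -/
def cutBoundary (S : Set (ZMod M)) : Set (ZMod M) := {x | ¬ (x - 1 ∈ S ↔ x ∈ S)}

theorem cutBoundary_compl (S : Set (ZMod M)) : cutBoundary Sᶜ = cutBoundary S := by
  ext x
  simp only [cutBoundary, Set.mem_ofPred_eq, Set.mem_compl_iff]
  tauto

theorem cutBoundary_union_subset (S T : Set (ZMod M)) :
    cutBoundary (S ∪ T) ⊆ cutBoundary S ∪ cutBoundary T := by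
  intro x
  simp only [cutBoundary, Set.mem_ofPred_eq, Set.mem_union]
  tauto

/-- The maximal arc around an interior cut. -/
theorem exists_maximal_arc [NeZero M] {S : Set (ZMod M)} (hS : S ≠ Set.univ) {y : ℤ}
    (h1 : (y : ZMod M) ∈ S) (h2 : (y : ZMod M) - 1 ∈ S) :
    ∃ x₁ x₂ : ℤ, x₁ < y ∧ y < x₂ ∧ x₂ < x₁ + M ∧
      (∀ i : ℤ, x₁ ≤ i → i < x₂ → (i : ZMod M) ∈ S) ∧
      (x₁ : ZMod M) ∈ cutBoundary S ∧ (x₂ : ZMod M) ∈ cutBoundary S := by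
  obtain ⟨s, hs⟩ := (Set.ne_univ_iff_exists_notMem S).1 hS
  obtain ⟨s, h3, h4, rfl⟩ := exists_intCast_zmod (y - M) s
  obtain ⟨g, ⟨hg1, hg2⟩, hg3⟩ := Int.exists_greatest_of_bdd (P := fun i => i < y ∧ (i : ZMod M) ∉ S)
    ⟨y, fun i hi => hi.1.le⟩ ⟨s, by omega, hs⟩
  obtain ⟨t, ⟨ht1, ht2⟩, ht3⟩ := Int.exists_least_of_bdd (P := fun i => y ≤ i ∧ (i : ZMod M) ∉ S)
    ⟨y, fun i hi => hi.1⟩ ⟨s + M, by omega, by simpa using hs⟩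
  have hgs := hg3 s ⟨by omega, hs⟩
  have hts := ht3 (s + M) ⟨by omega, by simpa using hs⟩
  have hgy : g ≠ y - 1 := fun h => hg2 (by rw [h]; simpa using h2)
  have hty : t ≠ y := fun h => ht2 (by rw [h]; exact h1)
  have hmem : ∀ i : ℤ, g + 1 ≤ i → i < t → (i : ZMod M) ∈ S := by
    intro i hi hi'
    by_contra hn
    rcases lt_or_ge i y with h | h
    · have := hg3 i ⟨h, hn⟩; omega
    · have := ht3 i ⟨h, hn⟩; omega
  refine ⟨g + 1, t, by omega, by omega, by omega, hmem, ?_, ?_⟩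
  · have h5 := hmem (g + 1) le_rfl (by omega)
    simp only [cutBoundary, Set.mem_ofPred_eq]
    intro h
    rw [← h] at h5
    exact hg2 (by simpa using h5)
  · have h5 := hmem (t - 1) (by omega) (by omega)
    simp only [cutBoundary, Set.mem_ofPred_eq]
    intro h
    exact ht2 (h.1 (by simpa using h5))

namespace ArcSystem

variable {F : ZMod M → ZMod M → StarSubalgebra ℂ Ω} {E : ZMod M → StarSubalgebra ℂ Ω}

theorem disj_of_le (h : ArcSystem Set.univ F E) {x x' y y' : ℤ} (h1 : x < x') (h2 : x' ≤ y)
    (h3 : y < y') (h4 : y' ≤ x + M) : F x x' ≤ commutant (F y y') := by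
  have m := fun i : ℤ => Set.mem_univ (i : ZMod M)
  rcases eq_or_lt_of_le h4 with rfl | h4
  · have := h.disj (m x) (m x') (m y) (m x) (by omega)
    simpa using this
  · exact h.disj (m x) (m x') (m y) (m y') (by omega)

theorem setAlg_le_commutant [NeZero M] (h : ArcSystem Set.univ F E) {S T : Set (ZMod M)}
    (hST : Disjoint S T) : setAlg F S ≤ commutant (setAlg F T) := by
  by_cases hS : S = Set.univ
  · have hT : T = ∅ := by rwa [hS, Set.univ_disjoint] at hST
    rw [hT, setAlg_empty]
    exact bot_le_commutant _
  by_cases hT : T = Set.univ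
  · have hS : S = ∅ := by rwa [hT, Set.disjoint_univ] at hST
    rw [hS, setAlg_empty]
    exact bot_le
  refine setAlg_le hS fun x x' h1 h2 h3 => ?_
  rw [le_commutant_comm]
  refine setAlg_le hT fun y y' h4 h5 h6 => ?_
  rw [le_commutant_comm]
  obtain ⟨i, hi1, hi2, hi3⟩ := exists_intCast_zmod x (y : ZMod M)
  obtain ⟨k, hk⟩ := (ZMod.intCast_eq_intCast_iff_dvd_sub _ _ _).1 hi3
  have hi4 : F y y' = F i (i + (y' - y) : ℤ) := by
    have : i + (y' - y) = y' + M * k := by omega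
    rw [hi3, this]
    simp
  rw [hi4]
  have hST' := Set.disjoint_left.1 hST
  refine h.disj_of_le h1 ?_ (by omega) ?_
  · by_contra hlt
    exact hST' (h3 i hi1 (by omega)) (by rw [← hi3]; exact h6 y le_rfl h4)
  · by_contra hlt
    refine hST' (h3 x le_rfl h1) ?_
    have := h6 (x - M * k + M) (by omega) (by omega)
    simpa using this

theorem edge_le_commutant_setAlg [NeZero M] (h : ArcSystem Set.univ F E) {S : Set (ZMod M)}
    {x : ZMod M} (hx : x ∉ S ∨ x - 1 ∉ S) : E x ≤ commutant (setAlg F S) := by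
  have hS : S ≠ Set.univ := by
    rintro rfl
    simp at hx
  rw [le_commutant_comm]
  refine setAlg_le hS fun y y' h4 h5 h6 => ?_
  rw [le_commutant_comm]
  obtain ⟨i, hi1, hi2, rfl⟩ := exists_intCast_zmod y x
  have m := fun i : ℤ => Set.mem_univ (i : ZMod M)
  refine h.edge_comm (m i) (m y) (m y') ?_
  have : i = y ∨ y' ≤ i := by
    by_contra! hc
    rcases hx with hx | hx
    · exact hx (h6 i (by omega) (by omega))
    · exact hx (by simpa using h6 (i - 1) (by omega) (by omega))
  omega

theorem edge_le_setAlg (h : ArcSystem Set.univ F E) (hM : 2 ≤ M) {S : Set (ZMod M)}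
    {x : ZMod M} (hx : x ∈ S ∨ x - 1 ∈ S) : E x ≤ setAlg F S := by
  have : NeZero M := ⟨by omega⟩
  obtain ⟨i, hi1, hi2, rfl⟩ := exists_intCast_zmod 0 x
  have m := fun i : ℤ => Set.mem_univ (i : ZMod M)
  rcases hx with hx | hx
  · refine (h.edge_left (m i) (m (i + 1)) (by omega)).trans (le_setAlg F (by omega) (by omega) ?_)
    intro j h1 h2
    rwa [show j = i by omega]
  · refine (h.edge_right (m (i - 1)) (m i) (by omega)).trans (le_setAlg F (by omega) (by omega) ?_)
    intro j h1 h2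
    rw [show j = i - 1 by omega]
    simpa using hx

variable [FiniteDimensional ℂ Ω] [Nontrivial Ω]

/-- Sweep round the circle: every further site with which `u` commutes shortens the remaining arc by
one site, at the price of the edge algebra of the cut crossed. -/
theorem mem_sup_of_commutes_sites (h : ArcSystem Set.univ F E) (hfac : Subalgebra.center ℂ Ω = ⊥)
    {u : Ω} (hu : ∀ i : ℤ, u ∈ commutant (F i (i + 1 : ℤ))) (k : ℕ) (hk : k + 1 < M) :
    u ∈ F (k + 1 : ℤ) (0 : ℤ) ⊔ ⨆ x, E x := by
  have m := fun i : ℤ => Set.mem_univ (i : ZMod M)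
  suffices hs : u ∈ F (k + 1 : ℤ) (0 : ℤ) ⊔
      ⨆ x ∈ {x : ZMod M | ∃ i : ℤ, 0 ≤ i ∧ i ≤ k ∧ x = i}, E x by
    refine SetLike.le_def.1 (sup_le_sup_left ?_ _) hs
    exact iSup₂_le fun x _ => le_iSup E x
  induction k with
  | zero =>
    have h1 := hu 0
    rw [h.commutant_eq (m 0) (m _) (by omega)] at h1
    exact StarSubalgebra.mem_sup_left (by simpa using h1)
  | succ k ih =>
    have h1 := ih (by omega)
    have h2 := hu (k + 1)
    have h3 := sup_inf_commutant_le ?_ ?_ ⟨h1, h2⟩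
    · refine SetLike.le_def.1 (sup_le ?_ ?_) h3
      · rw [← h.commutant_eq (x := 0) (y := (k + 1 : ℤ)) (m _) (m _) (by omega), ← commutant_sup]
        refine (h.bip hfac (m _) (m _) (m _) (by omega)).trans ?_
        push_cast
        refine sup_le_sup_left ?_ _
        refine le_iSup₂_of_le _ ⟨k + 1, by omega, by omega, rfl⟩ ?_
        simp
      · refine le_sup_of_le_right (iSup_mono fun x => iSup_mono' ?_)
        rintro ⟨i, h4, h5, h6⟩
        exact ⟨⟨i, h4, by push_cast; omega, h6⟩, le_rfl⟩
    · rw [le_commutant_comm]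
      refine iSup₂_le ?_
      rintro x ⟨i, h4, h5, rfl⟩
      exact h.edge_comm (m _) (m _) (m _) (by omega)
    · exact h.sub (m _) (m _) (m _) (m _) (by omega)

/-- After the sweep one site is left; commuting with it leaves only its centre, which consists of
edge algebras. -/
theorem mem_iSup_of_commutes_sites (h : ArcSystem Set.univ F E) (hfac : Subalgebra.center ℂ Ω = ⊥)
    (hM : 2 ≤ M) {u : Ω} (hu : ∀ i : ℤ, u ∈ commutant (F i (i + 1 : ℤ))) : u ∈ ⨆ x, E x := by
  have m := fun i : ℤ => Set.mem_univ (i : ZMod M)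
  obtain ⟨k, rfl⟩ : ∃ k, M = k + 2 := ⟨M - 2, by omega⟩
  have : NeZero (k + 2) := ⟨by omega⟩
  have h1 := h.mem_sup_of_commutes_sites hfac hu k (by omega)
  have h2 := hu (k + 1)
  have h3 : (((k : ℤ) + 1 + 1 : ℤ) : ZMod (k + 2)) = ((0 : ℤ) : ZMod (k + 2)) := by
    have := ZMod.natCast_self (k + 2)
    push_cast at this ⊢
    rw [← this]
    ring
  rw [h3] at h2
  have h4 := sup_inf_commutant_left_le ?_ ⟨h1, h2⟩
  · rw [h.centre_eq (m _) (m _) (by push_cast; omega)] at h4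
    exact (sup_le (sup_le (le_iSup _ _) (le_iSup _ _)) le_rfl : _ ≤ ⨆ x, E x) h4
  · rw [le_commutant_comm]
    refine iSup_le fun x => ?_
    obtain ⟨i, hi1, hi2, rfl⟩ := exists_intCast_zmod 0 x
    exact h.edge_comm (m _) (m _) (m _) (by omega)

/-- An element commuting with the algebras of sets which cover the circle is generated by the
algebras of the cuts at the boundaries of these sets. -/
theorem mem_iSup_boundary (h : ArcSystem Set.univ F E) (hfac : Subalgebra.center ℂ Ω = ⊥)
    (hM : 2 ≤ M) (𝒮 : Set (Set (ZMod M))) (hcov : ∀ j, ∃ S ∈ 𝒮, j ∈ S) {u : Ω}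
    (hu : ∀ S ∈ 𝒮, u ∈ commutant (setAlg F S)) :
    u ∈ ⨆ x ∈ {x | ∃ S ∈ 𝒮, x ∈ cutBoundary S}, E x := by
  classical
  have : NeZero M := ⟨by omega⟩
  by_cases huniv : Set.univ ∈ 𝒮
  · have h1 := hu _ huniv
    rw [setAlg_univ, mem_commutant] at h1
    have h2 : u ∈ Subalgebra.center ℂ Ω := Subalgebra.mem_center_iff.2 fun a => h1 a trivial
    rw [hfac] at h2
    obtain ⟨μ, rfl⟩ := Algebra.mem_bot.1 h2
    exact StarSubalgebra.algebraMap_mem _ μ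
  set B := {x | ∃ S ∈ 𝒮, x ∈ cutBoundary S} with hB
  have m := fun i : ℤ => Set.mem_univ (i : ZMod M)
  -- Cuts outside `B` are eliminated one at a time. Such a cut is interior to a maximal arc of a
  -- covering set; `u` commutes with that arc, so the edges inside it can be traded for those at its
  -- two ends, which belong to `B`.
  have key : ∀ Y : Finset (ZMod M), u ∈ ⨆ x ∈ (Y : Set (ZMod M)) ∪ B, E x → u ∈ ⨆ x ∈ B, E x := by
    intro Y
    induction Y using Finset.induction_on with
    | empty => intro h1; simpa using h1
    | insert y Y hy ih =>
      intro h1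
      by_cases hyB : y ∈ B
      · refine ih ?_
        rwa [Finset.coe_insert, Set.insert_union, Set.insert_eq_of_mem
          (show y ∈ (Y : Set (ZMod M)) ∪ B from Or.inr hyB)] at h1
      obtain ⟨S, hS, hyS⟩ := hcov y
      have hyS' : y - 1 ∈ S := by
        by_contra hn
        exact hyB ⟨S, hS, fun hi => hn (hi.2 hyS)⟩
      obtain ⟨i, -, -, rfl⟩ := exists_intCast_zmod 0 y
      obtain ⟨x₁, x₂, h2, h3, h4, h5, h6, h7⟩ := exists_maximal_arc
        (fun he => huniv (he ▸ hS)) hyS hyS'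
      refine ih ?_
      set P := ⨆ x ∈ {x | x ∈ (Y : Set (ZMod M)) ∪ B ∧
        ∀ i : ℤ, x₁ < i → i < x₂ → x ≠ i}, E x with hP
      have h8 : u ∈ F x₁ x₂ ⊔ P := by
        refine (iSup₂_le fun x hx => ?_ : _ ≤ F x₁ x₂ ⊔ P) h1
        by_cases hc : ∃ i : ℤ, x₁ < i ∧ i < x₂ ∧ x = i
        · obtain ⟨j, hj1, hj2, rfl⟩ := hc
          exact le_sup_of_le_left (h.edge (m _) (m _) (m _) (by omega))
        · push Not at hc
          refine le_sup_of_le_right (le_iSup₂_of_le x ⟨?_, hc⟩ le_rfl)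
          rw [Finset.coe_insert, Set.insert_union] at hx
          exact hx.resolve_left (hc i h2 h3)
      have h9 : F x₁ x₂ ≤ commutant P := by
        rw [le_commutant_comm]
        refine iSup₂_le ?_
        rintro x ⟨-, hx⟩
        obtain ⟨j, hj1, hj2, rfl⟩ := exists_intCast_zmod x₁ x
        have : j = x₁ ∨ x₂ ≤ j := by
          by_contra! hc
          exact hx j (by omega) (by omega) rfl
        exact h.edge_comm (m _) (m _) (m _) (by omega)
      have h10 : u ∈ commutant (F x₁ x₂) :=
        commutant_anti (le_setAlg F (by omega) (by omega) h5) (hu S hS)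
      have h11 := sup_inf_commutant_left_le h9 ⟨h8, h10⟩
      rw [h.centre_eq (m _) (m _) (by omega)] at h11
      refine (sup_le (sup_le ?_ ?_) ?_ : _ ≤ ⨆ x ∈ (Y : Set (ZMod M)) ∪ B, E x) h11
      · exact le_iSup₂_of_le _ (Or.inr ⟨S, hS, h6⟩) le_rfl
      · exact le_iSup₂_of_le _ (Or.inr ⟨S, hS, h7⟩) le_rfl
      · exact iSup₂_le fun x hx => le_iSup₂_of_le x hx.1 le_rfl
  refine key Finset.univ ?_
  refine (iSup_le fun x => le_iSup₂_of_le x (by simp) le_rfl : (⨆ x, E x) ≤ _)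
    (h.mem_iSup_of_commutes_sites hfac hM fun i => ?_)
  obtain ⟨S, hS, hi⟩ := hcov i
  refine commutant_anti (le_setAlg F (by omega) (by omega) ?_) (hu S hS)
  intro j h1 h2
  rwa [show j = i by omega]

theorem iSup_boundary_le (h : ArcSystem Set.univ F E) (hM : 2 ≤ M) (S : Set (ZMod M)) :
    ⨆ x ∈ cutBoundary S, E x ≤ setAlg F S := by
  refine iSup₂_le fun x hx => h.edge_le_setAlg hM ?_
  simp only [cutBoundary, Set.mem_ofPred_eq] at hx
  tauto

theorem iSup_boundary_le_commutant (h : ArcSystem Set.univ F E) (hM : 2 ≤ M) (S : Set (ZMod M)) :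
    ⨆ x ∈ cutBoundary S, E x ≤ commutant (setAlg F S) := by
  have : NeZero M := ⟨by omega⟩
  refine iSup₂_le fun x hx => h.edge_le_commutant_setAlg ?_
  simp only [cutBoundary, Set.mem_ofPred_eq] at hx
  tauto

/-- A central element commutes with the algebras of `S` and of its complement, which cover the
circle and have the same boundary. -/
theorem centre_setAlg (h : ArcSystem Set.univ F E) (hfac : Subalgebra.center ℂ Ω = ⊥)
    (hM : 2 ≤ M) (S : Set (ZMod M)) : centre (setAlg F S) = ⨆ x ∈ cutBoundary S, E x := by
  have : NeZero M := ⟨by omega⟩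
  refine le_antisymm (fun u hu => ?_) (le_inf (h.iSup_boundary_le hM S)
    (h.iSup_boundary_le_commutant hM S))
  have h1 := h.mem_iSup_boundary hfac hM {S, Sᶜ} (fun j => ?_) (u := u) ?_
  · refine (iSup₂_le ?_ : _ ≤ ⨆ x ∈ cutBoundary S, E x) h1
    rintro x ⟨T, (rfl | rfl), hT⟩
    · exact le_iSup₂_of_le x hT le_rfl
    · rw [cutBoundary_compl] at hT
      exact le_iSup₂_of_le x hT le_rfl
  · by_cases hj : j ∈ S
    · exact ⟨S, by simp, hj⟩
    · exact ⟨Sᶜ, by simp, hj⟩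
  · rintro T (rfl | rfl)
    · exact hu.2
    · exact h.setAlg_le_commutant disjoint_compl_right hu.1

/-- The sets `S`, `T` and the complement `U` of their union cover the circle, and a boundary cut of
`T` bounds `S` or `U`. The commutant of the three algebras thus lies in those of `S` and `U`;
dually, `u` lies in the algebra generated by all three. Commuting with `S` and `U` reduces these to
their centres, whose edges bound `T` or `S ∪ T`. -/
theorem inf_setAlg_le (h : ArcSystem Set.univ F E) (hfac : Subalgebra.center ℂ Ω = ⊥)
    (hM : 2 ≤ M) {S T : Set (ZMod M)} (hST : Disjoint S T) :
    commutant (setAlg F S) ⊓ setAlg F (S ∪ T) ≤ setAlg F T ⊔ centre (setAlg F (S ∪ T)) := by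
  have : NeZero M := ⟨by omega⟩
  rintro u ⟨hu1, hu2⟩
  set U := (S ∪ T)ᶜ with hU
  have hSU : Disjoint S U := Set.disjoint_left.2 fun x hx hx' => hx' (Or.inl hx)
  have hTU : Disjoint T U := Set.disjoint_left.2 fun x hx hx' => hx' (Or.inr hx)
  have hu3 : u ∈ commutant (setAlg F U) := h.setAlg_le_commutant disjoint_compl_right hu2
  have hbT : cutBoundary T ⊆ cutBoundary S ∪ cutBoundary U := by
    intro x
    have h1 := fun hx : x ∈ S => Set.disjoint_left.1 hST hx
    have h2 := fun hx : x - 1 ∈ S => Set.disjoint_left.1 hST hx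
    simp only [hU, cutBoundary, Set.mem_ofPred_eq, Set.mem_union, Set.mem_compl_iff]
    tauto
  have hbS : cutBoundary S ⊆ cutBoundary T ∪ cutBoundary U := by
    intro x
    have h1 := fun hx : x ∈ S => Set.disjoint_left.1 hST hx
    have h2 := fun hx : x - 1 ∈ S => Set.disjoint_left.1 hST hx
    simp only [hU, cutBoundary, Set.mem_ofPred_eq, Set.mem_union, Set.mem_compl_iff]
    tauto
  have h1 : commutant (setAlg F S ⊔ setAlg F U ⊔ setAlg F T) ≤ setAlg F S ⊔ setAlg F U := by
    intro y hy
    rw [commutant_sup, commutant_sup] at hy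
    have h2 := h.mem_iSup_boundary hfac hM {S, T, U} (fun j => ?_) (u := y) ?_
    · refine (iSup₂_le ?_ : _ ≤ setAlg F S ⊔ setAlg F U) h2
      have hS : ∀ x ∈ cutBoundary S, E x ≤ setAlg F S ⊔ setAlg F U := fun x hx =>
        le_sup_of_le_left ((le_iSup₂_of_le x hx le_rfl).trans (h.iSup_boundary_le hM S))
      have hU : ∀ x ∈ cutBoundary U, E x ≤ setAlg F S ⊔ setAlg F U := fun x hx =>
        le_sup_of_le_right ((le_iSup₂_of_le x hx le_rfl).trans (h.iSup_boundary_le hM U))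
      rintro x ⟨V, (rfl | rfl | rfl), hV⟩
      · exact hS x hV
      · exact (hbT hV).elim (hS x) (hU x)
      · exact hU x hV
    · by_cases hj : j ∈ S
      · exact ⟨S, by simp, hj⟩
      by_cases hj' : j ∈ T
      · exact ⟨T, by simp, hj'⟩
      · exact ⟨U, by simp, fun hc => hc.elim hj hj'⟩
    · rintro V (rfl | rfl | rfl)
      · exact hy.1.1
      · exact hy.2
      · exact hy.1.2
  have h2 : u ∈ setAlg F S ⊔ setAlg F U ⊔ setAlg F T := by
    apply commutant_le_comm hfac h1
    rw [commutant_sup]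
    exact ⟨hu1, hu3⟩
  have h3 := sup_inf_commutant_left_le (sup_le (h.setAlg_le_commutant hST)
    (h.setAlg_le_commutant hTU.symm)) ⟨h2, by rw [commutant_sup]; exact ⟨hu1, hu3⟩⟩
  refine (sup_le ((centre_sup_le (h.setAlg_le_commutant hSU)).trans ?_) le_sup_left :
    _ ≤ setAlg F T ⊔ centre (setAlg F (S ∪ T))) h3
  rw [h.centre_setAlg hfac hM, h.centre_setAlg hfac hM, h.centre_setAlg hfac hM,
    ← cutBoundary_compl (S ∪ T), ← hU]
  refine sup_le (iSup₂_le fun x hx => ?_) le_sup_right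
  rcases hbS hx with hx | hx
  · exact le_sup_of_le_left ((le_iSup₂_of_le x hx le_rfl).trans (h.iSup_boundary_le hM T))
  · exact le_sup_of_le_right (le_iSup₂_of_le x hx le_rfl)

theorem isBipartition_setAlg (h : ArcSystem Set.univ F E) (hfac : Subalgebra.center ℂ Ω = ⊥)
    (hM : 2 ≤ M) {S T : Set (ZMod M)} (hST : Disjoint S T) :
    IsBipartition (setAlg F S) (setAlg F T) (setAlg F (S ∪ T)) := by
  have : NeZero M := ⟨by omega⟩
  have hTle := setAlg_mono F (Set.subset_union_right : T ⊆ S ∪ T)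
  refine ⟨setAlg_mono F Set.subset_union_left, hTle, fun p hp => ?_, ?_⟩
  · have hc : centre (setAlg F (S ∪ T)) ≤ commutant (setAlg F T) :=
      (centre_le_commutant _).trans (commutant_anti hTle)
    have hp' := hp.isMinIdem ((centre_le_commutant _).trans (commutant_anti (centre_le _)))
    ext y
    constructor
    · rintro ⟨x, hx, rfl⟩
      obtain ⟨m, hm, h1⟩ := hp'.exists_mul_eq (le_commutant_comm.1 hc)
        (h.inf_setAlg_le hfac hM hST hx)
      exact ⟨m, hm, h1.symm⟩
    · rintro ⟨x, hx, rfl⟩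
      exact ⟨x, ⟨h.setAlg_le_commutant hST.symm hx, hTle hx⟩, rfl⟩
  · rw [h.centre_setAlg hfac hM, h.centre_setAlg hfac hM, h.centre_setAlg hfac hM]
    refine iSup₂_le fun x hx => ?_
    rcases cutBoundary_union_subset S T hx with hx | hx
    · exact le_sup_of_le_left (le_iSup₂_of_le x hx le_rfl)
    · exact le_sup_of_le_right (le_iSup₂_of_le x hx le_rfl)

/-- The algebras of sets of sites form a partition over any set onto which the sites are mapped. -/
theorem isPartition_setAlg (h : ArcSystem Set.univ F E) (hfac : Subalgebra.center ℂ Ω = ⊥)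
    (hM : 2 ≤ M) {P : Type*} {V : Set P} (f : ZMod M → P) (hf : ∀ j, f j ∈ V) :
    IsPartition V (fun S => setAlg F (f ⁻¹' S)) := by
  have : NeZero M := ⟨by omega⟩
  refine ⟨by simp [setAlg_empty], ?_, fun S T _ _ hST => ?_⟩
  · rw [show f ⁻¹' V = Set.univ from Set.eq_univ_of_forall hf, setAlg_univ]
  · exact h.isBipartition_setAlg hfac hM (hST.preimage f)

end ArcSystem

end SetAlgebras

/-! ### Integer coordinates for the vertices. -/

section Positions

variable {N : ℕ}

theorem intCast_pos_eq_iff {i j : ℤ} : (i : Pos N) = j ↔ ∃ t : ℤ, i = j + 4 * (N * t) := by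
  rw [ZMod.intCast_eq_intCast_iff_dvd_sub]
  constructor
  · rintro ⟨k, hk⟩
    refine ⟨-k, ?_⟩
    push_cast at hk
    linear_combination -hk
  · rintro ⟨t, rfl⟩
    refine ⟨-t, ?_⟩
    push_cast
    ring

/-- Any integer displacement may be used, not only the one of least absolute value; distances then
reduce to linear integer arithmetic. -/
theorem circleDist_le_iff [NeZero N] {x y : Pos N} {ρ : ℕ} :
    circleDist x y ≤ ρ ↔ ∃ t : ℤ, |t| ≤ ρ ∧ x = y + t := by
  have : NeZero (4 * N) := ⟨by have := NeZero.ne N; omega⟩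
  constructor
  · intro h
    refine ⟨(x - y).valMinAbs, ?_, ?_⟩
    · rw [Int.abs_eq_natAbs]
      exact_mod_cast h
    · rw [ZMod.coe_valMinAbs]; ring
  · rintro ⟨t, ht, rfl⟩
    unfold circleDist
    rw [add_sub_cancel_left]
    have h1 := ZMod.natAbs_min_of_le_div_two (4 * N) ((t : ZMod (4 * N)).valMinAbs) t (by simp)
      (ZMod.natAbs_valMinAbs_le _)
    rw [Int.abs_eq_natAbs] at ht
    exact h1.trans (by exact_mod_cast ht)

theorem intCast_mem_coarse [NeZero N] {b : ZMod 2} {i : ℤ} :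
    (i : Pos N) ∈ (CyclicGraph.coarse b).verts N ↔ i % 4 = 2 * b.val := by
  have : NeZero (4 * N) := ⟨by have := NeZero.ne N; omega⟩
  have h1 : (((i : ZMod (4 * N)).val : ℕ) : ℤ) = i % (4 * N : ℕ) := ZMod.val_intCast i
  have h2 : i % ((4 * N : ℕ) : ℤ) % 4 = i % 4 := Int.emod_emod_of_dvd _ ⟨N, by push_cast; ring⟩
  change (i : ZMod (4 * N)).val % 4 = 2 * b.val ↔ _
  omega

theorem intCast_mem_fine [NeZero N] {i : ℤ} :
    (i : Pos N) ∈ CyclicGraph.fine.verts N ↔ i % 2 = 1 := by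
  have : NeZero (4 * N) := ⟨by have := NeZero.ne N; omega⟩
  have h1 : (((i : ZMod (4 * N)).val : ℕ) : ℤ) = i % (4 * N : ℕ) := ZMod.val_intCast i
  have h2 : i % ((4 * N : ℕ) : ℤ) % 2 = i % 2 :=
    Int.emod_emod_of_dvd _ ⟨2 * N, by push_cast; ring⟩
  change (i : ZMod (4 * N)).val % 2 = 1 ↔ _
  omega

/-- The vertex with index `n` of a coarse graph, where `o` is the position of the vertex `0`. -/
def vtx (N : ℕ) (o n : ℤ) : Pos N := ((o + 4 * n : ℤ) : Pos N)

theorem vtx_eq_iff {o m n : ℤ} : vtx N o m = vtx N o n ↔ ∃ t : ℤ, m = n + N * t := by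
  rw [vtx, vtx, intCast_pos_eq_iff]
  refine exists_congr fun t => ?_
  constructor <;> intro h <;> linarith

theorem vtx_mem [NeZero N] {b : ZMod 2} {o : ℤ} (ho : o % 4 = 2 * b.val) (n : ℤ) :
    vtx N o n ∈ (CyclicGraph.coarse b).verts N := by
  rw [vtx, intCast_mem_coarse]
  omega

theorem exists_vtx [NeZero N] {b : ZMod 2} {o : ℤ} (ho : o % 4 = 2 * b.val) (n₀ : ℤ) {x : Pos N}
    (hx : x ∈ (CyclicGraph.coarse b).verts N) : ∃ n : ℤ, n₀ ≤ n ∧ n < n₀ + N ∧ x = vtx N o n := by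
  have : NeZero (4 * N) := ⟨by have := NeZero.ne N; omega⟩
  obtain ⟨i, h1, h2, rfl⟩ := exists_intCast_zmod (M := 4 * N) (o + 4 * n₀) x
  rw [intCast_mem_coarse] at hx
  push_cast at h2
  refine ⟨(i - o) / 4, by omega, by omega, ?_⟩
  rw [vtx]
  congr 1
  omega

/-- The vertices with index in a set of integers. -/
def vset (N : ℕ) (o : ℤ) (I : Set ℤ) : Set (Pos N) := vtx N o '' I

theorem vset_subset [NeZero N] {b : ZMod 2} {o : ℤ} (ho : o % 4 = 2 * b.val) (I : Set ℤ) :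
    vset N o I ⊆ (CyclicGraph.coarse b).verts N := by
  rintro _ ⟨n, -, rfl⟩
  exact vtx_mem ho n

theorem vset_Ico_full [NeZero N] {b : ZMod 2} {o : ℤ} (ho : o % 4 = 2 * b.val) (n : ℤ) :
    vset N o (Set.Ico n (n + N)) = (CyclicGraph.coarse b).verts N := by
  refine (vset_subset ho _).antisymm fun x hx => ?_
  obtain ⟨k, h1, h2, rfl⟩ := exists_vtx ho n hx
  exact ⟨k, ⟨h1, h2⟩, rfl⟩

theorem vset_disjoint {o : ℤ} {I J : Set ℤ} (h : ∀ i ∈ I, ∀ j ∈ J, i ≠ j ∧ |i - j| < N) :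
    Disjoint (vset N o I) (vset N o J) := by
  rw [Set.disjoint_left]
  rintro _ ⟨i, hi, rfl⟩ ⟨j, hj, hij⟩
  obtain ⟨t, ht⟩ := vtx_eq_iff.1 hij
  obtain ⟨h1, h2⟩ := h i hi j hj
  rw [abs_lt] at h2
  rcases lt_trichotomy t 0 with h | h | h
  · nlinarith
  · subst h; apply h1; linarith
  · nlinarith

theorem vset_union (o : ℤ) (I J : Set ℤ) : vset N o (I ∪ J) = vset N o I ∪ vset N o J :=
  Set.image_union _ _ _

theorem vset_Ico_shift (o n k t : ℤ) :
    vset N o (Set.Ico (n + N * t) (k + N * t)) = vset N o (Set.Ico n k) := by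
  ext x
  constructor
  · rintro ⟨i, ⟨h1, h2⟩, rfl⟩
    exact ⟨i - N * t, ⟨by linarith, by linarith⟩, vtx_eq_iff.2 ⟨-t, by ring⟩⟩
  · rintro ⟨i, ⟨h1, h2⟩, rfl⟩
    exact ⟨i + N * t, ⟨by linarith, by linarith⟩, vtx_eq_iff.2 ⟨t, by ring⟩⟩

theorem interval_vtx {b : ZMod 2} (o n : ℤ) (k : ℕ) :
    (CyclicGraph.coarse b).interval (vtx N o n) k = vset N o (Set.Ico n (n + k + 1)) := by
  ext x
  constructor
  · rintro ⟨j, hj, rfl⟩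
    refine ⟨n + j, ⟨by omega, by omega⟩, ?_⟩
    simp only [CyclicGraph.succ, CyclicGraph.step, vtx]
    push_cast
    ring
  · rintro ⟨i, ⟨h1, h2⟩, rfl⟩
    refine ⟨(i - n).toNat, by omega, ?_⟩
    simp only [CyclicGraph.succ, CyclicGraph.step, vtx]
    have : ((i - n).toNat : ℤ) = i - n := by omega
    have h3 : (((i - n).toNat : ℤ) : Pos N) = ((i - n : ℤ) : Pos N) := by rw [this]
    push_cast at h3 ⊢
    rw [h3]
    ring

end Positions

/-! ### Duality in partitions of a factor. -/

section PartitionFacts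

variable {Ω : Type*} [CStarAlgebra Ω]

theorem IsMinIdem.isAtomProj {D : StarSubalgebra ℂ Ω} (hD : D ≤ commutant D) {p : Ω}
    (hp : IsMinIdem D p) : IsAtomProj D p := by
  refine ⟨hp.mem, ?_, hp.ne_zero, fun q hq hq' hpq => ?_⟩
  · rw [isStarProjection_iff_isIdempotentElem_and_isStarNormal]
    exact ⟨hp.idem, ⟨le_commutant_iff.1 hD _ hp.mem _ (star_mem hp.mem)⟩⟩
  · obtain ⟨μ, hμ⟩ := hp.scalar q hq
    rw [hpq] at hμ
    have h1 : q * q = q := hq'.isIdempotentElem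
    rw [hμ, smul_mul_smul_comm, hp.idem, ← sub_eq_zero, ← sub_smul, smul_eq_zero] at h1
    rcases h1 with h1 | h1
    · have h2 : μ * (μ - 1) = 0 := by linear_combination h1
      rcases mul_eq_zero.1 h2 with h3 | h3
      · left; rw [hμ, h3, zero_smul]
      · right; rw [hμ, sub_eq_zero.1 h3, one_smul]
    · exact absurd h1 hp.ne_zero

/-- The equality in each block is glued along the atoms of the centre of `B`. -/
theorem IsBipartition.inf_le [FiniteDimensional ℂ Ω] {A₁ A₂ B : StarSubalgebra ℂ Ω}
    (h : IsBipartition A₁ A₂ B) : commutant A₁ ⊓ B ≤ A₂ ⊔ centre B := by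
  intro x hx
  have hZ : centre B ≤ commutant (centre B) :=
    (centre_le_commutant _).trans (commutant_anti (centre_le _))
  refine mem_sup_of_forall_atoms hZ fun p hp => ?_
  have h1 : p * x ∈ (fun x => p * x) '' (A₂ : Set Ω) := by
    rw [← h.comm_condition p (hp.isAtomProj hZ)]
    exact ⟨x, hx, rfl⟩
  obtain ⟨m, hm, h2⟩ := h1
  exact ⟨m, hm, h2.symm⟩

theorem IsPartition.mono {P : Type*} {V : Set P} {A : Set P → StarSubalgebra ℂ Ω}
    (h : IsPartition V A) {S T : Set P} (hST : S ⊆ T) (hT : T ⊆ V) : A S ≤ A T := by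
  have := (h.bipartition S (T \ S) (hST.trans hT) (Set.sdiff_subset.trans hT)
    Set.disjoint_sdiff_right).left_le
  rwa [Set.union_sdiff_cancel hST] at this

theorem centre_top_le (hfac : Subalgebra.center ℂ Ω = ⊥) :
    centre (⊤ : StarSubalgebra ℂ Ω) ≤ ⊥ := by
  intro u hu
  have h2 : u ∈ Subalgebra.center ℂ Ω :=
    Subalgebra.mem_center_iff.2 fun a => mem_commutant.1 hu.2 a trivial
  rw [hfac] at h2
  obtain ⟨μ, rfl⟩ := Algebra.mem_bot.1 h2
  exact StarSubalgebra.algebraMap_mem _ μ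

/-- The centre of the factor has 1 as an atom, so the blockwise condition for `S` and its complement
becomes plain duality. -/
theorem IsPartition.commutant_eq [FiniteDimensional ℂ Ω] [Nontrivial Ω]
    (hfac : Subalgebra.center ℂ Ω = ⊥)
    {P : Type*} {V : Set P} {A : Set P → StarSubalgebra ℂ Ω} (h : IsPartition V A) {S : Set P}
    (hS : S ⊆ V) : commutant (A S) = A (V \ S) := by
  have h1 := h.bipartition S (V \ S) hS Set.sdiff_subset Set.disjoint_sdiff_right
  rw [Set.union_sdiff_cancel hS, h.whole] at h1
  apply le_antisymm
  · have h2 := h1.inf_le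
    rw [inf_top_eq] at h2
    exact h2.trans (sup_le le_rfl ((centre_top_le hfac).trans bot_le))
  · have hone : IsAtomProj (centre (⊤ : StarSubalgebra ℂ Ω)) 1 := by
      apply IsMinIdem.isAtomProj
      · exact (centre_le_commutant _).trans (commutant_anti (centre_le _))
      · refine ⟨one_mem _, one_mul _, one_ne_zero, fun y hy => ?_⟩
        obtain ⟨μ, hμ⟩ := Algebra.mem_bot.1 (centre_top_le hfac hy)
        exact ⟨μ, by rw [one_mul, ← hμ, Algebra.algebraMap_eq_smul_one]⟩
    have h2 := h1.comm_condition 1 hone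
    simp only [one_mul, Set.image_id'] at h2
    intro x hx
    have : x ∈ (A (V \ S) : Set Ω) := hx
    rw [← h2] at this
    exact this.1

end PartitionFacts

/-! ### The arc system of a partition, with cuts between the vertices. -/

namespace FactorPartition

variable {N : ℕ} {b : ZMod 2}

/-- The algebra of the vertices with index in a set of integers. -/
def ialg (X : FactorPartition.{u} N (.coarse b)) (o : ℤ) (I : Set ℤ) : StarSubalgebra ℂ X.Ω :=
  X.alg (vset N o I)

/-- The algebra of the cut before the vertex with index `n`. -/
def cutAlg (X : FactorPartition.{u} N (.coarse b)) (o n : ℤ) : StarSubalgebra ℂ X.Ω :=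
  centre (X.alg {vtx N o (n - 1)}) ⊓ centre (X.alg {vtx N o n})

variable (X : FactorPartition.{u} N (.coarse b)) {o : ℤ}

theorem ialg_mono [NeZero N] (ho : o % 4 = 2 * b.val) {I J : Set ℤ} (h : I ⊆ J) :
    X.ialg o I ≤ X.ialg o J :=
  X.isPartition.mono (Set.image_mono h) (vset_subset ho J)

theorem commutant_ialg [NeZero N] (ho : o % 4 = 2 * b.val) {n k : ℤ} (h1 : n ≤ k)
    (h2 : k ≤ n + N) :
    commutant (X.ialg o (Set.Ico n k)) = X.ialg o (Set.Ico k (n + N)) := by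
  rw [ialg, X.isPartition.commutant_eq X.factor (vset_subset ho _), ialg, ← vset_Ico_full ho n,
    ← Set.Ico_union_Ico_eq_Ico h1 h2, vset_union, Set.union_sdiff_cancel_left]
  refine Set.disjoint_iff.1 (vset_disjoint ?_)
  rintro i ⟨h3, h4⟩ j ⟨h5, h6⟩
  exact ⟨by omega, by rw [abs_lt]; omega⟩

theorem ialg_Ico_shift (n k t : ℤ) :
    X.ialg o (Set.Ico (n + N * t) (k + N * t)) = X.ialg o (Set.Ico n k) := by
  rw [ialg, vset_Ico_shift, ialg]

theorem cutAlg_shift (n t : ℤ) : X.cutAlg o (n + N * t) = X.cutAlg o n := by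
  rw [cutAlg, cutAlg, vtx_eq_iff.2 ⟨t, rfl⟩, (vtx_eq_iff.2 ⟨t, by ring⟩ :
    vtx N o (n + N * t - 1) = vtx N o (n - 1))]

theorem centre_ialg [NeZero N] (ho : o % 4 = 2 * b.val) {n k : ℤ} (h1 : n < k) (h2 : k < n + N) :
    centre (X.ialg o (Set.Ico n k)) = X.cutAlg o n ⊔ X.cutAlg o k := by
  -- A graph interval is closed and its parameter counts steps, so `[n, k)` has parameter `k - n -
  -- 1`.
  have h3 := interval_vtx (N := N) (b := b) o n (k - n - 1).toNat
  rw [show n + ((k - n - 1).toNat : ℤ) + 1 = k by omega] at h3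
  have h4 := X.stronglyConnected (vtx N o n) (vtx_mem ho n) (k - n - 1).toNat (by
    rw [h3, ← vset_Ico_full ho n]
    intro he
    have h5 : vtx N o k ∈ vset N o (Set.Ico n (n + N)) := ⟨k, ⟨h1.le, h2⟩, rfl⟩
    rw [← he] at h5
    obtain ⟨i, ⟨h6, h7⟩, h8⟩ := h5
    obtain ⟨t, ht⟩ := vtx_eq_iff.1 h8
    rcases lt_trichotomy t 0 with h | h | h
    · nlinarith
    · subst h; omega
    · nlinarith)
  rw [h3] at h4
  rw [ialg, h4, cutAlg, cutAlg]
  have e1 : (CyclicGraph.coarse b).pred (vtx N o n) = vtx N o (n - 1) := by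
    simp only [CyclicGraph.pred, CyclicGraph.step, vtx]; push_cast; ring
  have e2 : ∀ j : ℕ, (CyclicGraph.coarse b).succ (vtx N o n) j = vtx N o (n + j) := by
    intro j
    simp only [CyclicGraph.succ, CyclicGraph.step, vtx]; push_cast; ring
  rw [e1, e2, e2, show n + ((k - n - 1).toNat : ℤ) = k - 1 by omega,
    show n + (((k - n - 1).toNat + 1 : ℕ) : ℤ) = k by omega]

theorem cutAlg_le_left (n : ℤ) : X.cutAlg o n ≤ X.ialg o {n - 1} := by
  rw [ialg, vset, Set.image_singleton]
  exact inf_le_left.trans (centre_le _)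

theorem cutAlg_le_right (n : ℤ) : X.cutAlg o n ≤ X.ialg o {n} := by
  rw [ialg, vset, Set.image_singleton]
  exact inf_le_right.trans (centre_le _)

/-- An element commuting with the third arc lies in the union of the first two; the bipartition
reduces it to the middle arc up to a centre, and commuting with the middle arc leaves centres only.
-/
theorem ialg_star [NeZero N] (ho : o % 4 = 2 * b.val) {n k m : ℤ} (h1 : n < k) (h2 : k < m)
    (h3 : m < n + N) : commutant (X.ialg o (Set.Ico n k) ⊔ X.ialg o (Set.Ico k m) ⊔
      X.ialg o (Set.Ico m (n + N))) ≤ X.cutAlg o n ⊔ X.cutAlg o k ⊔ X.cutAlg o m := by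
  rw [← X.commutant_ialg ho (n := n) (k := m) (by omega) (by omega), commutant_sup, commutant_sup,
    commutant_commutant X.factor]
  rintro u ⟨⟨hu1, hu2⟩, hu3⟩
  have h4 := X.isPartition.bipartition (vset N o (Set.Ico n k)) (vset N o (Set.Ico k m))
    (vset_subset ho _) (vset_subset ho _) (vset_disjoint (by
      rintro i ⟨h3, h4⟩ j ⟨h5, h6⟩
      exact ⟨by omega, by rw [abs_lt]; omega⟩))
  rw [← vset_union, Set.Ico_union_Ico_eq_Ico h1.le h2.le] at h4
  have h5 := h4.inf_le ⟨hu1, hu3⟩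
  have h6 := sup_inf_commutant_left_le ?_ ⟨h5, hu2⟩
  · change u ∈ centre (X.ialg o (Set.Ico k m)) ⊔ centre (X.ialg o (Set.Ico n m)) at h6
    rw [X.centre_ialg ho h2 (by omega), X.centre_ialg ho (h1.trans h2) h3] at h6
    refine SetLike.le_def.1 (sup_le (sup_le ?_ ?_) (sup_le ?_ ?_)) h6
    · exact le_sup_of_le_left le_sup_right
    · exact le_sup_right
    · exact le_sup_of_le_left le_sup_left
    · exact le_sup_right
  · rw [le_commutant_comm]
    exact (centre_le_commutant _).trans (commutant_anti h4.right_le)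

/-- The arcs of the partition, for the cuts with even index. -/
def baseArc (o : ℤ) (x y : ZMod (2 * N)) : StarSubalgebra ℂ X.Ω :=
  -- The end is the start plus the forward distance, which stays correct for arcs through the
  -- origin.
  X.ialg o (Set.Ico (x.val / 2 : ℤ) ((x.val + (y - x).val : ℤ) / 2))

/-- The algebras of the cuts with even index. -/
def baseEdge (o : ℤ) (x : ZMod (2 * N)) : StarSubalgebra ℂ X.Ω :=
  X.cutAlg o (x.val / 2 : ℤ)

theorem baseArc_eq [NeZero N] {n k : ℤ} (h1 : n < k) (h2 : k < n + N) :
    X.baseArc o ((2 * n : ℤ) : ZMod (2 * N)) ((2 * k : ℤ) : ZMod (2 * N)) =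
      X.ialg o (Set.Ico n k) := by
  have : NeZero (2 * N) := ⟨by have := NeZero.ne N; omega⟩
  have h3 : ((((2 * n : ℤ) : ZMod (2 * N)).val : ℕ) : ℤ) = 2 * n - 2 * (N * (2 * n / (2 * N : ℕ))) := by
    rw [ZMod.val_intCast, Int.emod_def]; push_cast; ring
  have h4 : (((((2 * k : ℤ) : ZMod (2 * N)) - ((2 * n : ℤ) : ZMod (2 * N))).val : ℕ) : ℤ) =
      2 * k - 2 * n := by
    rw [← Int.cast_sub, ZMod.val_intCast]
    exact Int.emod_eq_of_lt (by omega) (by push_cast; omega)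
  rw [baseArc, h3, h4, ← X.ialg_Ico_shift n k (-(2 * n / (2 * N : ℕ)))]
  congr 2
  · rw [mul_neg]; omega
  · rw [mul_neg]; omega

theorem baseEdge_eq [NeZero N] (n : ℤ) :
    X.baseEdge o ((2 * n : ℤ) : ZMod (2 * N)) = X.cutAlg o n := by
  have : NeZero (2 * N) := ⟨by have := NeZero.ne N; omega⟩
  have h3 : ((((2 * n : ℤ) : ZMod (2 * N)).val : ℕ) : ℤ) = 2 * n - 2 * (N * (2 * n / (2 * N : ℕ))) := by
    rw [ZMod.val_intCast, Int.emod_def]; push_cast; ring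
  rw [baseEdge, h3, ← X.cutAlg_shift n (-(2 * n / (2 * N : ℕ)))]
  congr 1
  rw [mul_neg]; omega

/-- The cuts with even index. -/
def evenCuts (N : ℕ) : Set (ZMod (2 * N)) := {x | ∃ n : ℤ, x = ((2 * n : ℤ) : ZMod (2 * N))}

theorem mem_evenCuts {n : ℤ} : ((n : ℤ) : ZMod (2 * N)) ∈ evenCuts N ↔ n % 2 = 0 := by
  constructor
  · rintro ⟨m, hm⟩
    rw [ZMod.intCast_eq_intCast_iff_dvd_sub] at hm
    obtain ⟨k, hk⟩ := hm
    push_cast at hk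
    rw [mul_assoc] at hk
    omega
  · intro h
    exact ⟨n / 2, by congr 1; omega⟩

theorem exists_two_mul [NeZero N] (c : ℤ) {x : ZMod (2 * N)} (hx : x ∈ evenCuts N) :
    ∃ n : ℤ, c ≤ n ∧ n < c + N ∧ x = ((2 * n : ℤ) : ZMod (2 * N)) := by
  have : NeZero (2 * N) := ⟨by have := NeZero.ne N; omega⟩
  obtain ⟨i, h1, h2, rfl⟩ := exists_intCast_zmod (2 * c) x
  rw [mem_evenCuts] at hx
  push_cast at h2
  exact ⟨i / 2, by omega, by omega, by congr 1; omega⟩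

theorem arcSystem_base [NeZero N] (ho : o % 4 = 2 * b.val) :
    ArcSystem (evenCuts N) (X.baseArc o) (X.baseEdge o) := by
  have hcast : ∀ n : ℤ, ((2 * n : ℤ) : ZMod (2 * N)) = ((2 * (n + N) : ℤ) : ZMod (2 * N)) := by
    intro n
    rw [ZMod.intCast_eq_intCast_iff_dvd_sub]
    exact ⟨1, by push_cast; ring⟩
  have hne : ∀ n k : ℤ, n ≤ k → ((2 * n : ℤ) : ZMod (2 * N)) ≠ ((2 * k : ℤ) : ZMod (2 * N)) → n < k :=
    fun n k h h' => lt_of_le_of_ne h fun he => h' (by rw [he])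
  have hcyc : ∀ x ∈ evenCuts N, ∀ y ∈ evenCuts N, ∀ z ∈ evenCuts N, Cyc x y z →
      ∃ n k m : ℤ, n < k ∧ k < m ∧ m < n + N ∧ x = ((2 * n : ℤ) : ZMod (2 * N)) ∧
        y = ((2 * k : ℤ) : ZMod (2 * N)) ∧ z = ((2 * m : ℤ) : ZMod (2 * N)) := by
    rintro x hx y hy z hz ⟨i, j, k, h1, h2, h3, rfl, rfl, rfl⟩
    rw [mem_evenCuts] at hx hy hz
    push_cast at h3
    exact ⟨i / 2, j / 2, k / 2, by omega, by omega, by omega, by congr 1; omega,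
      by congr 1; omega, by congr 1; omega⟩
  refine ⟨?_, ?_, ?_, ?_⟩
  · intro x hx y hy hxy
    obtain ⟨n, -, -, rfl⟩ := exists_two_mul 0 hx
    obtain ⟨k, h1, h2, rfl⟩ := exists_two_mul n hy
    have h3 := hne _ _ h1 hxy
    rw [X.baseArc_eq h3 h2, hcast n, X.baseArc_eq (by omega) (by omega),
      X.commutant_ialg ho h1 h2.le]
  · intro x hx y hy z hz hc
    obtain ⟨n, k, m, h1, h2, h3, rfl, rfl, rfl⟩ := hcyc x hx y hy z hz hc
    rw [X.baseArc_eq h1 (by omega), X.baseArc_eq (by omega) h3]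
    exact X.ialg_mono ho (Set.Ico_subset_Ico_right h2.le)
  · intro x hx y hy hxy
    obtain ⟨n, -, -, rfl⟩ := exists_two_mul 0 hx
    obtain ⟨k, h1, h2, rfl⟩ := exists_two_mul n hy
    have h3 := hne _ _ h1 hxy
    rw [X.baseArc_eq h3 h2, X.baseEdge_eq, X.baseEdge_eq, X.centre_ialg ho h3 h2]
  · intro x hx y hy z hz hc
    obtain ⟨n, k, m, h1, h2, h3, rfl, rfl, rfl⟩ := hcyc x hx y hy z hz hc
    have h4 : X.baseArc o ((2 * m : ℤ) : ZMod (2 * N)) ((2 * n : ℤ) : ZMod (2 * N)) =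
        X.ialg o (Set.Ico m (n + N)) := by
      rw [hcast n, X.baseArc_eq (by omega) (by omega)]
    rw [X.baseArc_eq h1 (by omega), X.baseArc_eq h2 (by omega), h4, X.baseEdge_eq, X.baseEdge_eq,
      X.baseEdge_eq]
    exact X.ialg_star ho h1 h2 h3

/-- Two bounds appear because the separation must exceed `l` both ways round the circle. -/
theorem uncorrelated_ialg [NeZero N] (ho : o % 4 = 2 * b.val) {l : ℕ}
    (hX : X.CorrelationLengthLE (4 * l)) {I J : Set ℤ}
    (h : ∀ i ∈ I, ∀ j ∈ J, (l : ℤ) < |i - j| ∧ |i - j| < N - l) :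
    Uncorrelated (X.ialg o I) (X.ialg o J) := by
  have h1 := hX (vset N o I) (vset_subset ho I)
  have h2 : vset N o J ⊆ (CyclicGraph.coarse b).verts N \
      (CyclicGraph.coarse b).nbhd (vset N o I) (4 * l) := by
    rintro _ ⟨j, hj, rfl⟩
    refine ⟨vtx_mem ho j, ?_⟩
    rintro ⟨-, _, ⟨i, hi, rfl⟩, hd⟩
    obtain ⟨s, hs, hs'⟩ := circleDist_le_iff.1 hd
    rw [vtx, vtx, ← Int.cast_add, intCast_pos_eq_iff] at hs'
    obtain ⟨t, ht⟩ := hs'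
    obtain ⟨h3, h4⟩ := h i hi j hj
    rw [abs_lt] at h4
    rw [lt_abs] at h3
    rw [abs_le] at hs
    push_cast at hs
    rcases lt_trichotomy t 0 with h | h | h
    · nlinarith
    · subst h; omega
    · nlinarith
  intro a ha c hc hac
  exact h1 a ha c (X.isPartition.mono h2 Set.sdiff_subset hc) hac

end FactorPartition

/-! ### Conditional independence, and generation of long arcs by short ones. -/

section Markov

variable {Ω : Type*} [CStarAlgebra Ω]

theorem uncorrelated_mono {A A' B B' : StarSubalgebra ℂ Ω}
    (h : Uncorrelated A B) (hA : A' ≤ A) (hB : B' ≤ B) : Uncorrelated A' B' :=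
  fun a ha c hc => h a (hA ha) c (hB hc)

theorem IsMinIdem.mul {P Q : StarSubalgebra ℂ Ω} (h : P ≤ commutant Q) {p q : Ω}
    (hp : IsMinIdem P p) (hq : IsMinIdem Q q) (hpq : p * q ≠ 0) : IsMinIdem (P ⊔ Q) (p * q) := by
  have hc := le_commutant_iff.1 h
  refine ⟨mul_mem (StarSubalgebra.mem_sup_left hp.mem) (StarSubalgebra.mem_sup_right hq.mem), ?_,
    hpq, fun y hy => ?_⟩
  · rw [mul_assoc, ← mul_assoc q, hc _ hp.mem _ hq.mem, mul_assoc, hq.idem, ← mul_assoc, hp.idem]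
  · obtain ⟨m, hm, h1⟩ := hq.exists_mul_eq h hy
    obtain ⟨μ, hμ⟩ := hp.scalar m hm
    refine ⟨μ, ?_⟩
    rw [mul_assoc, h1, hc _ hm _ hq.mem, ← mul_assoc, hμ, smul_mul_assoc]

/-- An algebra and its commutant are independent inside every block. -/
theorem mul_eq_zero_of_isMinIdem_centre [FiniteDimensional ℂ Ω] {M M' : StarSubalgebra ℂ Ω}
    (h : M ≤ commutant M') {f a c : Ω} (hf : IsMinIdem (centre M) f) (ha : a ∈ M) (hc : c ∈ M')
    (hac : f * a * c = 0) : f * a = 0 ∨ f * c = 0 := by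
  by_contra! hne
  obtain ⟨n, s, t, hs, ht, -, h2, h3⟩ := exists_average M
  have hcomm := le_commutant_iff.1 h
  have hfM : f ∈ M := centre_le _ hf.mem
  have hfa : f * a ∈ M := mul_mem hfM ha
  have hfc : ∀ m ∈ M, m * f = f * m := mem_commutant.1 (centre_le_commutant M hf.mem)
  -- The average of a positive element is central, hence a multiple of the atom `f`. As `c` kills
  -- it, it kills `f`.
  set ζ := ∑ i, s i * (star (f * a) * (f * a)) * t i with hζ
  have hζ0 : ζ ≠ 0 := fun h0 => hne.1 (h3 _ hfa h0)
  have hζM : ζ ∈ M := sum_mem fun i _ => mul_mem (mul_mem (hs i) (mul_mem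
    (star_mem hfa) hfa)) (ht i)
  have hζc : ζ * c = 0 := by
    rw [hζ, Finset.sum_mul]
    refine Finset.sum_eq_zero fun i _ => ?_
    calc s i * (star (f * a) * (f * a)) * t i * c
        = s i * (star (f * a) * (f * a)) * (t i * c) := by simp only [mul_assoc]
      _ = s i * (star (f * a) * (f * a * c)) * t i := by
        rw [← hcomm _ (ht i) _ hc]; simp only [mul_assoc]
      _ = 0 := by rw [hac]; simp
  have hζf : ζ * f = ζ := by
    rw [hζ, Finset.sum_mul]
    refine Finset.sum_congr rfl fun i _ => ?_
    calc s i * (star (f * a) * (f * a)) * t i * f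
        = s i * (star (f * a) * (f * (a * t i * f))) := by simp only [mul_assoc]
      _ = s i * (star (f * a) * (f * f * a)) * t i := by
        rw [hfc _ (mul_mem ha (ht i))]; simp only [mul_assoc]
      _ = _ := by rw [hf.idem]
  obtain ⟨μ, hμ⟩ := hf.scalar ζ ⟨hζM, h2 _⟩
  rw [← hfc _ hζM, hζf] at hμ
  rw [hμ, smul_mul_assoc, smul_eq_zero] at hζc
  rcases hζc with h4 | h4
  · exact hζ0 (by rw [hμ, h4, zero_smul])
  · exact hne.2 h4

theorem exists_atom_mul_ne_zero [FiniteDimensional ℂ Ω] {D : StarSubalgebra ℂ Ω}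
    (hD : D ≤ commutant D) {x : Ω} (hx : x ≠ 0) : ∃ e, IsMinIdem D e ∧ x * e ≠ 0 := by
  obtain ⟨s, hs, hsum⟩ := exists_atoms hD
  by_contra! h
  apply hx
  rw [← mul_one x, ← hsum, Finset.mul_sum]
  exact Finset.sum_eq_zero fun e he => h e (hs e he).1

namespace ArcSystem

variable {M : ℕ} {X : Set (ZMod M)} {F : ZMod M → ZMod M → StarSubalgebra ℂ Ω}
  {E : ZMod M → StarSubalgebra ℂ Ω} [FiniteDimensional ℂ Ω]

/-- Suppose atoms `e₁`, `e₂` of `E p₁`, `E p₂` satisfy `d * e₁ * e₂ = 0`, and let `e₃` be the atom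
of `E y` above `d`. Then `e₁ * e₃` selects a block of the arc from `p₁` to `y`, in which `e₂`
(inside the arc) and `d` (in the complementary arc) are independent. One of them vanishes there; the
absence of correlations excludes `e₂`, so `d * e₁ = 0`. -/
theorem condIndep_of_uncorrelated (h : ArcSystem X F E) {x p₁ p₂ y : ℤ}
    (hx : (x : ZMod M) ∈ X) (hp₁ : (p₁ : ZMod M) ∈ X) (hp₂ : (p₂ : ZMod M) ∈ X)
    (hy : (y : ZMod M) ∈ X) (h1 : x < p₁) (h2 : p₁ ≤ p₂) (h3 : p₂ < y) (h4 : y < x + M)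
    (hun : Uncorrelated (E p₁) (E p₂ ⊔ E y)) : CondIndep (E p₁) (E x ⊔ E y) (E p₂) := by
  have ab1 : E p₁ ≤ commutant (E p₁) :=
    h.edge_abelian hp₁ hx (intCast_zmod_ne (by omega) (by omega) (by omega))
  have ab2 : E p₂ ≤ commutant (E p₂) :=
    h.edge_abelian hp₂ hx (intCast_zmod_ne (by omega) (by omega) (by omega))
  have ab3 : E y ≤ commutant (E y) :=
    h.edge_abelian hy hx (intCast_zmod_ne (by omega) (by omega) (by omega))
  have hE1y : E p₁ ≤ commutant (E y) :=
    (h.edge_comm : E p₁ ≤ commutant (F y x)).trans (commutant_anti h.edge)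
  have hE2y : E p₂ ≤ commutant (E y) :=
    (h.edge_comm : E p₂ ≤ commutant (F y x)).trans (commutant_anti h.edge)
  have hE12 : E p₁ ≤ commutant (E p₂) :=
    (h.edge_comm : E p₁ ≤ commutant (F p₁ y)).trans (commutant_anti h.edge)
  have hD2 : E p₂ ≤ commutant (E x ⊔ E y) := le_commutant_sup
    ((h.edge_comm : E p₂ ≤ commutant (F y x)).trans (commutant_anti h.edge)) hE2y
  have hcen : centre (F p₁ y) = E p₁ ⊔ E y := h.centre_eq
  intro d hd p hp q hq hdpq
  by_contra! hne
  obtain ⟨e₁, he₁, hne₁⟩ := exists_atom_mul_ne_zero ab1 hne.1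
  obtain ⟨e₂, he₂, hne₂⟩ := exists_atom_mul_ne_zero ab2 hne.2
  obtain ⟨e₃, he₃, hne₃⟩ := exists_atom_mul_ne_zero ab3 hd.ne_zero
  obtain ⟨μ, hμ⟩ := he₁.scalar p hp
  obtain ⟨ν, hν⟩ := he₂.scalar q hq
  obtain ⟨κ, hκ⟩ := hd.scalar e₃ (StarSubalgebra.mem_sup_right he₃.mem)
  have c1 := le_commutant_iff.1 ab1
  have c2 := le_commutant_iff.1 ab2
  have c1y := le_commutant_iff.1 hE1y
  have c12 := le_commutant_iff.1 hE12
  have cd2 := le_commutant_iff.1 hD2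
  have hpe : p * e₁ = μ • e₁ := by rw [c1 _ he₁.mem _ hp, hμ]
  have hqe : q * e₂ = ν • e₂ := by rw [c2 _ he₂.mem _ hq, hν]
  rw [mul_assoc, hpe, mul_smul_comm] at hne₁
  rw [mul_assoc, hqe, mul_smul_comm] at hne₂
  obtain ⟨hμ0, hde₁⟩ := smul_ne_zero_iff.1 hne₁
  obtain ⟨hν0, hde₂⟩ := smul_ne_zero_iff.1 hne₂
  have hκ1 : d * e₃ = d := by
    have h5 : d * e₃ * e₃ = d * e₃ := by rw [mul_assoc, he₃.idem]
    rw [hκ, smul_mul_assoc, hκ, smul_smul, ← sub_eq_zero, ← sub_smul, smul_eq_zero] at h5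
    rw [hκ] at hne₃ ⊢
    have hκ0 := (smul_ne_zero_iff.1 hne₃).1
    have h6 : κ * (κ - 1) = 0 := by
      have := h5.resolve_right hd.ne_zero
      linear_combination this
    rw [sub_eq_zero.1 ((mul_eq_zero.1 h6).resolve_left hκ0), one_smul]
  have hzero : d * e₁ * e₂ = 0 := by
    have h5 : d * p * q * (e₁ * e₂) = (μ * ν) • (d * e₁ * e₂) := by
      calc d * p * q * (e₁ * e₂) = d * p * ((q * e₁) * e₂) := by simp only [mul_assoc]
        _ = d * (p * e₁) * (q * e₂) := by rw [c12 _ he₁.mem _ hq]; simp only [mul_assoc]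
        _ = _ := by
          rw [hpe, hqe, mul_smul_comm, mul_smul_comm, smul_mul_assoc, smul_smul, mul_comm ν]
    rw [hdpq, zero_mul, eq_comm, smul_eq_zero] at h5
    exact h5.resolve_left (mul_ne_zero hμ0 hν0)
  have hde13 : d * (e₁ * e₃) = d * e₁ := by
    rw [← c1y _ he₁.mem _ he₃.mem, ← mul_assoc, hκ1]
  have hmin : IsMinIdem (centre (F p₁ y)) (e₁ * e₃) := by
    rw [hcen]
    refine he₁.mul hE1y he₃ fun h0 => hde₁ ?_
    rw [← hde13, h0, mul_zero]
  have hdF : d ∈ F y p₁ :=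
    (sup_le h.edge h.edge : E x ⊔ E y ≤ F y p₁) hd.mem
  have he2F : e₂ ∈ F p₁ y := (h.edge : E p₂ ≤ F p₁ y) he₂.mem
  have c13d : d * (e₁ * e₃) = (e₁ * e₃) * d := by
    have : e₁ * e₃ ∈ F p₁ y :=
      mul_mem ((h.edge : E p₁ ≤ F p₁ y) he₁.mem) ((h.edge : E y ≤ F p₁ y) he₃.mem)
    exact le_commutant_iff.1 (h.disj : F p₁ y ≤ commutant (F y p₁)) _ this _ hdF
  have hfin := mul_eq_zero_of_isMinIdem_centre (h.disj : F p₁ y ≤ commutant (F y p₁)) hmin he2F hdF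
    (by rw [mul_assoc, ← cd2 _ he₂.mem _ hd.mem, ← mul_assoc, ← c13d, hde13, hzero])
  rcases hfin with h5 | h5
  · rw [mul_assoc] at h5
    rcases hun e₁ he₁.mem (e₃ * e₂) (mul_mem (StarSubalgebra.mem_sup_right he₃.mem)
      (StarSubalgebra.mem_sup_left he₂.mem)) h5 with h6 | h6
    · exact he₁.ne_zero h6
    · exact hde₂ (by rw [← hκ1, mul_assoc, h6, mul_zero])
  · exact hde₁ (by rw [← hde13, c13d, h5])

/-- An arc is generated by two overlapping arcs, if the overlap is long compared to the
correlations. -/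
theorem le_sup_of_uncorrelated [Nontrivial Ω] (hfac : Subalgebra.center ℂ Ω = ⊥)
    (h : ArcSystem X F E) {x p₁ p₂ y : ℤ}
    (hx : (x : ZMod M) ∈ X) (hp₁ : (p₁ : ZMod M) ∈ X) (hp₂ : (p₂ : ZMod M) ∈ X)
    (hy : (y : ZMod M) ∈ X) (h1 : x < p₁) (h2 : p₁ ≤ p₂) (h3 : p₂ < y) (h4 : y < x + M)
    (hun : Uncorrelated (E p₁) (E p₂ ⊔ E y)) : F x y ≤ F x p₂ ⊔ F p₁ y := by
  have hci := h.condIndep_of_uncorrelated hx hp₁ hp₂ hy h1 h2 h3 h4 hun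
  have ab : ∀ p : ℤ, (p : ZMod M) ∈ X → x < p → p < y → E p ≤ commutant (E p) :=
    fun p hp _ _ => h.edge_abelian hp hx (intCast_zmod_ne (by omega) (by omega) (by omega))
  have ab1 := ab p₁ hp₁ h1 (by omega)
  have ab2 := ab p₂ hp₂ (by omega) h3
  rw [← h.commutant_eq (x := y) (y := x)]
  apply commutant_le_comm hfac
  -- Shrinking either arc until the two abut leaves the edge of a single cut. The two resulting
  -- bounds involve different cuts, and independence of these given the ends removes both.
  have k1 : commutant (F x p₂ ⊔ F p₁ y) ≤ F y x ⊔ E p₂ :=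
    (commutant_anti (sup_le_sup_left h.sub _)).trans (h.bip hfac)
  have k2 : commutant (F x p₂ ⊔ F p₁ y) ≤ F y x ⊔ E p₁ :=
    (commutant_anti (sup_le_sup_right h.sub _)).trans (h.bip hfac)
  have hcen : centre (F y x) = E y ⊔ E x := h.centre_eq
  have hEp2 : F y x ≤ commutant (E p₂) := h.edge_comm'
  have hEp1 : F y x ≤ commutant (E p₁) := h.edge_comm'
  have hE12 : E p₂ ≤ commutant (E p₁) := le_commutant_comm.1
    ((h.edge_comm : E p₁ ≤ commutant (F p₁ y)).trans (commutant_anti h.edge))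
  have hD : E x ⊔ E y ≤ centre (F y x) := by rw [hcen, sup_comm]
  have hDM : E x ⊔ E y ≤ centre (F y x ⊔ E p₂) :=
    le_inf (le_sup_of_le_left (hD.trans (centre_le _))) (le_commutant_sup
      (hD.trans (centre_le_commutant _)) ((hD.trans (centre_le _)).trans hEp2))
  refine (le_inf k1 k2).trans (inf_sup_le_of_supportsIn (D := E x ⊔ E y) le_sup_left ab1
    (sup_le hEp1 hE12) (hD.trans (centre_le _))
    ((hD.trans (centre_le_commutant _)).trans (commutant_anti (hD.trans (centre_le _)))) ?_)
  refine supportsIn_of_condIndep (sup_le hEp1 hE12) ?_ hDM ?_ hci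
  · refine (centre_sup_le hEp2).trans ?_
    rw [hcen, sup_comm (E x)]
    exact sup_le_sup_left (centre_le _) _
  · exact le_inf le_sup_right (le_commutant_sup (le_commutant_comm.1 hEp2) ab2)

end ArcSystem

end Markov

namespace FactorPartition

variable {N : ℕ} {b : ZMod 2} (X : FactorPartition.{u} N (.coarse b)) {o : ℤ}

theorem ialg_le_sup [NeZero N] (ho : o % 4 = 2 * b.val) {l : ℕ}
    (hX : X.CorrelationLengthLE (4 * l)) (hN : 2 * l + 1 < N) {n k : ℤ} (h1 : n < k - 1 - l)
    (h2 : k < n + N) :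
    X.ialg o (Set.Ico n k) ≤ X.ialg o (Set.Ico n (k - 1)) ⊔ X.ialg o (Set.Ico (k - 1 - l) k) := by
  have h3 := (X.arcSystem_base ho).le_sup_of_uncorrelated X.factor (x := 2 * n)
    (p₁ := 2 * (k - 1 - l)) (p₂ := 2 * (k - 1)) (y := 2 * k) ⟨_, rfl⟩ ⟨_, rfl⟩ ⟨_, rfl⟩ ⟨_, rfl⟩
    (by omega) (by omega) (by omega) (by push_cast; omega) ?_
  · rwa [X.baseArc_eq (by omega) (by omega), X.baseArc_eq (by omega) (by omega),
      X.baseArc_eq (by omega) (by omega)] at h3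
  · rw [X.baseEdge_eq, X.baseEdge_eq, X.baseEdge_eq]
    -- The cut before the overlap is read on the vertex to its left, and the two other cuts on the
    -- vertex `k - 1`; the distance is then exactly `l + 1`.
    refine uncorrelated_mono (X.uncorrelated_ialg ho hX (I := {k - 1 - l - 1}) (J := {k - 1}) ?_)
      (X.cutAlg_le_left _) (sup_le (X.cutAlg_le_right _) (X.cutAlg_le_left _))
    rintro i rfl j rfl
    rw [lt_abs, abs_lt]
    omega

/-- The algebra of an arc is generated by those of the subarcs that are not longer than the
correlation length plus one. -/
theorem ialg_le_of_short [NeZero N] (ho : o % 4 = 2 * b.val) {l : ℕ}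
    (hX : X.CorrelationLengthLE (4 * l)) (hN : 2 * l + 1 < N) {n k : ℤ} (h1 : n < k)
    (h2 : k < n + N) {T : StarSubalgebra ℂ X.Ω} (hT : ∀ i j : ℤ, n ≤ i → i < j → j ≤ k →
      j ≤ i + l + 1 → X.ialg o (Set.Ico i j) ≤ T) : X.ialg o (Set.Ico n k) ≤ T := by
  obtain ⟨s, hs⟩ : ∃ s : ℕ, k = n + s + 1 := ⟨(k - n - 1).toNat, by omega⟩
  induction s generalizing k with
  | zero => exact hT n k le_rfl h1 le_rfl (by omega)
  | succ s ih =>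
    by_cases hle : k ≤ n + l + 1
    · exact hT n k le_rfl h1 le_rfl hle
    · refine (X.ialg_le_sup ho hX hN (by omega) h2).trans (sup_le ?_ ?_)
      · exact ih (by omega) (by omega) (fun i j h3 h4 h5 h6 => hT i j h3 h4 (by omega) h6)
          (by push_cast at hs; omega)
      · exact hT _ _ (by omega) (by omega) le_rfl (by omega)

end FactorPartition

/-! ### Pulling back the output partition. -/

section Transport

variable {N : ℕ} {b b' : ZMod 2} {X : FactorPartition.{u} N (.coarse b)}
  {Y : FactorPartition.{u} N (.coarse b')} {o o' : ℤ} {R : ℕ}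

/-- The algebras of the second partition, pulled back along an isomorphism. -/
def pullAlg (Y : FactorPartition.{u} N (.coarse b')) {Ω : Type u} [CStarAlgebra Ω] (U : Ω ≃⋆ₐ[ℂ] Y.Ω)
    (S : Set (Pos N)) : StarSubalgebra ℂ Ω :=
  (Y.alg S).comap (U : Ω →⋆ₐ[ℂ] Y.Ω)

variable {Ω : Type u} [CStarAlgebra Ω] {U : Ω ≃⋆ₐ[ℂ] Y.Ω}

theorem mem_pullAlg {S : Set (Pos N)} {a : Ω} : a ∈ pullAlg Y U S ↔ U a ∈ Y.alg S := Iff.rfl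

theorem pullAlg_le_iff {S : Set (Pos N)} {T : StarSubalgebra ℂ Ω} :
    pullAlg Y U S ≤ T ↔ Y.alg S ≤ T.map (U : Ω →⋆ₐ[ℂ] Y.Ω) := by
  constructor
  · intro h y hy
    exact ⟨U.symm y, h (by rw [mem_pullAlg, U.apply_symm_apply]; exact hy), U.apply_symm_apply y⟩
  · intro h a ha
    obtain ⟨t, ht, h1⟩ := h (mem_pullAlg.1 ha)
    exact U.injective h1 ▸ ht

theorem pullAlg_mono {S T : Set (Pos N)} (h : S ⊆ T)
    (hT : T ⊆ (CyclicGraph.coarse b').verts N) : pullAlg Y U S ≤ pullAlg Y U T :=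
  fun _ ha => Y.isPartition.mono h hT ha

theorem commutant_pullAlg {S : Set (Pos N)} (hS : S ⊆ (CyclicGraph.coarse b').verts N) :
    commutant (pullAlg Y U S) = pullAlg Y U ((CyclicGraph.coarse b').verts N \ S) := by
  ext x
  rw [mem_pullAlg, ← Y.isPartition.commutant_eq Y.factor hS, mem_commutant, mem_commutant]
  constructor
  · intro h y hy
    have := congrArg U (h (U.symm y) (by rw [mem_pullAlg, U.apply_symm_apply]; exact hy))
    simpa using this
  · intro h a ha
    have := h (U a) (mem_pullAlg.1 ha)
    rw [← map_mul, ← map_mul] at this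
    exact U.injective this

/-- The pulled back algebra of the vertices with index in a set of integers. -/
def pullInt (Y : FactorPartition.{u} N (.coarse b')) (U : Ω ≃⋆ₐ[ℂ] Y.Ω) (o' : ℤ) (I : Set ℤ) :
    StarSubalgebra ℂ Ω := pullAlg Y U (vset N o' I)

theorem pullInt_mono [NeZero N] (ho' : o' % 4 = 2 * b'.val) {I J : Set ℤ} (h : I ⊆ J) :
    pullInt Y U o' I ≤ pullInt Y U o' J :=
  pullAlg_mono (Set.image_mono h) (vset_subset ho' J)

theorem pullInt_Ico_shift (n k t : ℤ) :
    pullInt Y U o' (Set.Ico (n + N * t) (k + N * t)) = pullInt Y U o' (Set.Ico n k) := by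
  rw [pullInt, vset_Ico_shift, pullInt]

theorem commutant_pullInt [NeZero N] (ho' : o' % 4 = 2 * b'.val) {n k : ℤ} (h1 : n ≤ k)
    (h2 : k ≤ n + N) :
    commutant (pullInt Y U o' (Set.Ico n k)) = pullInt Y U o' (Set.Ico k (n + N)) := by
  rw [pullInt, commutant_pullAlg (vset_subset ho' _), pullInt, ← vset_Ico_full ho' n,
    ← Set.Ico_union_Ico_eq_Ico h1 h2, vset_union, Set.union_sdiff_cancel_left]
  refine Set.disjoint_iff.1 (vset_disjoint ?_)
  rintro i ⟨h3, h4⟩ j ⟨h5, h6⟩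
  exact ⟨by omega, by rw [abs_lt]; omega⟩

theorem pullInt_le_of_short [NeZero N] (ho' : o' % 4 = 2 * b'.val) {l : ℕ}
    (hY : Y.CorrelationLengthLE (4 * l)) (hN : 2 * l + 1 < N) {n k : ℤ} (h1 : n < k)
    (h2 : k < n + N) {T : StarSubalgebra ℂ Ω} (hT : ∀ i j : ℤ, n ≤ i → i < j → j ≤ k →
      j ≤ i + l + 1 → pullInt Y U o' (Set.Ico i j) ≤ T) : pullInt Y U o' (Set.Ico n k) ≤ T := by
  rw [pullInt, pullAlg_le_iff]
  refine Y.ialg_le_of_short ho' hY hN h1 h2 fun i j h3 h4 h5 h6 => ?_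
  exact pullAlg_le_iff.1 (hT i j h3 h4 h5 h6)

end Transport

/-! ### One-sided light cones. -/

section Causality

variable {N : ℕ} {b b' : ZMod 2} {X : FactorPartition.{u} N (.coarse b)}
  {Y : FactorPartition.{u} N (.coarse b')} {o : ℤ} {R : ℕ} {U : X.Ω ≃⋆ₐ[ℂ] Y.Ω}

/-- The output origin `o - 2 * R` absorbs the radius: in indices, the cone spreads to the right
only, by `R`. -/
theorem nbhd_vset_subset [NeZero N] {G : ZMod 2} (ho : (o - 2 * R) % 4 = 2 * G.val) (n k : ℤ) :
    (CyclicGraph.coarse G).nbhd (vset N o (Set.Ico n k)) (2 * R) ⊆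
      vset N (o - 2 * R) (Set.Ico n (k + R)) := by
  rintro x ⟨hx, _, ⟨i, ⟨h1, h2⟩, rfl⟩, hd⟩
  obtain ⟨t, ht, rfl⟩ := circleDist_le_iff.1 hd
  rw [vtx, ← Int.cast_add, intCast_mem_coarse] at hx
  rw [abs_le] at ht
  push_cast at ht
  refine ⟨i + (t + 2 * R) / 4, ⟨by omega, by omega⟩, ?_⟩
  rw [vtx, vtx, ← Int.cast_add]
  congr 1
  omega

theorem ialg_le_pullInt [NeZero N] (ho' : (o - 2 * R) % 4 = 2 * b'.val)
    (ho : o % 4 = 2 * b.val) (hU : FactorPartition.HasCausalityRadius X Y (2 * R) U) (n k : ℤ) :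
    X.ialg o (Set.Ico n k) ≤ pullInt Y U (o - 2 * R) (Set.Ico n (k + R)) := fun a ha =>
  Y.isPartition.mono (nbhd_vset_subset ho' n k) (vset_subset ho' _)
    (hU _ (vset_subset ho _) a ha)

/-- Commutants of the causality relation for the complementary interval, moved by one period. -/
theorem pullInt_le_ialg [NeZero N] (ho' : (o - 2 * R) % 4 = 2 * b'.val)
    (ho : o % 4 = 2 * b.val) (hU : FactorPartition.HasCausalityRadius X Y (2 * R) U) {n k : ℤ}
    (h1 : n ≤ k) (h2 : k ≤ n - R + N) :
    pullInt Y U (o - 2 * R) (Set.Ico n k) ≤ X.ialg o (Set.Ico (n - R) k) := by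
  have h3 := commutant_anti (ialg_le_pullInt ho' ho hU k (n - R + N))
  rw [show n - R + N + R = n + (N : ℤ) by ring, X.commutant_ialg ho h2 (by omega),
    commutant_pullInt ho' (by omega) (by omega)] at h3
  have h4 := pullInt_Ico_shift (Y := Y) (U := U) (o' := o - 2 * R) n k 1
  have h5 := X.ialg_Ico_shift (o := o) (n - R) k 1
  rw [mul_one] at h4 h5
  rwa [h4, h5] at h3

end Causality

theorem condIndep_of_uncorrelated_left {Ω : Type*} [CStarAlgebra Ω] {P D Q : StarSubalgebra ℂ Ω}
    (hDP : D ≤ commutant P) (h : Uncorrelated P (D ⊔ Q)) : CondIndep P D Q := by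
  intro d hd p hp q hq h0
  rw [← le_commutant_iff.1 hDP _ hd.mem _ hp, mul_assoc] at h0
  rcases h p hp (d * q) (mul_mem (StarSubalgebra.mem_sup_left hd.mem)
    (StarSubalgebra.mem_sup_right hq)) h0 with h1 | h1
  · left; rw [h1, mul_zero]
  · right; exact h1

theorem condIndep_of_uncorrelated_right {Ω : Type*} [CStarAlgebra Ω] {P D Q : StarSubalgebra ℂ Ω}
    (hDQ : D ≤ commutant Q) (hPQ : P ≤ commutant Q) (h : Uncorrelated Q (D ⊔ P)) :
    CondIndep P D Q := by
  intro d hd p hp q hq h0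
  rw [← le_commutant_iff.1 (sup_le hDQ hPQ : D ⊔ P ≤ commutant Q) (d * p)
    (mul_mem (StarSubalgebra.mem_sup_left hd.mem) (StarSubalgebra.mem_sup_right hp)) q hq] at h0
  rcases h q hq (d * p) (mul_mem (StarSubalgebra.mem_sup_left hd.mem)
    (StarSubalgebra.mem_sup_right hp)) h0 with h1 | h1
  · right; rw [h1, mul_zero]
  · left; exact h1

/-! ### Cutting all the vertices. -/

namespace FactorPartition

variable {N : ℕ} {b : ZMod 2}

/-- The data for cutting every vertex of a partition in two: `Q m` generates, together with what is
far on the left, the left-hand side of the cut of the vertex `m`. -/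
structure VertexCuts (X : FactorPartition.{u} N (.coarse b)) (o : ℤ) (l w : ℕ)
    (Q : ℤ → StarSubalgebra ℂ X.Ω) : Prop where
  offset : o % 4 = 2 * b.val
  hw : l + 1 ≤ w
  hN : 2 * w + 2 * l + 1 ≤ N
  corr : X.CorrelationLengthLE (4 * l)
  shift : ∀ m t : ℤ, Q (m + N * t) = Q m
  le : ∀ m : ℤ, Q m ≤ X.ialg o (Set.Ico (m - w) (m + 1))

/-- The left-hand side of the cut of the vertex `m`. -/
def leftAlg (X : FactorPartition.{u} N (.coarse b)) (o : ℤ) (l w : ℕ)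
    (Q : ℤ → StarSubalgebra ℂ X.Ω) (m : ℤ) : StarSubalgebra ℂ X.Ω :=
  X.ialg o (Set.Ico (m - w - l) m) ⊔ Q m

/-- A lower bound for the algebra of the arc from the cut `x` to the cut `y`. -/
def hullAlg (X : FactorPartition.{u} N (.coarse b)) (o : ℤ) (l w : ℕ)
    (Q : ℤ → StarSubalgebra ℂ X.Ω) (x y : ℤ) : StarSubalgebra ℂ X.Ω :=
  X.ialg o (Set.Ico (x / 2) ((y + 1) / 2)) ⊓ commutant (if x % 2 = 0 then ⊥ else Q (x / 2)) ⊓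
    (if y % 2 = 0 then ⊤ else X.leftAlg o l w Q (y / 2))

/-- An arc system on a set `S` of cuts that contains the even ones, which extends the arc system of
a partition. -/
structure Refinement (X : FactorPartition.{u} N (.coarse b)) (o : ℤ) (l w : ℕ)
    (Q : ℤ → StarSubalgebra ℂ X.Ω) (S : Set (ZMod (2 * N)))
    (F : ZMod (2 * N) → ZMod (2 * N) → StarSubalgebra ℂ X.Ω)
    (E : ZMod (2 * N) → StarSubalgebra ℂ X.Ω) : Prop where
  sys : ArcSystem S F E
  even_subset : evenCuts N ⊆ S
  arc_even : ∀ x ∈ evenCuts N, ∀ y ∈ evenCuts N, F x y = X.baseArc o x y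
  edge_le_right : ∀ x : ℤ, (x : ZMod (2 * N)) ∈ S → E x ≤ X.ialg o {x / 2}
  edge_le_left : ∀ x : ℤ, (x : ZMod (2 * N)) ∈ S → E x ≤ X.ialg o {(x - 1) / 2}
  hull_le : ∀ x y : ℤ, (x : ZMod (2 * N)) ∈ S → (y : ZMod (2 * N)) ∈ S → x < y →
    (y + 1) / 2 - x / 2 ≤ w + 1 → X.hullAlg o l w Q x y ≤ F x y

variable {X : FactorPartition.{u} N (.coarse b)} {o : ℤ} {l w : ℕ}
  {Q : ℤ → StarSubalgebra ℂ X.Ω}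

theorem ialg_singleton_shift (n t : ℤ) : X.ialg o {n + N * t} = X.ialg o {n} := by
  rw [ialg, ialg, vset, vset, Set.image_singleton, Set.image_singleton, vtx_eq_iff.2 ⟨t, rfl⟩]

theorem ialg_singleton (n : ℤ) : X.ialg o (Set.Ico n (n + 1)) = X.ialg o {n} := by
  congr 1
  ext i
  simp only [Set.mem_Ico, Set.mem_singleton_iff]
  omega

theorem VertexCuts.hullAlg_shift (h : VertexCuts X o l w Q) (x y t : ℤ) :
    X.hullAlg o l w Q (x + 2 * (N * t)) (y + 2 * (N * t)) = X.hullAlg o l w Q x y := by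
  have e1 : (x + 2 * (N * t)) / 2 = x / 2 + N * t := by omega
  have e2 : (y + 2 * (N * t) + 1) / 2 = (y + 1) / 2 + N * t := by omega
  have e3 : (x + 2 * (N * t)) % 2 = x % 2 := by omega
  have e4 : (y + 2 * (N * t)) % 2 = y % 2 := by omega
  have e5 : (y + 2 * (N * t)) / 2 = y / 2 + N * t := by omega
  have e6 : X.leftAlg o l w Q (y / 2 + N * t) = X.leftAlg o l w Q (y / 2) := by
    rw [leftAlg, leftAlg, h.shift, show y / 2 + N * t - w - l = y / 2 - w - l + N * t by ring,
      X.ialg_Ico_shift]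
  rw [hullAlg, hullAlg, e1, e2, e3, e4, e5, e6, X.ialg_Ico_shift, h.shift]

theorem VertexCuts.refinement_base (h : VertexCuts X o l w Q) :
    Refinement X o l w Q (evenCuts N) (X.baseArc o) (X.baseEdge o) := by
  have hN := h.hN
  have hw := h.hw
  have : NeZero N := ⟨by omega⟩
  refine ⟨X.arcSystem_base h.offset, subset_rfl, fun _ _ _ _ => rfl, ?_, ?_, ?_⟩
  · intro x hx
    rw [mem_evenCuts] at hx
    obtain ⟨n, rfl⟩ : ∃ n, x = 2 * n := ⟨x / 2, by omega⟩
    rw [X.baseEdge_eq, show 2 * n / 2 = n by omega]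
    exact X.cutAlg_le_right n
  · intro x hx
    rw [mem_evenCuts] at hx
    obtain ⟨n, rfl⟩ : ∃ n, x = 2 * n := ⟨x / 2, by omega⟩
    rw [X.baseEdge_eq, show (2 * n - 1) / 2 = n - 1 by omega]
    exact X.cutAlg_le_left n
  · intro x y hx hy hxy hle
    rw [mem_evenCuts] at hx hy
    obtain ⟨n, rfl⟩ : ∃ n, x = 2 * n := ⟨x / 2, by omega⟩
    obtain ⟨k, rfl⟩ : ∃ n, y = 2 * n := ⟨y / 2, by omega⟩
    rw [X.baseArc_eq (by omega) (by omega)]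
    refine inf_le_left.trans (inf_le_left.trans ?_)
    rw [show 2 * n / 2 = n by omega, show (2 * k + 1) / 2 = k by omega]

theorem intCast_two_mul_add (x t : ℤ) :
    ((x + 2 * (N * t) : ℤ) : ZMod (2 * N)) = (x : ZMod (2 * N)) := by
  rw [ZMod.intCast_eq_intCast_iff_dvd_sub]
  exact ⟨-t, by push_cast; ring⟩

variable {S : Set (ZMod (2 * N))} {F : ZMod (2 * N) → ZMod (2 * N) → StarSubalgebra ℂ X.Ω}
  {E : ZMod (2 * N) → StarSubalgebra ℂ X.Ω}

theorem Refinement.arc_eq [NeZero N] (h : Refinement X o l w Q S F E) {n k : ℤ} (h1 : n < k)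
    (h2 : k < n + N) :
    F ((2 * n : ℤ) : ZMod (2 * N)) ((2 * k : ℤ) : ZMod (2 * N)) = X.ialg o (Set.Ico n k) := by
  rw [h.arc_even _ ⟨n, rfl⟩ _ ⟨k, rfl⟩, X.baseArc_eq h1 h2]

theorem VertexCuts.uncorrelated_edge [NeZero N] (hv : VertexCuts X o l w Q) {x y z : ℤ}
    {i j k : ℤ}
    (hx : E x ≤ X.ialg o {i}) (hy : E y ≤ X.ialg o {j}) (hz : E z ≤ X.ialg o {k})
    (hij : l < |i - j| ∧ |i - j| < N - l) (hik : l < |i - k| ∧ |i - k| < N - l) :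
    Uncorrelated (E x) (E y ⊔ E z) := by
  refine uncorrelated_mono (X.uncorrelated_ialg hv.offset hv.corr (I := {i}) (J := {j, k}) ?_) hx
    (sup_le (hy.trans (X.ialg_mono hv.offset (by simp))) (hz.trans (X.ialg_mono hv.offset
      (by simp))))
  rintro _ rfl _ (rfl | rfl)
  · exact hij
  · exact hik

theorem Refinement.edge_comm_edge (h : Refinement X o l w Q S F E) {x y : ℤ}
    (hx : (x : ZMod (2 * N)) ∈ S) (hy : (y : ZMod (2 * N)) ∈ S)
    (hxy : x ≠ y ∧ x < y + 2 * N ∧ y < x + 2 * N) : E x ≤ commutant (E y) := by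
  have h1 : E x ≤ centre (F x y) ∧ E y ≤ centre (F x y) := by
    rw [h.sys.centre_eq hx hy (by push_cast; omega)]
    exact ⟨le_sup_left, le_sup_right⟩
  exact (h1.1.trans (centre_le_commutant _)).trans (commutant_anti (h1.2.trans (centre_le _)))

theorem Refinement.edge_comm_self (h : Refinement X o l w Q S F E) (hN : 2 ≤ N) {x : ℤ}
    (hx : (x : ZMod (2 * N)) ∈ S) : E x ≤ commutant (E x) := by
  have h1 : ((2 * (x / 2 + 1) : ℤ) : ZMod (2 * N)) ∈ S := h.even_subset ⟨_, rfl⟩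
  exact h.sys.edge_abelian hx h1 (intCast_zmod_ne (by omega) (by push_cast; omega)
    (by push_cast; omega))

theorem Refinement.edge_comm_edge' (h : Refinement X o l w Q S F E) (hN : 2 ≤ N) {x y : ℤ}
    (hx : (x : ZMod (2 * N)) ∈ S) (hy : (y : ZMod (2 * N)) ∈ S)
    (hxy : x < y + 2 * N ∧ y < x + 2 * N) : E x ≤ commutant (E y) := by
  by_cases he : x = y
  · subst he
    exact h.edge_comm_self hN hx
  · exact h.edge_comm_edge hx hy ⟨he, hxy⟩

/-- The points around vertex `m` are spaced by the correlation length: `v` lies `l` vertices after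
the end `b` of the vertex, `q` is where the interval containing `Q m` begins, and `z` lies `l`
vertices before `q`, all read modulo a period. An edge algebra may be placed in the vertex on either
side of its cut, which supplies the missing unit of distance. -/
theorem Refinement.cutData (h : Refinement X o l w Q S F E) (hv : VertexCuts X o l w Q) {m : ℤ}
    (hm : ((2 * m + 1 : ℤ) : ZMod (2 * N)) ∉ S) :
    CutData S F E (Q m) (2 * m + 1) (2 * (m + 1)) (2 * (m + 1 + l)) (2 * (m + N - w - l))
      (2 * (m + N - w)) (2 * (m + N)) := by
  have hN := hv.hN
  have hw := hv.hw
  have : NeZero N := ⟨by omega⟩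
  have : NeZero (2 * N) := ⟨by omega⟩
  have mem : ∀ n : ℤ, ((2 * n : ℤ) : ZMod (2 * N)) ∈ S := fun n => h.even_subset ⟨n, rfl⟩
  have er : ∀ n : ℤ, E ((2 * n : ℤ) : ZMod (2 * N)) ≤ X.ialg o {n} := fun n => by
    have := h.edge_le_right (2 * n) (mem n)
    rwa [show 2 * n / 2 = n by omega] at this
  have el : ∀ n : ℤ, E ((2 * n : ℤ) : ZMod (2 * N)) ≤ X.ialg o {n - 1} := fun n => by
    have := h.edge_le_left (2 * n) (mem n)
    rwa [show (2 * n - 1) / 2 = n - 1 by omega] at this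
  have sh : ∀ n : ℤ, X.ialg o {n + N} = X.ialg o {n} := fun n => by
    have := ialg_singleton_shift (X := X) (o := o) n 1
    rwa [mul_one] at this
  have hshift : ∀ n : ℤ, ((2 * (n + N) : ℤ) : ZMod (2 * N)) = ((2 * n : ℤ) : ZMod (2 * N)) := by
    intro n
    rw [← intCast_two_mul_add (2 * n) 1]
    congr 1
    ring
  refine ⟨h.sys, by omega, by omega, by omega, by omega, by omega, by push_cast; omega, mem _,
    mem _, mem _, mem _, mem _, ?_, ?_, ?_, ?_, ?_, ?_⟩
  · intro x hx
    obtain ⟨i, h1, h2, rfl⟩ := exists_intCast_zmod (2 * m + 1) x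
    have h3 : i ≠ 2 * m + 1 := fun he => hm (he ▸ hx)
    push_cast at h2
    exact ⟨i, by omega, by omega, rfl⟩
  · rw [show m + N - w = m - w + (N : ℤ) by ring, hshift, h.arc_eq (by omega) (by omega)]
    exact hv.le m
  · intro x hx h1 h2
    have hxl := h.edge_le_left x hx
    have hzx := h.edge_comm_edge' (by omega) hx (mem (m + N - w - l)) (by omega)
    have hqz := h.edge_comm_edge' (by omega) (mem (m + N - w - l)) (mem (m + N - w)) (by omega)
    have hxq := h.edge_comm_edge' (by omega) hx (mem (m + N - w)) (by omega)
    -- Either `x` is far from `z`, so that `E z` is uncorrelated with the rest, or `x` is close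
    -- enough to `z` to be far from `q` also the other way round.
    by_cases hc : (x - 1) / 2 ≤ m + N - w - 2 * l - 2
    · refine condIndep_of_uncorrelated_left hzx ?_
      have hq := er (m + N - w)
      rw [show m + N - w = m - w + (N : ℤ) by ring, sh] at hq
      rw [show m - w + (N : ℤ) = m + N - w by ring] at hq
      refine hv.uncorrelated_edge (el _) hxl hq ?_ ?_ <;> rw [lt_abs, abs_lt] <;> omega
    · refine condIndep_of_uncorrelated_right hxq hqz ?_
      refine hv.uncorrelated_edge (er _) hxl (el _) ?_ ?_ <;> rw [lt_abs, abs_lt] <;> omega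
  · intro x hx h1 h2
    have hxr := h.edge_le_right x hx
    have hzx := h.edge_comm_edge' (by omega) hx (mem (m + N - w - l)) (by omega)
    have hvz := h.edge_comm_edge' (by omega) (mem (m + N - w - l)) (mem (m + 1 + l)) (by omega)
    have hxv := h.edge_comm_edge' (by omega) hx (mem (m + 1 + l)) (by omega)
    -- The same alternative on the other side: `E z` or `E v` is uncorrelated with the two other
    -- algebras.
    by_cases hc : m + N - w + 1 ≤ x / 2
    · refine condIndep_of_uncorrelated_left hzx ?_
      have hq := el (m + 1 + l)
      rw [← sh] at hq
      refine hv.uncorrelated_edge (er _) hxr hq ?_ ?_ <;> rw [lt_abs, abs_lt] <;> omega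
    · refine condIndep_of_uncorrelated_right hxv hvz ?_
      refine hv.uncorrelated_edge (el _) hxr (er _) ?_ ?_ <;> rw [lt_abs, abs_lt] <;> omega
  · have h1 := h.edge_comm_edge' (by omega) (mem (m + N - w - l)) (mem (m + 1)) (by omega)
    have h2 := h.edge_comm_edge' (by omega) (mem (m + 1 + l)) (mem (m + 1)) (by omega)
    refine condIndep_of_uncorrelated_right h1 h2 ?_
    refine hv.uncorrelated_edge (el _) (er _) (er _) ?_ ?_ <;> rw [lt_abs, abs_lt] <;> omega
  · rw [hshift, h.arc_eq (by omega) (by omega)]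
    refine uncorrelated_mono (X.uncorrelated_ialg hv.offset hv.corr (I := {m + N - w - l})
      (J := Set.Ico m (m + 1)) ?_) (er _) le_rfl
    rintro _ rfl j ⟨h1, h2⟩
    rw [lt_abs, abs_lt]
    omega

/-- The hull bound survives insertion: an arc ending in the new cut is first extended over the whole
vertex `m`, where the bound is known, and the condition involving `Q m` is then imposed by
`fwd_le_arc` or `bwd_le_arc`. -/
theorem Refinement.insert (h : Refinement X o l w Q S F E) (hv : VertexCuts X o l w Q) {m : ℤ}
    (hm : ((2 * m + 1 : ℤ) : ZMod (2 * N)) ∉ S) :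
    ∃ F' E', Refinement X o l w Q (insert ((2 * m + 1 : ℤ) : ZMod (2 * N)) S) F' E' := by
  have hN := hv.hN
  have hw := hv.hw
  have : NeZero N := ⟨by omega⟩
  have : NeZero (2 * N) := ⟨by omega⟩
  have hd := h.cutData hv hm
  have mem : ∀ n : ℤ, ((2 * n : ℤ) : ZMod (2 * N)) ∈ S := fun n => h.even_subset ⟨n, rfl⟩
  have hshift : ∀ n : ℤ, ((2 * (n + N) : ℤ) : ZMod (2 * N)) = ((2 * n : ℤ) : ZMod (2 * N)) := by
    intro n
    rw [← intCast_two_mul_add (2 * n) 1]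
    congr 1
    ring
  have hcut : hd.edgeCut ≤ X.ialg o {m} := by
    refine hd.edgeCut_le.trans ?_
    rw [hshift, h.arc_eq (by omega) (by omega), ialg_singleton]
  have hper : ∀ x : ℤ, (x : ZMod (2 * N)) = ((2 * m + 1 : ℤ) : ZMod (2 * N)) →
      ∃ t : ℤ, x = 2 * m + 1 + 2 * (N * t) := by
    intro x hx
    rw [ZMod.intCast_eq_intCast_iff_dvd_sub] at hx
    obtain ⟨t, ht⟩ := hx
    push_cast at ht
    exact ⟨-t, by linarith⟩
  refine ⟨hd.arc, hd.edge, hd.arcSystem X.factor, h.even_subset.trans (Set.subset_insert _ _),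
    ?_, ?_, ?_, ?_⟩
  · intro x hx y hy
    rw [hd.arc_of_mem (h.even_subset hx) (h.even_subset hy), h.arc_even _ hx _ hy]
  · rintro x (hx | hx)
    · rw [hx, hd.edge_self]
      obtain ⟨t, rfl⟩ := hper x hx
      rw [show (2 * m + 1 + 2 * (N * t)) / 2 = m + N * t by omega, ialg_singleton_shift]
      exact hcut
    · rw [hd.edge_of_mem hx]
      exact h.edge_le_right x hx
  · rintro x (hx | hx)
    · rw [hx, hd.edge_self]
      obtain ⟨t, rfl⟩ := hper x hx
      rw [show (2 * m + 1 + 2 * (N * t) - 1) / 2 = m + N * t by omega, ialg_singleton_shift]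
      exact hcut
    · rw [hd.edge_of_mem hx]
      exact h.edge_le_left x hx
  · rintro x y (hx | hx) (hy | hy) hxy hle
    -- Two distinct representatives of the same cut differ by at least one period, too much for a
    -- hull of length at most `w + 1`.
    · obtain ⟨t, rfl⟩ := hper x hx
      obtain ⟨s, rfl⟩ := hper y hy
      have h1 : (N : ℤ) * t < N * s := by omega
      have h2 : t < s := lt_of_mul_lt_mul_left h1 (by omega)
      have h3 : (N : ℤ) * (t + 1) ≤ N * s := mul_le_mul_of_nonneg_left (by omega) (by omega)
      rw [mul_add, mul_one] at h3
      omega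
    · obtain ⟨t, rfl⟩ := hper x hx
      obtain ⟨y, rfl⟩ : ∃ y', y = y' + 2 * (N * t) := ⟨y - 2 * (N * t), by ring⟩
      rw [hv.hullAlg_shift, intCast_two_mul_add, intCast_two_mul_add]
      rw [intCast_two_mul_add] at hy
      refine le_trans ?_ (hd.fwd_le_arc (x := y) ?_ (by omega))
      · refine le_inf ?_ ?_
        · rw [hshift]
          refine le_trans ?_ (h.hull_le (2 * m) y (mem m) hy ?_ (by omega))
          · rw [hullAlg, hullAlg, show (2 * m + 1) / 2 = m by omega, show 2 * m / 2 = m by omega,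
              if_pos (show 2 * m % 2 = 0 by omega)]
            exact inf_le_inf_right _ (inf_le_inf_left _ (le_commutant_comm.1 bot_le))
          · omega
        · refine inf_le_left.trans (inf_le_right.trans ?_)
          rw [if_neg (by omega), show (2 * m + 1) / 2 = m by omega]
      · have : y ≠ 2 * m + 1 := fun he => hm (he ▸ hy)
        omega
    · obtain ⟨t, rfl⟩ := hper y hy
      obtain ⟨x, rfl⟩ : ∃ x', x = x' + 2 * (N * t) := ⟨x - 2 * (N * t), by ring⟩
      rw [hv.hullAlg_shift, intCast_two_mul_add, intCast_two_mul_add]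
      rw [intCast_two_mul_add] at hx
      have hx' := intCast_two_mul_add (N := N) x 1
      rw [mul_one] at hx'
      -- One period is added because the window of the cut data starts just after the cut, so what
      -- precedes the cut appears at its end.
      have h1 := hd.bwd_le_arc X.factor (x := x + 2 * N) (by rw [hx']; exact hx) (by omega)
        (by omega)
      rw [hx'] at h1
      refine le_trans ?_ h1
      have e1 : F ((2 * (m + N - w - l) : ℤ) : ZMod (2 * N)) ((2 * (m + N) : ℤ) : ZMod (2 * N)) =
          X.ialg o (Set.Ico (m - w - l) m) := by
        rw [show m + N - w - l = m - w - l + (N : ℤ) by ring, hshift, hshift,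
          h.arc_eq (by omega) (by omega)]
      rw [e1]
      refine le_inf ?_ ?_
      · refine le_trans ?_ (h.hull_le x (2 * (m + 1)) hx (mem _) (by omega) (by omega))
        rw [hullAlg, hullAlg, show (2 * m + 1 + 1) / 2 = m + 1 by omega,
          show (2 * (m + 1) + 1) / 2 = m + 1 by omega, if_pos (show 2 * (m + 1) % 2 = 0 by omega)]
        exact inf_le_inf_left _ le_top
      · refine inf_le_right.trans ?_
        rw [if_neg (by omega), show (2 * m + 1) / 2 = m by omega, leftAlg]
    · rw [hd.arc_of_mem hx hy]
      exact h.hull_le x y hx hy hxy hle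

theorem VertexCuts.exists_refinement (hv : VertexCuts X o l w Q) :
    ∃ F E, Refinement X o l w Q Set.univ F E := by
  classical
  have hN := hv.hN
  have : NeZero N := ⟨by omega⟩
  have : NeZero (2 * N) := ⟨by omega⟩
  have key : ∀ s : Finset (ZMod (2 * N)), ∃ F E, Refinement X o l w Q (evenCuts N ∪ s) F E := by
    intro s
    induction s using Finset.induction_on with
    | empty => exact ⟨_, _, by simpa using hv.refinement_base⟩
    | insert c s hc ih =>
      obtain ⟨F, E, h⟩ := ih
      have he : evenCuts N ∪ ((insert c s : Finset _) : Set (ZMod (2 * N))) =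
          Insert.insert c (evenCuts N ∪ (s : Set (ZMod (2 * N)))) := by
        rw [Finset.coe_insert, Set.union_insert]
      rw [he]
      by_cases hmem : c ∈ evenCuts N ∪ (s : Set (ZMod (2 * N)))
      · rw [Set.insert_eq_of_mem hmem]
        exact ⟨F, E, h⟩
      · obtain ⟨i, -, -, rfl⟩ := exists_intCast_zmod 0 c
        have hodd : i % 2 ≠ 0 := fun h0 => hmem (Or.inl (mem_evenCuts.2 h0))
        obtain ⟨m, rfl⟩ : ∃ m, i = 2 * m + 1 := ⟨i / 2, by omega⟩
        exact h.insert hv hmem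
  obtain ⟨F, E, h⟩ := key Finset.univ
  rw [Finset.coe_univ, Set.union_univ] at h
  exact ⟨F, E, h⟩

end FactorPartition

set_option linter.unusedSectionVars false

/-! ### Grouping sites into vertices. -/

section Cells

variable {Ω : Type*} [CStarAlgebra Ω] {M N : ℕ}

/-- The sites of an arc. -/
def siteArc (M : ℕ) (x y : ℤ) : Set (ZMod M) := {j | ∃ i : ℤ, x ≤ i ∧ i < y ∧ j = i}

namespace ArcSystem

variable {F : ZMod M → ZMod M → StarSubalgebra ℂ Ω} {E : ZMod M → StarSubalgebra ℂ Ω}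
  [FiniteDimensional ℂ Ω] [Nontrivial Ω]

theorem commutant_setAlg (h : ArcSystem Set.univ F E) (hfac : Subalgebra.center ℂ Ω = ⊥)
    (hM : 2 ≤ M) (S : Set (ZMod M)) : commutant (setAlg F S) = setAlg F Sᶜ := by
  have : NeZero M := ⟨by omega⟩
  apply le_antisymm
  · have h1 := h.inf_setAlg_le hfac hM (disjoint_compl_right (a := S))
    rw [Set.union_compl_self, setAlg_univ, inf_top_eq] at h1
    exact h1.trans (sup_le le_rfl ((centre_top_le hfac).trans bot_le))
  · rw [le_commutant_comm]
    exact h.setAlg_le_commutant disjoint_compl_right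

theorem setAlg_siteArc (h : ArcSystem Set.univ F E) (hfac : Subalgebra.center ℂ Ω = ⊥)
    (hM : 2 ≤ M) {x y : ℤ} (h1 : x < y) (h2 : y < x + M) : setAlg F (siteArc M x y) = F x y := by
  have m := fun i : ℤ => Set.mem_univ (i : ZMod M)
  apply le_antisymm
  · have h3 : F y (x + M : ℤ) ≤ setAlg F (siteArc M x y)ᶜ := by
      refine le_setAlg F h2 (by omega) fun i hi hi' => ?_
      rintro ⟨j, hj, hj', he⟩
      exact intCast_zmod_ne (by omega) (by omega) (by omega) he
    rw [← h.commutant_setAlg hfac hM, le_commutant_comm] at h3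
    have h4 := h.commutant_eq (m y) (m (x + M)) (by omega)
    rw [h4] at h3
    simpa using h3
  · exact le_setAlg F h1 h2 fun i hi hi' => ⟨i, hi, hi', rfl⟩

/-- A distant cut `t` separates the two sides: the first algebra lies in the arc from `t` to `x`,
the second in its complement, so the intersection lies in a centre `E x ⊔ E t`. Uncorrelatedness
removes `E t`. -/
theorem inf_edges_le (h : ArcSystem Set.univ F E) {x t s : ℤ} (hs : 0 < s)
    (h1 : x + s ≤ t) (h2 : t ≤ x - s + M) (hun : Uncorrelated (E t) (E x ⊔ E (x + s : ℤ))) :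
    (E (x - s : ℤ) ⊔ E x) ⊓ (E x ⊔ E (x + s : ℤ)) ≤ E x := by
  have m := fun i : ℤ => Set.mem_univ (i : ZMod M)
  have hxt : (x : ZMod M) ≠ t := intCast_zmod_ne (by omega) (by omega) (by omega)
  have hcen := h.cen _ (m x) _ (m t) hxt
  have e1 : E x ⊔ E (x + s : ℤ) ≤ F x t :=
    sup_le (h.edge (m _) (m _) (m _) (by omega)) (h.edge (m _) (m _) (m _) (by omega))
  have e2 : E (x - s : ℤ) ⊔ E x ≤ F t x := by
    have h3 : (((x - s) + M : ℤ) : ZMod M) = ((x - s : ℤ) : ZMod M) := by simp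
    rw [← h3]
    exact sup_le (h.edge (m _) (m _) (m _) (by omega)) (h.edge (m _) (m _) (m _) (by omega))
  have hab : E t ≤ commutant (E t) := h.edge_abelian (m t) (m x) hxt.symm
  have hEt : E t ≤ commutant (F x t) :=
    (le_sup_right.trans hcen.ge).trans (centre_le_commutant _)
  have hle : (E (x - s : ℤ) ⊔ E x) ⊓ (E x ⊔ E (x + s : ℤ)) ≤ E x ⊔ E t := by
    rw [← hcen, centre, h.dual _ (m x) _ (m t) hxt, inf_comm]
    exact inf_le_inf e1 e2
  refine (le_inf inf_le_right hle).trans ?_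
  exact inf_sup_le_of_supportsIn (D := ⊥) le_sup_left hab
    (e1.trans (le_commutant_comm.1 hEt)) bot_le (bot_le_commutant _)
    (supportsIn_bot_of_uncorrelated hun)

end ArcSystem

/-- The point with index `n` of a regular subset of the circle, with origin `o` and spacing
`2 * s`. -/
def gridPos (N : ℕ) (o s n : ℤ) : Pos N := ((o + 2 * s * n : ℤ) : Pos N)

theorem vtx_eq_gridPos (o n : ℤ) : vtx N o n = gridPos N o 2 n := by
  rw [vtx, gridPos]
  congr 1

/-- The point of the grid in whose cell a site lies; the cell of the point with index `n` consists
of the `s` sites starting with `x₀ + s * n`. -/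
def cell (N : ℕ) (o s x₀ : ℤ) (j : ZMod (2 * N)) : Pos N := gridPos N o s ((j.val - x₀) / s)

theorem cell_intCast [NeZero N] (o : ℤ) {s : ℤ} (hs : s = 1 ∨ s = 2) (x₀ i : ℤ) :
    cell N o s x₀ (i : ZMod (2 * N)) = gridPos N o s ((i - x₀) / s) := by
  have : NeZero (2 * N) := ⟨by have := NeZero.ne N; omega⟩
  have h3 : (((i : ZMod (2 * N)).val : ℕ) : ℤ) = i - 2 * (N * (i / (2 * N : ℕ))) := by
    rw [ZMod.val_intCast, Int.emod_def]; push_cast; ring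
  rw [cell, h3, gridPos, gridPos, intCast_pos_eq_iff]
  refine ⟨-(i / (2 * N : ℕ)), ?_⟩
  rw [mul_neg]
  rcases hs with rfl | rfl <;> omega

theorem preimage_cell [NeZero N] (o : ℤ) {s : ℤ} (hs : s = 1 ∨ s = 2) (x₀ n k : ℤ) :
    cell N o s x₀ ⁻¹' (gridPos N o s '' Set.Ico n k) =
      siteArc (2 * N) (x₀ + s * n) (x₀ + s * k) := by
  have : NeZero (2 * N) := ⟨by have := NeZero.ne N; omega⟩
  ext j
  obtain ⟨i, -, -, rfl⟩ := exists_intCast_zmod 0 j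
  rw [Set.mem_preimage, cell_intCast o hs]
  constructor
  · rintro ⟨n', ⟨h1, h2⟩, h3⟩
    rw [gridPos, gridPos, intCast_pos_eq_iff] at h3
    obtain ⟨t, ht⟩ := h3
    refine ⟨i + 2 * (N * t), ?_, ?_, ?_⟩
    · rcases hs with rfl | rfl <;> omega
    · rcases hs with rfl | rfl <;> omega
    · rw [FactorPartition.intCast_two_mul_add]
  · rintro ⟨i', h1, h2, h3⟩
    rw [← cell_intCast o hs, h3, cell_intCast o hs]
    refine ⟨_, ⟨?_, ?_⟩, rfl⟩
    · rcases hs with rfl | rfl <;> omega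
    · rcases hs with rfl | rfl <;> omega

theorem gridPos_period (o : ℤ) {s : ℤ} (hs : s = 1 ∨ s = 2) (n₀ n : ℤ) [NeZero N] :
    ∃ k : ℤ, n₀ ≤ k ∧ s * (k + 1 - n₀) ≤ 2 * N ∧ gridPos N o s n = gridPos N o s k := by
  have hN : 0 < N := NeZero.pos N
  have key : ∀ P : ℤ, 0 < P → 2 * s * P = 4 * N →
      ∃ k : ℤ, n₀ ≤ k ∧ k < n₀ + P ∧ gridPos N o s n = gridPos N o s k := by
    intro P hP hPs
    refine ⟨n₀ + (n - n₀) % P, ?_, ?_, ?_⟩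
    · have := Int.emod_nonneg (n - n₀) hP.ne'; omega
    · have := Int.emod_lt_of_pos (n - n₀) hP; omega
    · rw [gridPos, gridPos, intCast_pos_eq_iff]
      refine ⟨(n - n₀) / P, ?_⟩
      have := Int.emod_add_mul_ediv (n - n₀) P
      linear_combination (-2 * s) * this + ((n - n₀) / P) * hPs
  rcases hs with rfl | rfl
  · obtain ⟨k, h1, h2, h3⟩ := key (2 * N) (by omega) (by ring)
    exact ⟨k, h1, by omega, h3⟩
  · obtain ⟨k, h1, h2, h3⟩ := key N (by omega) (by ring)
    exact ⟨k, h1, by omega, h3⟩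

/-- Centres of intervals are generated by the edges at their ends; `hsc` says that the centres of
adjacent cells meet exactly in the edge that they share. -/
theorem ArcSystem.isStronglyConnected_setAlg [FiniteDimensional ℂ Ω] [Nontrivial Ω] [NeZero N]
    {F : ZMod (2 * N) → ZMod (2 * N) → StarSubalgebra ℂ Ω}
    {E : ZMod (2 * N) → StarSubalgebra ℂ Ω} (h : ArcSystem Set.univ F E)
    (hfac : Subalgebra.center ℂ Ω = ⊥) (hN : 2 ≤ N) (G : CyclicGraph) {o s x₀ : ℤ}
    (hs : s = 1 ∨ s = 2) (hstep : (G.step : ℤ) = 2 * s)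
    (hverts : ∀ x ∈ G.verts N, ∃ n, x = gridPos N o s n)
    (hsub : ∀ n, gridPos N o s n ∈ G.verts N)
    (hsc : ∀ n : ℤ, (E (x₀ + s * n - s : ℤ) ⊔ E (x₀ + s * n : ℤ)) ⊓
      (E (x₀ + s * n : ℤ) ⊔ E (x₀ + s * n + s : ℤ)) ≤ E (x₀ + s * n : ℤ)) :
    IsStronglyConnected G (fun S => setAlg F (cell N o s x₀ ⁻¹' S)) := by
  intro x hx k hk
  obtain ⟨n, rfl⟩ := hverts x hx
  have m := fun i : ℤ => Set.mem_univ (i : ZMod (2 * N))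
  have hsucc : ∀ j : ℕ, G.succ (gridPos N o s n) j = gridPos N o s (n + j) := by
    intro j
    have : ((G.step : ℤ) : Pos N) = ((2 * s : ℤ) : Pos N) := by rw [hstep]
    rw [CyclicGraph.succ, gridPos, gridPos]
    push_cast at this ⊢
    rw [this]
    ring
  have hpred : G.pred (gridPos N o s n) = gridPos N o s (n - 1) := by
    have : ((G.step : ℤ) : Pos N) = ((2 * s : ℤ) : Pos N) := by rw [hstep]
    rw [CyclicGraph.pred, gridPos, gridPos]
    push_cast at this ⊢
    rw [this]
    ring
  have hinter : G.interval (gridPos N o s n) k = gridPos N o s '' Set.Ico n (n + k + 1) := by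
    ext y
    constructor
    · rintro ⟨j, hj, rfl⟩
      exact ⟨n + j, ⟨by omega, by omega⟩, (hsucc j).symm⟩
    · rintro ⟨i, ⟨h1, h2⟩, rfl⟩
      refine ⟨(i - n).toNat, by omega, ?_⟩
      rw [hsucc]
      congr 1
      omega
  have hsmall : s * (k + 1) < 2 * N := by
    by_contra hlt
    apply hk
    rw [hinter]
    ext y
    constructor
    · rintro ⟨i, -, rfl⟩
      exact hsub i
    · intro hy
      obtain ⟨n', rfl⟩ := hverts y hy
      obtain ⟨i, h1, h2, h3⟩ := gridPos_period (N := N) o hs n n'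
      refine ⟨i, ⟨h1, ?_⟩, h3.symm⟩
      rcases hs with rfl | rfl <;> omega
  have hcell : ∀ i j : ℤ, i < j → s * (j - i) < 2 * N →
      centre (setAlg F (cell N o s x₀ ⁻¹' (gridPos N o s '' Set.Ico i j))) =
        E (x₀ + s * i : ℤ) ⊔ E (x₀ + s * j : ℤ) := by
    intro i j hij hlt
    have h1 : x₀ + s * i < x₀ + s * j := by rcases hs with rfl | rfl <;> omega
    have h2 : x₀ + s * j < x₀ + s * i + (2 * N : ℕ) := by
      push_cast
      rcases hs with rfl | rfl <;> omega
    rw [preimage_cell o hs, h.setAlg_siteArc hfac (by omega) h1 h2, h.centre_eq (m _) (m _)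
      (by omega)]
  have hsingle : ∀ i : ℤ, centre (setAlg F (cell N o s x₀ ⁻¹' {gridPos N o s i})) =
      E (x₀ + s * i : ℤ) ⊔ E (x₀ + s * (i + 1) : ℤ) := by
    intro i
    rw [← hcell i (i + 1) (by omega) (by rcases hs with rfl | rfl <;> omega)]
    congr 3
    rw [← Set.image_singleton]
    congr 1
    ext t
    simp only [Set.mem_Ico, Set.mem_singleton_iff]
    omega
  have hmid : ∀ i : ℤ, (E (x₀ + s * (i - 1) : ℤ) ⊔ E (x₀ + s * (i - 1 + 1) : ℤ)) ⊓
      (E (x₀ + s * i : ℤ) ⊔ E (x₀ + s * (i + 1) : ℤ)) = E (x₀ + s * i : ℤ) := by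
    intro i
    have h1 := hsc i
    rw [show x₀ + s * (i - 1) = x₀ + s * i - s by ring, show i - 1 + 1 = i by ring,
      show x₀ + s * (i + 1) = x₀ + s * i + s by ring]
    exact le_antisymm h1 (le_inf le_sup_right le_sup_left)
  beta_reduce
  rw [hinter, hpred, hsucc, hsucc, hcell _ _ (by omega) (by
    rw [show n + k + 1 - n = (k : ℤ) + 1 by ring]; exact hsmall), hsingle, hsingle, hsingle,
    hsingle, hmid, show n + ((k + 1 : ℕ) : ℤ) = n + k + 1 by push_cast; ring]
  congr 1
  have h1 := hmid (n + k + 1)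
  rw [show n + (k : ℤ) + 1 - 1 = n + k by ring] at h1
  exact h1.symm

end Cells

/-- Both families exchange complements and commutants, so the inclusion for the complementary set is
the reverse inclusion. -/
theorem ArcSystem.setAlg_eq_of_le {Ω : Type*} [CStarAlgebra Ω] [FiniteDimensional ℂ Ω]
    [Nontrivial Ω] {M : ℕ} {F : ZMod M → ZMod M → StarSubalgebra ℂ Ω}
    {E : ZMod M → StarSubalgebra ℂ Ω} (h : ArcSystem Set.univ F E)
    (hfac : Subalgebra.center ℂ Ω = ⊥) (hM : 2 ≤ M) {P : Type*} {V : Set P} {f : ZMod M → P}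
    (hf : ∀ j, f j ∈ V) {A : Set P → StarSubalgebra ℂ Ω}
    (hA : ∀ S ⊆ V, commutant (A S) = A (V \ S)) (hle : ∀ S ⊆ V, setAlg F (f ⁻¹' S) ≤ A S)
    {S : Set P} (hS : S ⊆ V) : setAlg F (f ⁻¹' S) = A S := by
  refine le_antisymm (hle S hS) ?_
  have h1 := hA (V \ S) Set.sdiff_subset
  rw [Set.sdiff_sdiff_cancel_left hS] at h1
  have h2 := commutant_anti (hle (V \ S) Set.sdiff_subset)
  rw [h1, h.commutant_setAlg hfac hM] at h2
  refine h2.trans (setAlg_mono F fun j hj => ?_)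
  by_contra hn
  exact hj ⟨hf j, hn⟩

/-! ### The fine and the shifted partition. -/

namespace FactorPartition

variable {N : ℕ} {b : ZMod 2} {X : FactorPartition.{u} N (.coarse b)} {o : ℤ} {l w : ℕ}
  {Q : ℤ → StarSubalgebra ℂ X.Ω} {F : ZMod (2 * N) → ZMod (2 * N) → StarSubalgebra ℂ X.Ω}
  {E : ZMod (2 * N) → StarSubalgebra ℂ X.Ω}

theorem Refinement.inf_edges_le (h : Refinement X o l w Q Set.univ F E)
    (hv : VertexCuts X o l w Q) {s : ℤ} (hs : s = 1 ∨ s = 2) (x : ℤ) :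
    (E (x - s : ℤ) ⊔ E x) ⊓ (E x ⊔ E (x + s : ℤ)) ≤ E x := by
  have hN := hv.hN
  have hw := hv.hw
  have : NeZero N := ⟨by omega⟩
  have er := fun i : ℤ => h.edge_le_right i (Set.mem_univ _)
  -- Both `x` and `x + s` can be read on the vertices `x / 2` and `x / 2 + 1`, so the vertex `x / 2
  -- + l + 2` is at distance at least `l + 1`.
  refine h.sys.inf_edges_le (t := 2 * (x / 2 + l + 2)) (by omega) (by omega)
    (by push_cast; omega) ?_
  refine hv.uncorrelated_edge (er _) (er _) (er _) ?_ ?_ <;> rw [lt_abs, abs_lt] <;> omega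

theorem val_add_one (b : ZMod 2) : ((b + 1).val : ℤ) = 1 - b.val := by
  revert b; decide

theorem VertexCuts.offset_half (hv : VertexCuts X o l w Q) :
    (o - 2) % 4 = 2 * ((b + 1).val : ℤ) := by
  have := hv.offset
  have h1 := val_add_one b
  have h2 := ZMod.val_lt b
  omega

/-- The partition over the fine graph. -/
noncomputable def Refinement.finePartition (h : Refinement X o l w Q Set.univ F E)
    (hv : VertexCuts X o l w Q) : FactorPartition.{u} N .fine where
  Ω := X.Ω
  factor := X.factor
  -- Site `i` stands at `o - 1 + 2 * i`: sites `2 * n` and `2 * n + 1` are the halves of the vertex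
  -- at `o + 4 * n`.
  alg S := setAlg F (cell N (o - 1) 1 0 ⁻¹' S)
  isPartition := by
    have hN := hv.hN
    have hw := hv.hw
    have ho := hv.offset
    have : NeZero N := ⟨by omega⟩
    refine h.sys.isPartition_setAlg X.factor (by omega) _ fun j => ?_
    rw [cell, gridPos, intCast_mem_fine]
    omega
  stronglyConnected := by
    have hN := hv.hN
    have hw := hv.hw
    have ho := hv.offset
    have : NeZero N := ⟨by omega⟩
    have : NeZero (4 * N) := ⟨by omega⟩
    refine h.sys.isStronglyConnected_setAlg X.factor (by omega) .fine (Or.inl rfl) rfl ?_ ?_ ?_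
    · intro x hx
      obtain ⟨i, -, -, rfl⟩ := exists_intCast_zmod 0 x
      rw [intCast_mem_fine] at hx
      refine ⟨(i - (o - 1)) / 2, ?_⟩
      rw [gridPos]
      congr 1
      omega
    · intro n
      rw [gridPos, intCast_mem_fine]
      omega
    · intro n
      exact h.inf_edges_le hv (Or.inl rfl) _

/-- The partition over the other coarse graph. -/
noncomputable def Refinement.halfPartition (h : Refinement X o l w Q Set.univ F E)
    (hv : VertexCuts X o l w Q) : FactorPartition.{u} N (.coarse (b + 1)) where
  Ω := X.Ω
  factor := X.factor
  -- A cell consists of sites `2 * n - 1` and `2 * n`, on either side of the cut between two old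
  -- vertices; its position is `o - 2 + 4 * n`.
  alg S := setAlg F (cell N (o - 2) 2 (-1) ⁻¹' S)
  isPartition := by
    have hN := hv.hN
    have hw := hv.hw
    have ho := hv.offset_half
    have : NeZero N := ⟨by omega⟩
    refine h.sys.isPartition_setAlg X.factor (by omega) _ fun j => ?_
    rw [cell, ← vtx_eq_gridPos]
    exact vtx_mem ho _
  stronglyConnected := by
    have hN := hv.hN
    have hw := hv.hw
    have ho := hv.offset_half
    have : NeZero N := ⟨by omega⟩
    refine h.sys.isStronglyConnected_setAlg X.factor (by omega) (.coarse (b + 1)) (Or.inr rfl)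
      rfl ?_ ?_ ?_
    · intro x hx
      obtain ⟨n, -, -, rfl⟩ := exists_vtx ho 0 hx
      exact ⟨n, vtx_eq_gridPos _ _⟩
    · intro n
      rw [← vtx_eq_gridPos]
      exact vtx_mem ho _
    · intro n
      exact h.inf_edges_le hv (Or.inr rfl) _

theorem cell_two [NeZero N] (o x₀ i : ℤ) :
    cell N o 2 x₀ (i : ZMod (2 * N)) = vtx N o ((i - x₀) / 2) := by
  rw [cell_intCast o (Or.inr rfl), vtx_eq_gridPos]

theorem Refinement.setAlg_le_alg (h : Refinement X o l w Q Set.univ F E)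
    (hv : VertexCuts X o l w Q) {S : Set (Pos N)} (hS : S ⊆ (CyclicGraph.coarse b).verts N) :
    setAlg F (cell N o 2 0 ⁻¹' S) ≤ X.alg S := by
  have hN := hv.hN
  have hw := hv.hw
  have ho := hv.offset
  have : NeZero N := ⟨by omega⟩
  have m := fun i : ℤ => Set.mem_univ (i : ZMod (2 * N))
  by_cases huniv : (CyclicGraph.coarse b).verts N ⊆ S
  · rw [hS.antisymm huniv, X.isPartition.whole]
    exact le_top
  refine setAlg_le ?_ fun x y h1 h2 h3 => ?_
  · intro he
    apply huniv
    intro p hp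
    obtain ⟨n, -, -, rfl⟩ := exists_vtx ho 0 hp
    have : ((2 * n : ℤ) : ZMod (2 * N)) ∈ cell N o 2 0 ⁻¹' S := by rw [he]; trivial
    rw [Set.mem_preimage, cell_two, show (2 * n - 0) / 2 = n by omega] at this
    exact this
  have hsub : vset N o (Set.Ico (x / 2) ((y + 1) / 2)) ⊆ S := by
    rintro _ ⟨i, ⟨h4, h5⟩, rfl⟩
    have := h3 (max x (2 * i)) (by omega) (by omega)
    rw [Set.mem_preimage, cell_two] at this
    rwa [show (max x (2 * i) - 0) / 2 = i by omega] at this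
  push_cast at h2
  have hlt : (y + 1) / 2 < x / 2 + N := by
    by_contra hge
    apply huniv
    rw [← vset_Ico_full ho (x / 2)]
    exact (Set.image_mono (Set.Ico_subset_Ico_right (by omega))).trans hsub
  -- The arc is rounded outwards to whole vertices, all of which belong to `S`.
  have h4 : F x y ≤ F ((2 * (x / 2) : ℤ) : ZMod (2 * N)) ((2 * ((y + 1) / 2) : ℤ) : ZMod (2 * N)) :=
    h.sys.sub (m _) (m _) (m _) (m _) (by push_cast; omega)
  rw [h.arc_eq (by omega) hlt] at h4
  exact h4.trans (X.isPartition.mono hsub hS)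

theorem Refinement.setAlg_eq_alg (h : Refinement X o l w Q Set.univ F E)
    (hv : VertexCuts X o l w Q) {S : Set (Pos N)} (hS : S ⊆ (CyclicGraph.coarse b).verts N) :
    setAlg F (cell N o 2 0 ⁻¹' S) = X.alg S := by
  have hN := hv.hN
  have hw := hv.hw
  have : NeZero N := ⟨by omega⟩
  refine h.sys.setAlg_eq_of_le X.factor (by omega) (A := X.alg)
    (V := (CyclicGraph.coarse b).verts N) (f := cell N o 2 0) (fun j => ?_)
    (fun S hS => X.isPartition.commutant_eq X.factor hS) (fun S hS => h.setAlg_le_alg hv hS) hS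
  rw [cell, ← vtx_eq_gridPos]
  exact vtx_mem hv.offset _

/-- The fine points at distance 1/4 from a coarse vertex are the two sites of its cell; the
parameter `x₀` covers both coarse graphs at once. -/
theorem preimage_fine_nbhd [NeZero N] {b : ZMod 2} {o o' x₀ : ℤ} (ho : o' % 4 = 2 * b.val)
    (hx₀ : o' = o + 2 * x₀) {S : Set (Pos N)} (hS : S ⊆ (CyclicGraph.coarse b).verts N) :
    cell N (o - 1) 1 0 ⁻¹' (CyclicGraph.fine.nbhd S 1) = cell N o' 2 x₀ ⁻¹' S := by
  have : NeZero (2 * N) := ⟨by have := NeZero.ne N; omega⟩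
  ext j
  obtain ⟨i, -, -, rfl⟩ := exists_intCast_zmod 0 j
  rw [Set.mem_preimage, Set.mem_preimage, cell_two, cell_intCast _ (Or.inl rfl)]
  constructor
  · rintro ⟨-, y, hy, hd⟩
    obtain ⟨n, -, -, rfl⟩ := exists_vtx ho 0 (hS hy)
    obtain ⟨t, ht, he⟩ := circleDist_le_iff.1 hd
    rw [gridPos, vtx, ← Int.cast_add, intCast_pos_eq_iff] at he
    obtain ⟨r, hr⟩ := he
    rw [abs_le] at ht
    push_cast at ht
    rw [vtx_eq_iff.2 (⟨r, by omega⟩ : ∃ r : ℤ, (i - x₀) / 2 = n + N * r)]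
    exact hy
  · intro hy
    refine ⟨?_, _, hy, circleDist_le_iff.2 ⟨(o - 1 + 2 * 1 * ((i - 0) / 1)) -
      (o' + 4 * ((i - x₀) / 2)), ?_, ?_⟩⟩
    · rw [gridPos, intCast_mem_fine]
      omega
    · rw [abs_le]
      push_cast
      omega
    · rw [gridPos, vtx, ← Int.cast_add]
      congr 1
      ring

theorem circleDist_cells [NeZero N] (o : ℤ) (j : ZMod (2 * N)) :
    circleDist (cell N (o - 2) 2 (-1) j) (cell N o 2 0 j) ≤ 2 ∧
      circleDist (cell N o 2 0 j) (cell N (o - 2) 2 (-1) j) ≤ 2 := by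
  have : NeZero (2 * N) := ⟨by have := NeZero.ne N; omega⟩
  obtain ⟨i, -, -, rfl⟩ := exists_intCast_zmod 0 j
  rw [cell_two, cell_two]
  constructor
  · refine circleDist_le_iff.2 ⟨(o - 2 + 4 * ((i - -1) / 2)) - (o + 4 * ((i - 0) / 2)), ?_, ?_⟩
    · rw [abs_le]; push_cast; omega
    · rw [vtx, vtx, ← Int.cast_add]; congr 1; ring
  · refine circleDist_le_iff.2 ⟨(o + 4 * ((i - 0) / 2)) - (o - 2 + 4 * ((i - -1) / 2)), ?_, ?_⟩
    · rw [abs_le]; push_cast; omega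
    · rw [vtx, vtx, ← Int.cast_add]; congr 1; ring

/-- All the isomorphisms are the identity: only the grouping of the sites changes. -/
theorem Refinement.isElementary (h : Refinement X o l w Q Set.univ F E)
    (hv : VertexCuts X o l w Q) :
    IsElementary X (h.halfPartition hv) (StarAlgEquiv.refl (R := ℂ) (A := X.Ω)) := by
  have hN := hv.hN
  have hw := hv.hw
  have : NeZero N := ⟨by omega⟩
  refine ⟨?_, h.finePartition hv, StarAlgEquiv.refl (R := ℂ) (A := X.Ω),
    StarAlgEquiv.refl (R := ℂ) (A := X.Ω), ?_, ?_, rfl⟩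
  · intro S hS a ha
    rw [← h.setAlg_eq_alg hv hS] at ha
    refine setAlg_mono F (fun j hj => ?_) ha
    refine ⟨?_, _, hj, (circleDist_cells o j).1⟩
    rw [cell, ← vtx_eq_gridPos]
    exact vtx_mem hv.offset_half _
  · intro S hS
    refine Eq.trans (Set.image_id _) ?_
    rw [← h.setAlg_eq_alg hv hS, ← preimage_fine_nbhd (o := o) (x₀ := 0) hv.offset (by ring) hS]
    rfl
  · intro S hS
    refine Eq.trans (Set.image_id _) ?_
    change ((setAlg F (cell N (o - 1) 1 0 ⁻¹' (CyclicGraph.fine.nbhd S 1)) :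
      StarSubalgebra ℂ X.Ω) : Set X.Ω) = setAlg F (cell N (o - 2) 2 (-1) ⁻¹' S)
    rw [preimage_fine_nbhd (o := o) (o' := o - 2) (x₀ := -1) hv.offset_half (by ring) hS]

/-- Each algebra of the shifted partition lies in that of the old vertices within 1/2, and this
enlargement is paid once on each side. -/
theorem Refinement.correlationLengthLE (h : Refinement X o l w Q Set.univ F E)
    (hv : VertexCuts X o l w Q) : (h.halfPartition hv).CorrelationLengthLE (4 * (l + 1)) := by
  have hN := hv.hN
  have hw := hv.hw
  have : NeZero N := ⟨by omega⟩
  have hle : ∀ S : Set (Pos N), setAlg F (cell N (o - 2) 2 (-1) ⁻¹' S) ≤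
      X.alg ((CyclicGraph.coarse b).nbhd S 2) := by
    intro S
    rw [← h.setAlg_eq_alg hv (fun x hx => hx.1)]
    refine setAlg_mono F fun j hj => ⟨?_, _, hj, (circleDist_cells o j).2⟩
    rw [cell, ← vtx_eq_gridPos]
    exact vtx_mem hv.offset _
  intro S hS
  refine uncorrelated_mono (hv.corr ((CyclicGraph.coarse b).nbhd S 2) (fun x hx => hx.1)) (hle S)
    ((hle _).trans (X.isPartition.mono ?_ Set.sdiff_subset))
  rintro x ⟨hx, y, ⟨hy, hy'⟩, hxy⟩
  refine ⟨hx, ?_⟩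
  rintro ⟨-, z, ⟨hz, s, hs, hzs⟩, hxz⟩
  apply hy'
  refine ⟨hy, s, hs, ?_⟩
  rw [circleDist_le_iff] at *
  obtain ⟨t1, ht1, h1⟩ := hxy
  obtain ⟨t2, ht2, h2⟩ := hzs
  obtain ⟨t3, ht3, h3⟩ := hxz
  refine ⟨t2 + t3 - t1, ?_, ?_⟩
  · rw [abs_le] at *
    push_cast at *
    omega
  · push_cast
    linear_combination h2 + h3 - h1

end FactorPartition

/-! ### The radius drops by one half. -/

section Causality

namespace FactorPartition

variable {N : ℕ} {b b' : ZMod 2} {X : FactorPartition.{u} N (.coarse b)}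
  {Y : FactorPartition.{u} N (.coarse b')} {o : ℤ} {R l l' : ℕ} {U : X.Ω ≃⋆ₐ[ℂ] Y.Ω}

/-- The short arcs of the second partition define cuts of the vertices of the first one. -/
theorem vertexCuts_pullInt (hR : 1 ≤ R) (hl : l ≤ l') (hN : N > 2 * R + 2 * (l + l'))
    (ho : o % 4 = 2 * b.val) (ho' : (o - 2 * R) % 4 = 2 * b'.val)
    (hX : X.CorrelationLengthLE (4 * l)) (hU : HasCausalityRadius X Y (2 * R) U) :
    VertexCuts X o l (R + l')
      (fun m => pullInt Y U (o - 2 * R) (Set.Ico (m - l') (m + 1))) := by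
  have : NeZero N := ⟨by omega⟩
  refine ⟨ho, by omega, by omega, hX, fun m t => ?_, fun m => ?_⟩
  · rw [← pullInt_Ico_shift (m - l') (m + 1) t]
    congr 2 <;> ring
  · refine (pullInt_le_ialg ho' ho hU (by omega) (by omega)).trans
      (X.ialg_mono ho (Set.Ico_subset_Ico_left ?_))
    push_cast
    omega

variable {F : ZMod (2 * N) → ZMod (2 * N) → StarSubalgebra ℂ X.Ω}
  {E : ZMod (2 * N) → StarSubalgebra ℂ X.Ω}

/-- By `pullInt_le_of_short` the interval may be taken of length at most `l' + 1`. It then lies in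
the hull: its cone starts at vertex `i - R`, it commutes with `Q (i - R)` because the two output
intervals are disjoint, and it is contained in `Q (j - 1)`. The hull length is at most `R + l' + 1`,
which is why `w = R + l'`. -/
theorem pullInt_le_arc (hR : 1 ≤ R) (hN : N > 2 * R + 2 * (l + l'))
    (ho : o % 4 = 2 * b.val) (ho' : (o - 2 * R) % 4 = 2 * b'.val)
    (hY : Y.CorrelationLengthLE (4 * l')) (hU : HasCausalityRadius X Y (2 * R) U)
    (h : Refinement X o l (R + l')
      (fun m => pullInt Y U (o - 2 * R) (Set.Ico (m - l') (m + 1))) Set.univ F E) {n k : ℤ}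
    (h1 : n < k) (h2 : k - 1 < n - R + N) :
    pullInt Y U (o - 2 * R) (Set.Ico n k) ≤
      F ((2 * (n - R) + 1 : ℤ) : ZMod (2 * N)) ((2 * (k - 1) + 1 : ℤ) : ZMod (2 * N)) := by
  have : NeZero N := ⟨by omega⟩
  have m := fun i : ℤ => Set.mem_univ (i : ZMod (2 * N))
  refine pullInt_le_of_short ho' hY (by omega) h1 (by omega) fun i j h3 h4 h5 h6 => ?_
  have h7 := h.hull_le (2 * (i - R) + 1) (2 * (j - 1) + 1) (m _) (m _) (by omega)
    (by push_cast; omega)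
  refine le_trans ?_ (h7.trans (h.sys.sub (m _) (m _) (m _) (m _) (by push_cast; omega)))
  rw [hullAlg, if_neg (by omega), if_neg (by omega),
    show (2 * (i - R) + 1) / 2 = i - R by omega, show (2 * (j - 1) + 1) / 2 = j - 1 by omega,
    show (2 * (j - 1) + 1 + 1) / 2 = j by omega]
  refine le_inf (le_inf (pullInt_le_ialg ho' ho hU h4.le (by omega)) ?_) ?_
  · rw [commutant_pullInt ho' (by omega) (by omega)]
    exact pullInt_mono ho' (Set.Ico_subset_Ico (by omega) (by omega))
  · rw [leftAlg]
    exact le_sup_of_le_right (pullInt_mono ho' (Set.Ico_subset_Ico (by omega) (by omega)))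

/-- Commutants of `pullInt_le_arc` for the complementary interval, unless the output interval
already covers the circle. -/
theorem arc_le_pullInt (hR : 1 ≤ R) (hN : N > 2 * R + 2 * (l + l'))
    (ho : o % 4 = 2 * b.val) (ho' : (o - 2 * R) % 4 = 2 * b'.val)
    (hY : Y.CorrelationLengthLE (4 * l')) (hU : HasCausalityRadius X Y (2 * R) U)
    (h : Refinement X o l (R + l')
      (fun m => pullInt Y U (o - 2 * R) (Set.Ico (m - l') (m + 1))) Set.univ F E) {s e : ℤ}
    (h1 : s < e) (h2 : e < s + N) :
    F ((2 * s + 1 : ℤ) : ZMod (2 * N)) ((2 * e + 1 : ℤ) : ZMod (2 * N)) ≤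
      pullInt Y U (o - 2 * R) (Set.Ico (s + 1) (e + R)) := by
  have : NeZero N := ⟨by omega⟩
  have m := fun i : ℤ => Set.mem_univ (i : ZMod (2 * N))
  rcases le_or_gt (s + 1 + N) (e + R) with hc | hc
  · refine le_top.trans ?_
    have h3 := pullInt_mono (Y := Y) (U := U) ho'
      (Set.Ico_subset_Ico_right hc :
        Set.Ico (s + 1) (s + 1 + N) ⊆ Set.Ico (s + 1) (e + R))
    refine le_trans ?_ h3
    rw [pullInt, vset_Ico_full ho']
    intro x _
    rw [mem_pullAlg, Y.isPartition.whole]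
    trivial
  · have h3 := pullInt_le_arc hR hN ho ho' hY hU h (n := e + R - N) (k := s + 1) (by omega)
      (by omega)
    have h4 := commutant_anti h3
    rw [commutant_pullInt ho' (by omega) (by omega), h.sys.commutant_eq (m _) (m _)
      (by push_cast; omega)] at h4
    have h5 : ((2 * (e + R - N - R) + 1 : ℤ) : ZMod (2 * N)) =
        ((2 * e + 1 : ℤ) : ZMod (2 * N)) := by
      rw [← intCast_two_mul_add (2 * e + 1) (-1)]
      congr 1
      ring
    rw [h5, show s + 1 - 1 = s by ring, show e + R - N + (N : ℤ) = e + R by ring] at h4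
    exact h4

theorem halfPartition_radius (hR : 1 ≤ R) (hN : N > 2 * R + 2 * (l + l'))
    (ho' : (o - 2 * R) % 4 = 2 * b'.val)
    (hY : Y.CorrelationLengthLE (4 * l')) (hU : HasCausalityRadius X Y (2 * R) U)
    (hv : VertexCuts X o l (R + l')
      (fun m => pullInt Y U (o - 2 * R) (Set.Ico (m - l') (m + 1))))
    (h : Refinement X o l (R + l')
      (fun m => pullInt Y U (o - 2 * R) (Set.Ico (m - l') (m + 1))) Set.univ F E) :
    HasCausalityRadius (h.halfPartition hv) Y (2 * (R - 1)) U := by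
  have : NeZero N := ⟨by omega⟩
  have m := fun i : ℤ => Set.mem_univ (i : ZMod (2 * N))
  have ho := hv.offset
  have hoh := hv.offset_half
  intro S hS
  suffices hs : setAlg F (cell N (o - 2) 2 (-1) ⁻¹' S) ≤
      pullAlg Y U ((CyclicGraph.coarse b').nbhd S (2 * (R - 1))) from fun a ha => hs ha
  have hnb : ∀ n k : ℤ, n < k → vset N (o - 2) (Set.Ico n k) ⊆ S →
      vset N (o - 2 * R) (Set.Ico n (k - 1 + R)) ⊆
        (CyclicGraph.coarse b').nbhd S (2 * (R - 1)) := by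
    rintro n k hnk hsub _ ⟨i, ⟨h1, h2⟩, rfl⟩
    -- Output vertex `i` is within the reduced radius of the shifted vertices `i - R + 1` to `i`;
    -- the witness is the first of these in the interval.
    refine ⟨vtx_mem ho' i, vtx N (o - 2) (max n (i - R + 1)),
      hsub ⟨_, ⟨by omega, by omega⟩, rfl⟩, ?_⟩
    refine circleDist_le_iff.2 ⟨(o - 2 * R + 4 * i) - (o - 2 + 4 * max n (i - R + 1)), ?_, ?_⟩
    · rw [abs_le]
      omega
    · rw [vtx, vtx, ← Int.cast_add]
      congr 1
      ring
  by_cases huniv : (CyclicGraph.coarse (b + 1)).verts N ⊆ S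
  · have h1 := hnb 0 N (by omega) ((vset_subset hoh _).trans huniv)
    have h2 : (CyclicGraph.coarse b').nbhd S (2 * (R - 1)) = (CyclicGraph.coarse b').verts N := by
      refine Set.Subset.antisymm (fun x hx => hx.1) (le_trans ?_ h1)
      rw [← vset_Ico_full ho' 0]
      exact Set.image_mono (Set.Ico_subset_Ico_right (by omega))
    intro x _
    rw [mem_pullAlg, h2, Y.isPartition.whole]
    trivial
  refine setAlg_le ?_ fun x y h1 h2 h3 => ?_
  · intro he
    apply huniv
    intro p hp
    obtain ⟨n, -, -, rfl⟩ := exists_vtx hoh 0 hp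
    have : ((2 * n : ℤ) : ZMod (2 * N)) ∈ cell N (o - 2) 2 (-1) ⁻¹' S := by rw [he]; trivial
    rw [Set.mem_preimage, cell_two, show (2 * n - -1) / 2 = n by omega] at this
    exact this
  have hsub : vset N (o - 2) (Set.Ico ((x + 1) / 2) (y / 2 + 1)) ⊆ S := by
    rintro _ ⟨i, ⟨h4, h5⟩, rfl⟩
    have := h3 (max x (2 * i - 1)) (by omega) (by omega)
    rw [Set.mem_preimage, cell_two] at this
    rwa [show (max x (2 * i - 1) - -1) / 2 = i by omega] at this
  push_cast at h2
  have hlt : y / 2 + 1 < (x + 1) / 2 + N := by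
    by_contra hge
    apply huniv
    rw [← vset_Ico_full hoh ((x + 1) / 2)]
    exact (Set.image_mono (Set.Ico_subset_Ico_right (by omega))).trans hsub
  have h4 : F x y ≤ F ((2 * ((x + 1) / 2 - 1) + 1 : ℤ) : ZMod (2 * N))
      ((2 * (y / 2) + 1 : ℤ) : ZMod (2 * N)) :=
    h.sys.sub (m _) (m _) (m _) (m _) (by push_cast; omega)
  have h5 := arc_le_pullInt hR hN ho ho' hY hU h (s := (x + 1) / 2 - 1) (e := y / 2) (by omega)
    (by omega)
  refine h4.trans (h5.trans (pullAlg_mono ?_ fun p hp => hp.1))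
  have h6 := hnb _ _ (by omega) hsub
  rwa [show y / 2 + 1 - 1 = y / 2 by ring,
    show (x + 1) / 2 = (x + 1) / 2 - 1 + 1 by ring] at h6

/-- The first factor of a generalised QCA. -/
theorem exists_first_factor (hR : 1 ≤ R) (hl : l ≤ l') (hN : N > 2 * R + 2 * (l + l'))
    (hb : b' = b + (R : ZMod 2)) (hX : X.CorrelationLengthLE (4 * l))
    (hY : Y.CorrelationLengthLE (4 * l')) (hU : HasCausalityRadius X Y (2 * R) U) :
    ∃ (C : FactorPartition.{u} N (.coarse (b + 1))) (V : X.Ω ≃⋆ₐ[ℂ] C.Ω), IsElementary X C V ∧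
      C.CorrelationLengthLE (4 * (l + 1)) ∧
      HasCausalityRadius C Y (2 * (R - 1)) (V.symm.trans U) := by
  have ho : (2 * b.val : ℤ) % 4 = 2 * b.val := by
    have := ZMod.val_lt b
    omega
  have ho' : (2 * b.val - 2 * R : ℤ) % 4 = 2 * b'.val := by
    have h1 : (b'.val : ℤ) = (b.val + R) % 2 := by
      rw [hb, ZMod.val_add, ZMod.val_natCast]
      push_cast
      omega
    omega
  have hv := vertexCuts_pullInt hR hl hN ho ho' hX hU
  obtain ⟨F, E, h⟩ := hv.exists_refinement
  exact ⟨h.halfPartition hv, StarAlgEquiv.refl (R := ℂ) (A := X.Ω), h.isElementary hv,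
    h.correlationLengthLE hv, halfPartition_radius hR hN ho' hY hU hv h⟩

end FactorPartition

end Causality

/-! ### Inverses, products and the induction on the radius. -/

namespace FactorPartition

variable {N : ℕ} {b b' : ZMod 2} {X : FactorPartition.{u} N (.coarse b)}
  {Y : FactorPartition.{u} N (.coarse b')} {U : X.Ω ≃⋆ₐ[ℂ] Y.Ω}

theorem circleDist_le_symm [NeZero N] {x y : Pos N} {ρ : ℕ} (h : circleDist x y ≤ ρ) :
    circleDist y x ≤ ρ := by
  rw [circleDist_le_iff] at *
  obtain ⟨t, ht, h1⟩ := h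
  refine ⟨-t, by rwa [abs_neg], ?_⟩
  push_cast
  linear_combination -h1

/-- Causality is self-dual: apply it to the complement of the neighbourhood of `S` and take
commutants. -/
theorem HasCausalityRadius.symm [NeZero N] {ρ : ℕ} (h : HasCausalityRadius X Y ρ U) :
    HasCausalityRadius Y X ρ U.symm := by
  intro S hS y hy
  have h1 : pullAlg Y U S ≤ X.alg ((CyclicGraph.coarse b).nbhd S ρ) := by
    have h2 : X.alg ((CyclicGraph.coarse b).verts N \ (CyclicGraph.coarse b).nbhd S ρ) ≤
        pullAlg Y U ((CyclicGraph.coarse b').verts N \ S) := by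
      refine le_trans (fun a ha => h _ Set.sdiff_subset a ha)
        (pullAlg_mono (U := U) ?_ Set.sdiff_subset)
      rintro x ⟨hx, z, hz, hd⟩
      exact ⟨hx, fun hxS => hz.2 ⟨hz.1, x, hxS, circleDist_le_symm hd⟩⟩
    have h3 := commutant_anti h2
    rwa [commutant_pullAlg Set.sdiff_subset, Set.sdiff_sdiff_cancel_left hS,
      X.isPartition.commutant_eq X.factor Set.sdiff_subset,
      Set.sdiff_sdiff_cancel_left (fun x hx => hx.1)] at h3
  exact h1 (mem_pullAlg.2 (by rwa [U.apply_symm_apply]))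

theorem image_symm_eq {Ω Ω' : Type*} [CStarAlgebra Ω] [CStarAlgebra Ω'] (V : Ω ≃⋆ₐ[ℂ] Ω')
    {S : Set Ω} {T : Set Ω'} (h : V '' S = T) : V.symm '' T = S := by
  rw [← h, Set.image_image]
  simp

theorem IsElementary.symm [NeZero N] (h : IsElementary X Y U) : IsElementary Y X U.symm := by
  obtain ⟨W, V₁, V₂, h1, h2, rfl⟩ := h.decomposition
  exact ⟨h.radius.symm, W, V₂.symm, V₁.symm, fun S hS => image_symm_eq V₂ (h2 S hS),
    fun S hS => image_symm_eq V₁ (h1 S hS), rfl⟩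

theorem nbhd_zero [NeZero N] {G : CyclicGraph} {S : Set (Pos N)} (hS : S ⊆ G.verts N) :
    G.nbhd S 0 = S := by
  have h0 : ∀ x y : Pos N, circleDist x y ≤ 0 ↔ x = y := by
    intro x y
    rw [circleDist_le_iff]
    constructor
    · rintro ⟨t, ht, h⟩
      have : t = 0 := abs_nonpos_iff.1 ht
      simpa [this] using h
    · rintro rfl
      exact ⟨0, by simp, by simp⟩
  ext x
  constructor
  · rintro ⟨-, y, hy, hd⟩
    rwa [(h0 x y).1 hd]
  · exact fun hx => ⟨hS hx, x, hx, (h0 x x).2 rfl⟩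

/-- An isomorphism of radius zero carries each algebra exactly onto its counterpart, so it can be
absorbed in the coarse-graining. -/
theorem IsElementary.trans_radius_zero [NeZero N] {Z : FactorPartition.{u} N (.coarse b')}
    {V : Y.Ω ≃⋆ₐ[ℂ] Z.Ω} (h : IsElementary X Y U) (hV : HasCausalityRadius Y Z 0 V) :
    IsElementary X Z (U.trans V) := by
  obtain ⟨W, V₁, V₂, h1, h2, rfl⟩ := h.decomposition
  have h3 : ∀ S ⊆ (CyclicGraph.coarse b').verts N, V '' (Y.alg S : Set Y.Ω) = Z.alg S := by
    intro S hS
    apply Set.Subset.antisymm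
    · rintro _ ⟨a, ha, rfl⟩
      have := hV S hS a ha
      rwa [nbhd_zero hS] at this
    · intro z hz
      have := hV.symm S hS z hz
      rw [nbhd_zero hS] at this
      exact ⟨_, this, V.apply_symm_apply z⟩
  refine ⟨fun S hS a ha => ?_, W, V₁, V₂.trans V, h1, fun S hS => ?_, rfl⟩
  · have := h.radius S hS a ha
    have h4 := h3 ((CyclicGraph.coarse b').nbhd S 2) fun x hx => hx.1
    exact h4.subset ⟨_, this, rfl⟩
  · rw [← h3 S hS, ← h2 S hS, Set.image_image]
    rfl

theorem IsElementary.isProduct {X : FactorPartition.{u} N (.coarse b)}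
    {Y : FactorPartition.{u} N (.coarse b')} {U : X.Ω ≃⋆ₐ[ℂ] Y.Ω} (hb : b' = b + 1)
    (h : IsElementary X Y U) : IsProduct 1 X Y U := by
  subst hb
  exact IsProduct.cons X Y Y U (StarAlgEquiv.refl ℂ Y.Ω) h (IsProduct.nil Y)

theorem IsProduct.snoc {n : ℕ} {c : ZMod 2} {C : FactorPartition.{u} N (.coarse c)}
    {U₁ : X.Ω ≃⋆ₐ[ℂ] C.Ω} {U₂ : C.Ω ≃⋆ₐ[ℂ] Y.Ω} (h : IsProduct n X C U₁) (hb : b' = c + 1)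
    (h₂ : IsElementary C Y U₂) : IsProduct (n + 1) X Y (U₁.trans U₂) := by
  induction h with
  | nil X => exact h₂.isProduct hb
  | cons X Y' Z V V' hV _ ih => exact IsProduct.cons X Y' Y V (V'.trans U₂) hV (ih hb h₂)

theorem isElementary_of_radius_one [NeZero N] {l l' : ℕ} (hN : N > 2 * 1 + 2 * (l + l'))
    (hb : b' = b + 1) (hX : X.CorrelationLengthLE (4 * l)) (hY : Y.CorrelationLengthLE (4 * l'))
    (hl : l ≤ l') (hU : HasCausalityRadius X Y (2 * 1) U) : IsElementary X Y U := by
  obtain ⟨C, V, h1, -, h2⟩ := exists_first_factor le_rfl hl hN (by simpa using hb) hX hY hU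
  subst hb
  have h3 := h1.trans_radius_zero h2
  rwa [show V.trans (V.symm.trans U) = U from StarAlgEquiv.ext fun x => by simp] at h3

/-- Each peeling lowers `n + 1` by one and raises one correlation length by one, which keeps the
bound on `N`. The correlation lengths are quantified inside the induction since either may grow. -/
theorem isProduct_of_radius {n : ℕ} :
    ∀ {l l' : ℕ} {b b' : ZMod 2} {X : FactorPartition.{u} N (.coarse b)}
      {Y : FactorPartition.{u} N (.coarse b')} {U : X.Ω ≃⋆ₐ[ℂ] Y.Ω},
      N > 2 * (n + 1) + 2 * (l + l') → b' = b + ((n + 1 : ℕ) : ZMod 2) →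
      X.CorrelationLengthLE (4 * l) → Y.CorrelationLengthLE (4 * l') →
      HasCausalityRadius X Y (2 * (n + 1)) U → IsProduct (n + 1) X Y U := by
  induction n with
  | zero =>
    intro l l' b b' X Y U hN hb hX hY hU
    have : NeZero N := ⟨by omega⟩
    have hb1 : b' = b + 1 := by simpa using hb
    refine IsElementary.isProduct hb1 ?_
    rcases le_total l l' with hl | hl
    · exact isElementary_of_radius_one hN hb1 hX hY hl hU
    · refine (isElementary_of_radius_one (by omega) ?_ hY hX hl hU.symm).symm
      rw [hb1, add_assoc, CharTwo.add_self_eq_zero, add_zero]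
  | succ n ih =>
    intro l l' b b' X Y U hN hb hX hY hU
    have : NeZero N := ⟨by omega⟩
    rcases le_total l l' with hl | hl
    · obtain ⟨C, V, h1, h2, h3⟩ := exists_first_factor (by omega) hl hN hb hX hY hU
      have h4 : IsProduct (n + 1) C Y (V.symm.trans U) :=
        ih (l := l + 1) (by omega) (by rw [hb]; push_cast; ring) h2 hY h3
      have h5 := IsProduct.cons X C Y V _ h1 h4
      rwa [show V.trans (V.symm.trans U) = U from StarAlgEquiv.ext fun x => by simp] at h5
    · have hb2 : b = b' + ((n + 1 + 1 : ℕ) : ZMod 2) := by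
        rw [hb, add_assoc, CharTwo.add_self_eq_zero, add_zero]
      -- When `l' ≤ l` the first factor of the inverse is peeled off; its inverse becomes the last
      -- factor of `U`.
      obtain ⟨C, V, h1, h2, h3⟩ := exists_first_factor (by omega) hl (by omega) hb2 hY hX hU.symm
      have h4 : IsProduct (n + 1) X C (V.symm.trans U.symm).symm := by
        refine ih (l' := l' + 1) (by omega) ?_ hX h2 h3.symm
        rw [hb, ← sub_eq_zero]
        push_cast
        linear_combination CharTwo.add_self_eq_zero (1 : ZMod 2)
      have h5 := h4.snoc (Y := Y)
        (by rw [add_assoc, CharTwo.add_self_eq_zero, add_zero]) h1.symm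
      rwa [show (V.symm.trans U.symm).symm.trans V.symm = U from
        StarAlgEquiv.ext fun x => by simp] at h5

end FactorPartition

/-- The causality radius is `r = R / 2`; it is an integer when the input and the output partitions
are over the same graph, and half an odd integer when one of them is over `Γ_N` and the other one
over `Γ_N^{+1/2}`. -/
theorem mainTheorem1 (N R l l' : ℕ) (hR : 1 ≤ R) (hN : N > 2 * R + 2 * (l + l'))
    (b b' : ZMod 2) (hb : b' = b + (R : ZMod 2))
    (X : FactorPartition.{u} N (.coarse b)) (Y : FactorPartition.{u} N (.coarse b'))
    (hX : X.CorrelationLengthLE (4 * l)) (hY : Y.CorrelationLengthLE (4 * l'))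
    (U : X.Ω ≃⋆ₐ[ℂ] Y.Ω) (hU : FactorPartition.HasCausalityRadius X Y (2 * R) U) :
    FactorPartition.IsProduct R X Y U := by
  obtain ⟨n, rfl⟩ : ∃ n, R = n + 1 := ⟨R - 1, by omega⟩
  exact FactorPartition.isProduct_of_radius hN hb hX hY hU
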